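/- Let $n\in\mathbb N$, $\hbar>0$, $\varkappa\in\mathbb R$, $\hat z=(\hat{\vec p},\vec x)=(-i\hbar\partial_{\vec x},\vec x)$, $\hat w=(-i\hbar\partial_{\vec y},\vec y)$, $J=\begin{pmatrix}0&-\mathbb I\\ \mathbb I&0\end{pmatrix}$, and let $\mathcal H_{zz},W_{zz},W_{ww}$ (symmetric) and $W_{zw}$ be real $2n\times2n$ matrices and $\mathcal H_z$ a real $2n$-vector, all depending smoothly on $t\in\mathbb R$. Put $$\mathcal H(\hat z,t)=\tfrac12\langle\hat z,\mathcal H_{zz}\hat z\rangle+\langle\mathcal H_z,\hat z\rangle,\qquad V(\hat z,\hat w,t)=\tfrac12\langle\hat z,W_{zz}\hat z\rangle+\langle\hat z,W_{zw}\hat w\rangle+\tfrac12\langle\hat w,W_{ww}\hat w\rangle ,$$ and consider the nonlocal Gross--Pitaevskii equation (GPE) $$\Big\{-i\hbar\partial_t+\mathcal H(\hat z,t)+\varkappa\int_{\mathbb R^n}d\vec y\,\Psi^*(\vec y,t)V(\hat z,\hat w,t)\Psi(\vec y,t)\Big\}\Psi(\vec x,t)=0 .$$ Here $\hbar$ is fixed.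 $\mathcal P^t_\hbar$ is the class of functions $\varphi\big(\tfrac{\vec x-\vec X(t)}{\sqrt\hbar},t\big)\exp\{\tfrac i\hbar[S(t)+\langle\vec P(t),\vec x-\vec X(t)\rangle]\}$, where $S,\vec P,\vec X$ are real and smooth in $t\in\mathbb R$ and $t\mapsto\varphi(\cdot,t)$ is a smooth curve in the Schwartz space $\mathcal S(\mathbb R^n)$; $\mathcal P^0_\hbar$ is the class of functions of $\vec x$ of the same form with $t=0$. Solutions of the GPE are understood in the class $\mathcal P^t_\hbar$, for all $t\in\mathbb R$. For $\tilde\varkappa\in\mathbb R$ the Hamilton--Ehrenfest system (HES) for $\mathfrak g=(z,\Delta)$ is $$\dot z=J\mathfrak H_z,\qquad \dot\Delta=J\mathfrak H_{zz}\Delta-\Delta\mathfrak H_{zz}J,$$ with $\mathfrak H_{zz}=\mathcal H_{zz}+\tilde\varkappa W_{zz}$ and $\mathfrak H_z=\mathcal H_z+(\mathcal H_{zz}+\tilde\varkappa W_{zz}+\tilde\varkappa W_{zw})z$. The linear associated Schrödinger equation (LASE) along a solution $\mathfrak g(t)$ of the HES is $$\big\{-i\hbar\partial_t+\mathfrak H+\langle\mathfrak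 H_z,\Delta\hat z\rangle+\tfrac12\langle\Delta\hat z,\mathfrak H_{zz}\Delta\hat z\rangle\big\}\Phi=0,\qquad \Delta\hat z=\hat z-z(t),$$ $$\mathfrak H=\tfrac12\langle z,[\mathcal H_{zz}+\tilde\varkappa(W_{zz}+2W_{zw}+W_{ww})]z\rangle+\langle\mathcal H_z,z\rangle+\tfrac12\tilde\varkappa\,\mathrm{Sp}(W_{ww}\Delta).$$ Its Green operator $G(t,s)$ is the family of continuous linear operators on $\mathcal S(\mathbb R^n)$, given by the Green function of the LASE as (distributional) kernel, such that for each $\psi\in\mathcal S(\mathbb R^n)$ the curve $t\mapsto G(t,s)\psi$ is smooth in $\mathcal S(\mathbb R^n)$, satisfies the LASE, and tends to $\psi$ as $t\to s$. For $\psi\in\mathcal S(\mathbb R^n)$ let $\mathfrak g_0(\psi)=(z_\psi,\Delta_\psi)$ consist of the mean values $z_\psi=\langle\psi|\hat z|\psi\rangle/\|\psi\|^2$ and the centred symmetrized second moments of $\hat z$ in the state $\psi$ (taken to be $0$ if $\psi=0$). The nonlinear evolution operator is $\hat U_\varkappa(t,s,\psi)=G(t,s)\psi$, where $\tilde\varkappa=\varkappa\|\psi\|^2$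 and $\mathfrak g$ is the solution of the HES with $\mathfrak g(s)=\mathfrak g_0(\psi)$; the inverse operator is $\hat U^{-1}_\varkappa(t,s,\psi)=G(s,t)\psi$, where $\tilde\varkappa=\varkappa\|\psi\|^2$ and $\mathfrak g$ is the solution of the HES with $\mathfrak g(t)=\mathfrak g_0(\psi)$. Write $\hat U_\varkappa(t,\cdot)=\hat U_\varkappa(t,0,\cdot)$ and $\hat U^{-1}_\varkappa(t,\cdot)=\hat U^{-1}_\varkappa(t,0,\cdot)$. Then: (0) These operators are well defined: for all $\tilde\varkappa$, $s$ and initial values $\mathfrak g_0$ the HES has exactly one solution on $\mathbb R$ with $\mathfrak g(s)=\mathfrak g_0$, and for all $\tilde\varkappa$, $s$ the LASE along any solution of the HES has exactly one Green operator. (1) Let $\hat{\mathsf a}:\mathcal P^0_\hbar\to\mathcal P^0_\hbar$ be any operator. If $\Psi$ is a solution of the GPE, then $$\hat{\mathsf A}(\Psi(t))=\hat U_\varkappa\big(t,\hat{\mathsf a}\,\hat U_\varkappa^{-1}(t,\Psi(t))\big)$$ is also a solution of the GPE; that is, $\hat{\mathsf A}(\cdot)$ is a symmetry operator. (2) Let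 $\hat{\mathsf b}:\mathcal P^0_\hbar\to\mathcal P^0_\hbar$ have an operator exponential $\exp(\alpha\hat{\mathsf b}):\mathcal P^0_\hbar\to\mathcal P^0_\hbar$, $\alpha\in\mathbb R$; that is, for every $\psi\in\mathcal P^0_\hbar$ the curve $\alpha\mapsto\exp(\alpha\hat{\mathsf b})\psi$ is the unique solution in $\mathcal P^0_\hbar$ of $\frac{d}{d\alpha}\psi_\alpha=\hat{\mathsf b}\psi_\alpha$, $\psi_0=\psi$ (derivative in $\mathcal S(\mathbb R^n)$). Then the operators $$\hat{\mathsf B}(\alpha,\Psi(t))=\hat U_\varkappa\big(t,\exp\{\alpha\hat{\mathsf b}\}\,\hat U_\varkappa^{-1}(t,\Psi(t))\big)$$ map solutions of the GPE to solutions of the GPE, and for all $\alpha,\beta,t\in\mathbb R$ and all $\Psi\in\mathcal P^t_\hbar$ $$\hat{\mathsf B}(\alpha+\beta,\Psi(t))=\hat{\mathsf B}\big(\alpha,\hat{\mathsf B}(\beta,\Psi(t))\big).$$ -/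

import Mathlib

open scoped ContDiff SchwartzMap Topology

noncomputable section

namespace NonlocalGPE

/-- The configuration space `ℝⁿ`. -/
abbrev Cfg (n : ℕ) : Type := EuclideanSpace ℝ (Fin n)

/-- The index set of the phase-space coordinates `z = (p, x)`: `Sum.inl j` stands for `p_j` and
`Sum.inr j` for `x_j`. -/
abbrev PIdx (n : ℕ) : Type := Fin n ⊕ Fin n

/-- Complex-valued Schwartz functions on `ℝⁿ`. -/
abbrev Sch (n : ℕ) : Type := 𝓢(Cfg n, ℂ)

/-- The data of the Gross--Pitaevskii equation with quadratic external and nonlocal potentials. -/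
structure Data (n : ℕ) where
  hbar : ℝ
  hbar_pos : 0 < hbar
  kappa : ℝ
  Hzz : ℝ → Matrix (PIdx n) (PIdx n) ℝ
  Hz : ℝ → PIdx n → ℝ
  Wzz : ℝ → Matrix (PIdx n) (PIdx n) ℝ
  Wzw : ℝ → Matrix (PIdx n) (PIdx n) ℝ
  Www : ℝ → Matrix (PIdx n) (PIdx n) ℝ
  Hzz_symm : ∀ t, (Hzz t).IsSymm
  Wzz_symm : ∀ t, (Wzz t).IsSymm
  Www_symm : ∀ t, (Www t).IsSymm
  Hzz_smooth : ∀ j k, ContDiff ℝ ∞ (fun t => Hzz t j k)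
  Hz_smooth : ∀ j, ContDiff ℝ ∞ (fun t => Hz t j)
  Wzz_smooth : ∀ j k, ContDiff ℝ ∞ (fun t => Wzz t j k)
  Wzw_smooth : ∀ j k, ContDiff ℝ ∞ (fun t => Wzw t j k)
  Www_smooth : ∀ j k, ContDiff ℝ ∞ (fun t => Www t j k)

/-! ### Curves of Schwartz functions -/

/-- The curve `u` in a topological vector space has derivative `v` at `t`. -/
def HasCurveDerivAt {V : Type*} [AddCommGroup V] [Module ℝ V] [TopologicalSpace V]
    (u : ℝ → V) (v : V) (t : ℝ) : Prop :=
  Filter.Tendsto (fun h : ℝ => h⁻¹ • (u (t + h) - u t)) (𝓝[≠] 0) (𝓝 v)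

/-- Infinitely differentiable curves in a topological vector space. -/
def IsSmoothCurve {V : Type*} [AddCommGroup V] [Module ℝ V] [TopologicalSpace V]
    (u : ℝ → V) : Prop :=
  ∃ d : ℕ → ℝ → V, d 0 = u ∧ ∀ k t, HasCurveDerivAt (d k) (d (k + 1) t) t

/-! ### Trajectory concentrated functions -/

/-- The class of initial functions
`exp(i/ħ (S₀ + ⟨P₀, x - X₀⟩)) φ₀((x - X₀)/√ħ)` with `φ₀` a Schwartz function. -/
def P0 {n : ℕ} (hbar : ℝ) : Set (Sch n) :=
  {ψ | ∃ (φ₀ : Sch n) (S₀ : ℝ) (P₀ X₀ : Cfg n), ∀ x : Cfg n,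
    ψ x = Complex.exp (Complex.I / hbar * ((S₀ + inner ℝ P₀ (x - X₀) : ℝ) : ℂ)) *
      φ₀ ((Real.sqrt hbar)⁻¹ • (x - X₀))}

/-- The class of functions `Φ(x,t) = φ((x - X(t))/√ħ, t) exp(i/ħ (S(t) + ⟨P(t), x - X(t)⟩))`, where
`φ` is Schwartz in its first argument and everything depends smoothly on `t`. -/
def Pt {n : ℕ} (hbar : ℝ) : Set (ℝ → Sch n) :=
  {Φ | ∃ (φ : ℝ → Sch n) (S : ℝ → ℝ) (P X : ℝ → Cfg n),
    IsSmoothCurve φ ∧ ContDiff ℝ ∞ S ∧ ContDiff ℝ ∞ P ∧ ContDiff ℝ ∞ X ∧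
    ∀ (t : ℝ) (x : Cfg n),
      Φ t x = φ t ((Real.sqrt hbar)⁻¹ • (x - X t)) *
        Complex.exp (Complex.I / hbar * ((S t + inner ℝ (P t) (x - X t) : ℝ) : ℂ))}

/-! ### Operators of momentum and position, and the nonlinear equation -/

/-- The operators `ẑ = (p̂, x)`, `p̂_j = -iħ ∂/∂x_j`. -/
def zhat {n : ℕ} (hbar : ℝ) : PIdx n → (Cfg n → ℂ) → (Cfg n → ℂ)
  | Sum.inl j, f => fun x =>
      -Complex.I * (hbar : ℂ) * fderiv ℝ f x (EuclideanSpace.single j 1)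
  | Sum.inr j, f => fun x => ((x j : ℝ) : ℂ) * f x

/-- `ẑ_j` acting on the first variable of a function of `(x, y)`. -/
def zhat₁ {n : ℕ} (hbar : ℝ) (j : PIdx n) (F : Cfg n → Cfg n → ℂ) : Cfg n → Cfg n → ℂ :=
  fun x y => zhat hbar j (fun x' => F x' y) x

/-- `ŵ_j`: the same operator acting on the second variable of a function of `(x, y)`. -/
def what₂ {n : ℕ} (hbar : ℝ) (j : PIdx n) (F : Cfg n → Cfg n → ℂ) : Cfg n → Cfg n → ℂ :=
  fun x y => zhat hbar j (F x) y

variable {n : ℕ}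

/-- `H(ẑ,t) = ½⟨ẑ, H_zz(t) ẑ⟩ + ⟨H_z(t), ẑ⟩`. As `H_zz` is symmetric, this is Weyl-ordered. -/
def Data.Hop (Q : Data n) (t : ℝ) (f : Cfg n → ℂ) : Cfg n → ℂ := fun x =>
  (1 / 2) * ∑ j, ∑ k, (Q.Hzz t j k : ℂ) * zhat Q.hbar j (zhat Q.hbar k f) x +
    ∑ j, (Q.Hz t j : ℂ) * zhat Q.hbar j f x

/-- `V(ẑ,ŵ,t) = ½⟨ẑ, W_zz(t) ẑ⟩ + ⟨ẑ, W_zw(t) ŵ⟩ + ½⟨ŵ, W_ww(t) ŵ⟩`, acting on functions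
of `(x, y)`. -/
def Data.Vop (Q : Data n) (t : ℝ) (F : Cfg n → Cfg n → ℂ) : Cfg n → Cfg n → ℂ := fun x y =>
  (1 / 2) * ∑ j, ∑ k, (Q.Wzz t j k : ℂ) * zhat₁ Q.hbar j (zhat₁ Q.hbar k F) x y +
    ∑ j, ∑ k, (Q.Wzw t j k : ℂ) * zhat₁ Q.hbar j (what₂ Q.hbar k F) x y +
    (1 / 2) * ∑ j, ∑ k, (Q.Www t j k : ℂ) * what₂ Q.hbar j (what₂ Q.hbar k F) x y

/-- `V̂(t,ψ)ψ (x) = ∫ dy ψ*(y) V(ẑ,ŵ,t) ψ(y) ψ(x)`. -/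
def Data.Hartree (Q : Data n) (t : ℝ) (ψ : Cfg n → ℂ) : Cfg n → ℂ := fun x =>
  ∫ y, (starRingEnd ℂ) (ψ y) * Q.Vop t (fun x' y' => ψ x' * ψ y') x y

/-- `Ψ` is a solution, in the class of trajectory concentrated functions, of the equation
`{-iħ ∂_t + H(ẑ,t) + ϰ V̂(t,Ψ(t))} Ψ = 0`. -/
def Data.IsGPESolution (Q : Data n) (Ψ : ℝ → Sch n) : Prop :=
  Ψ ∈ Pt Q.hbar ∧
  ∀ (t : ℝ) (x : Cfg n),
    -Complex.I * (Q.hbar : ℂ) * deriv (fun τ => Ψ τ x) t +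
      Q.Hop t (Ψ t) x + (Q.kappa : ℂ) * Q.Hartree t (Ψ t) x = 0

/-! ### Mean values and the Hamilton--Ehrenfest system -/

/-- `‖ψ‖²`. -/
def normSq (ψ : Cfg n → ℂ) : ℝ := ∫ x, ‖ψ x‖ ^ 2

/-- The mean value `⟨ψ|A ψ⟩ / ‖ψ‖²` (zero for `ψ = 0`) of a symmetric operator `A`; it is real. -/
def mean (A : (Cfg n → ℂ) → (Cfg n → ℂ)) (ψ : Cfg n → ℂ) : ℝ :=
  (normSq ψ)⁻¹ * (∫ x, (starRingEnd ℂ) (ψ x) * A ψ x).re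

/-- `Δẑ_j = ẑ_j - z_j`. -/
def dzhat (hbar : ℝ) (z : PIdx n → ℝ) (j : PIdx n) (f : Cfg n → ℂ) : Cfg n → ℂ := fun x =>
  zhat hbar j f x - (z j : ℂ) * f x

/-- The first moments `z_ψ`. -/
def zMean (hbar : ℝ) (ψ : Cfg n → ℂ) : PIdx n → ℝ := fun j => mean (zhat hbar j) ψ

/-- The centred second moments `½⟨Δẑ_j Δẑ_k + Δẑ_k Δẑ_j⟩`. -/
def DeltaMean (hbar : ℝ) (ψ : Cfg n → ℂ) : Matrix (PIdx n) (PIdx n) ℝ :=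
  Matrix.of fun j k => 1 / 2 * mean (fun f => fun x =>
    dzhat hbar (zMean hbar ψ) j (dzhat hbar (zMean hbar ψ) k f) x +
      dzhat hbar (zMean hbar ψ) k (dzhat hbar (zMean hbar ψ) j f) x) ψ

/-- Points `g = (z, Δ)` of the phase space of first and second moments. -/
abbrev Moments (n : ℕ) : Type := (PIdx n → ℝ) × Matrix (PIdx n) (PIdx n) ℝ

/-- `g₀(ψ)`: the first and second moments of `ψ`. -/
def moments (hbar : ℝ) (ψ : Cfg n → ℂ) : Moments n := (zMean hbar ψ, DeltaMean hbar ψ)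

/-- `𝔥_zz(t) = H_zz(t) + ϰ̃ W_zz(t)`. -/
def Data.hzz (Q : Data n) (κt t : ℝ) : Matrix (PIdx n) (PIdx n) ℝ := Q.Hzz t + κt • Q.Wzz t

/-- `𝔥_z = H_z(t) + (H_zz(t) + ϰ̃ W_zz(t) + ϰ̃ W_zw(t)) z`. -/
def Data.hz (Q : Data n) (κt t : ℝ) (z : PIdx n → ℝ) : PIdx n → ℝ :=
  Q.Hz t + (Q.Hzz t + κt • (Q.Wzz t + Q.Wzw t)).mulVec z

/-- `𝔥 = ½⟨z, [H_zz + ϰ̃ (W_zz + 2 W_zw + W_ww)] z⟩ + ⟨H_z, z⟩ + ½ ϰ̃ Sp(W_ww Δ)`. -/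
def Data.h0 (Q : Data n) (κt t : ℝ) (g : Moments n) : ℝ :=
  1 / 2 * (g.1 ⬝ᵥ
      (Q.Hzz t + κt • (Q.Wzz t + (2 : ℝ) • Q.Wzw t + Q.Www t)).mulVec g.1) +
    Q.Hz t ⬝ᵥ g.1 + 1 / 2 * κt * (Q.Www t * g.2).trace

/-- The Hamilton--Ehrenfest system of second order, with nonlinearity parameter `ϰ̃`:
`ż = J 𝔥_z(t, z)`, `Δ̇ = J 𝔥_zz Δ - Δ 𝔥_zz J`. -/
def Data.IsHESSolution (Q : Data n) (κt : ℝ) (g : ℝ → Moments n) : Prop :=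
  (∀ t j, HasDerivAt (fun τ => (g τ).1 j)
      ((Matrix.J (Fin n) ℝ).mulVec (Q.hz κt t (g t).1) j) t) ∧
  (∀ t j k, HasDerivAt (fun τ => (g τ).2 j k)
      ((Matrix.J (Fin n) ℝ * Q.hzz κt t * (g t).2 -
        (g t).2 * Q.hzz κt t * Matrix.J (Fin n) ℝ) j k) t)

/-- The solution of the Hamilton--Ehrenfest system with value `g₀` at time `s`. -/
def Data.hes (Q : Data n) (κt s : ℝ) (g₀ : Moments n) : ℝ → Moments n :=
  Classical.epsilon fun g => Q.IsHESSolution κt g ∧ g s = g₀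

/-! ### The linear associated Schrödinger equation and its Green function -/

/-- The quadratic operator `𝔥 + ⟨𝔥_z, Δẑ⟩ + ½⟨Δẑ, 𝔥_zz Δẑ⟩`, `Δẑ = ẑ - z`, of the linear
associated Schrödinger equation at the point `g = (z, Δ)`. -/
def Data.lase (Q : Data n) (κt t : ℝ) (g : Moments n) (f : Cfg n → ℂ) : Cfg n → ℂ := fun x =>
  (Q.h0 κt t g : ℂ) * f x +
    ∑ j, (Q.hz κt t g.1 j : ℂ) * dzhat Q.hbar g.1 j f x +
    (1 / 2) * ∑ j, ∑ k, (Q.hzz κt t j k : ℂ) *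
      dzhat Q.hbar g.1 j (dzhat Q.hbar g.1 k f) x

/-- `G t` is the operator `ψ ↦ ∫ G(·, y, t, s) ψ(y) dy` whose (distributional) kernel is the Green
function of the linear associated Schrödinger equation along `g`: each `G t ψ` satisfies
`{-iħ ∂_t + 𝔥̂(t, g(t))} G = 0`, depends smoothly on `t`, and `G t → 1` (that is, the kernel tends
to `δ(x - y)`) as `t → s`. -/
def Data.IsGreen (Q : Data n) (κt s : ℝ) (g : ℝ → Moments n) (G : ℝ → Sch n →L[ℂ] Sch n) : Prop :=
  ∀ ψ : Sch n,
    IsSmoothCurve (fun t => G t ψ) ∧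
    (∀ (t : ℝ) (x : Cfg n),
      -Complex.I * (Q.hbar : ℂ) * deriv (fun τ => G τ ψ x) t +
        Q.lase κt t (g t) (G t ψ) x = 0) ∧
    Filter.Tendsto (fun t => G t ψ) (𝓝 s) (𝓝 ψ)

/-- The Green operator of the linear associated Schrödinger equation along `g`. -/
def Data.green (Q : Data n) (κt s : ℝ) (g : ℝ → Moments n) : ℝ → Sch n →L[ℂ] Sch n :=
  Classical.epsilon fun G => Q.IsGreen κt s g G

/-! ### The nonlinear evolution operator and the symmetry operators -/

/-- The nonlinear evolution operator `Û(t,s,ψ)`: the Green operator from time `s` to time `t` of the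
linear associated Schrödinger equation, with `ϰ̃ = ϰ‖ψ‖²` and with `g(t)` the solution of the
Hamilton--Ehrenfest system whose value at time `s` is given by the moments of `ψ`. -/
def Data.evol (Q : Data n) (t s : ℝ) (ψ : Sch n) : Sch n :=
  Q.green (Q.kappa * normSq ψ) s (Q.hes (Q.kappa * normSq ψ) s (moments Q.hbar ψ)) t ψ

/-- The inverse evolution operator `Û⁻¹(t,s,ψ)`: the same with the Green function taken from time
`t` to time `s`, the moments of `ψ` now being prescribed at time `t`. -/
def Data.evolInv (Q : Data n) (t s : ℝ) (ψ : Sch n) : Sch n :=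
  Q.green (Q.kappa * normSq ψ) t (Q.hes (Q.kappa * normSq ψ) t (moments Q.hbar ψ)) s ψ

/-- `Û(t, a Û⁻¹(t, ψ))`, where `Û(t, ·) = Û(t, 0, ·)`. -/
def Data.symOp (Q : Data n) (a : Sch n → Sch n) (t : ℝ) (ψ : Sch n) : Sch n :=
  Q.evol t 0 (a (Q.evolInv t 0 ψ))

/-- `E α = exp(α b)` on the class of initial functions: `E α ψ` is the unique solution of
`dψ_α/dα = b ψ_α`, `ψ_0 = ψ`, in the class, the derivative being taken in the Schwartz space. -/
def IsOperatorExp (hbar : ℝ) (b : Sch n → Sch n) (E : ℝ → Sch n → Sch n) : Prop :=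
  (∀ α, Set.MapsTo (E α) (P0 hbar) (P0 hbar)) ∧
  (∀ ψ ∈ P0 hbar, E 0 ψ = ψ ∧ ∀ α, HasCurveDerivAt (fun α' => E α' ψ) (b (E α ψ)) α) ∧
  (∀ u : ℝ → Sch n, (∀ α, u α ∈ P0 hbar ∧ HasCurveDerivAt u (b (u α)) α) →
    ∀ α, u α = E α (u 0))

end NonlocalGPE

end

/-! ### Calculus of curves in the Schwartz space. -/

noncomputable section

namespace NonlocalGPE

open Filter LineDeriv

variable {n : ℕ}

/-! ### Coordinate operators on the Schwartz space -/

/-! The nonlinearity enters only through finitely many numbers. For a state ψ the nonlocal term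
depends on ψ through `‖ψ‖²` and its first and second moments, and once these are frozen the whole
operator is quadratic in `ẑ`. Recentred at the mean of ψ, it is exactly the operator of the linear
associated equation at the moments of ψ (`gpeOp_eq_laseOp`). Quadratic symmetric generators conserve
the norm, and commutators with them make the first and second moments obey a closed system, the
Hamilton–Ehrenfest system (`hasDerivAt_moments`).

Hence a nonzero solution of the nonlocal equation solves the linear equation along its own moments,
which solve the HES (`lase_of_gpe`). Conversely, a nonzero solution of the linear equation along `g`
whose moments equal `g` at one time keeps the moments `g` (`IsLaseAt.moments_eq`), so with `ϰ̃ =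
ϰ‖ψ‖²` it solves the nonlocal equation. The zero state is treated separately. Consequently `evol`
produces solutions (`evol_spec`) and `evolInv` recovers earlier values of solutions (`evolInv_eq`).
A symmetry operator therefore sends Ψ to the solution with initial value `a (Ψ 0)`, and the
composition law reduces to `evolInv_evol` and to the group law of the operator exponential, which
follows from uniqueness.

Well-posedness: the HES consists of two linear equations, solved globally. For the linear
Schrödinger equation uniqueness is conservation of the norm. Existence is explicit near each time: a
Gaussian wave operator whose parameters follow the classical trajectory and a matrix Riccati
equation intertwines the evolution with a pure kinetic one, which is a Fourier multiplier
(`hasDerivAt_wave`, `exists_free_evolution`). The Riccati solution may exist only for short times;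
invertible local propagators are glued by `exists_global`.

Time derivatives are needed in the topology of the Schwartz space. They come from pointwise
derivatives and local boundedness (`PDeriv.hasCurveDerivAt`): all Schwartz seminorms are reduced to
the sup norm inside classes stable under `x_j` and `∂_j` (`seminorm_induction`). Members of `Pt`
have both properties, so solutions in that class are differentiable Schwartz curves; conversely
every smooth curve lies in `Pt`. -/

theorem coord_hasTemperateGrowth (j : Fin n) :
    Function.HasTemperateGrowth (fun x : Cfg n => ((x j : ℝ) : ℂ)) :=
  (Complex.ofRealCLM ∘L (EuclideanSpace.proj (𝕜 := ℝ) j)).hasTemperateGrowth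

/-- Multiplication by the coordinate `x_j`. -/
def Xop (j : Fin n) : Sch n →L[ℂ] Sch n :=
  SchwartzMap.smulLeftCLM ℂ (fun x : Cfg n => ((x j : ℝ) : ℂ))

/-- The partial derivative `∂/∂x_j`. -/
def Dop (j : Fin n) : Sch n →L[ℂ] Sch n :=
  lineDerivOpCLM ℂ (Sch n) (EuclideanSpace.single j (1 : ℝ))

@[simp] theorem Xop_apply (j : Fin n) (f : Sch n) (x : Cfg n) :
    Xop j f x = (x j : ℂ) * f x := by
  simp [Xop, SchwartzMap.smulLeftCLM_apply_apply (coord_hasTemperateGrowth j)]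

theorem Dop_apply (j : Fin n) (f : Sch n) (x : Cfg n) :
    Dop j f x = fderiv ℝ f x (EuclideanSpace.single j 1) := rfl

theorem fderiv_apply_eq_sum (f : Sch n) (x v : Cfg n) :
    fderiv ℝ f x v = ∑ j, (v j : ℂ) * Dop j f x := by
  conv_lhs => rw [← (EuclideanSpace.basisFun (Fin n) ℝ).sum_repr v]
  simp [Dop_apply]

/-- One factor `‖x‖ ≤ ∑ |x_j|` of the weight is absorbed into multiplication by coordinates. -/
theorem seminorm_zero_le_sum (k : ℕ) (f : Sch n) :
    SchwartzMap.seminorm ℝ (k + 1) 0 f ≤ ∑ j, SchwartzMap.seminorm ℝ k 0 (Xop j f) := by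
  refine SchwartzMap.seminorm_le_bound ℝ _ _ f (Finset.sum_nonneg fun _ _ => apply_nonneg _ _)
    fun x => ?_
  have hx : ‖x‖ ≤ ∑ j, ‖x j‖ := by
    conv_lhs => rw [← (EuclideanSpace.basisFun (Fin n) ℝ).sum_repr x]
    refine (norm_sum_le _ _).trans (le_of_eq ?_)
    simp [norm_smul]
  rw [norm_iteratedFDeriv_zero, pow_succ]
  calc ‖x‖ ^ k * ‖x‖ * ‖f x‖ ≤ ‖x‖ ^ k * (∑ j, ‖x j‖) * ‖f x‖ := by gcongr
    _ = ∑ j, ‖x‖ ^ k * ‖Xop j f x‖ := by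
        rw [Finset.mul_sum, Finset.sum_mul]
        refine Finset.sum_congr rfl fun j _ => ?_
        simp [mul_assoc]
    _ ≤ _ := by
        refine Finset.sum_le_sum fun j _ => ?_
        simpa using SchwartzMap.le_seminorm ℝ k 0 (Xop j f) x

/-- Since `Df = ∑ (∂_j f) dx_j`, an extra derivative costs only the norms of the fixed maps `c ↦ c
dx_j`. -/
theorem exists_seminorm_succ_le_sum (k m : ℕ) : ∃ C : Fin n → ℝ, (∀ j, 0 ≤ C j) ∧ ∀ f : Sch n,
    SchwartzMap.seminorm ℝ k (m + 1) f ≤ ∑ j, C j * SchwartzMap.seminorm ℝ k m (Dop j f) := by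
  let L : Fin n → ℂ →L[ℝ] (Cfg n →L[ℝ] ℂ) := fun j =>
    ContinuousLinearMap.smulRightL ℝ (Cfg n) ℂ (EuclideanSpace.proj j)
  refine ⟨fun j => ‖L j‖, fun j => norm_nonneg (L j), fun f => ?_⟩
  refine SchwartzMap.seminorm_le_bound ℝ _ _ f
    (Finset.sum_nonneg fun j _ => mul_nonneg (norm_nonneg (L j)) (apply_nonneg _ _)) fun x => ?_
  have hf : fderiv ℝ f = fun x => ∑ j, (L j ∘ Dop j f) x := by
    funext x
    ext v
    rw [fderiv_apply_eq_sum]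
    simp [L]
  rw [← norm_iteratedFDeriv_fderiv, hf, iteratedFDeriv_fun_sum_apply
    fun j _ => (L j).contDiff.contDiffAt.comp x ((Dop j f).contDiffAt ⊤ |>.of_le (mod_cast le_top))]
  refine (mul_le_mul_of_nonneg_left (norm_sum_le _ _) (by positivity)).trans ?_
  rw [Finset.mul_sum]
  refine Finset.sum_le_sum fun j _ => ?_
  refine (mul_le_mul_of_nonneg_left
    ((L j).norm_iteratedFDeriv_comp_left ((Dop j f).contDiffAt ⊤) (mod_cast le_top))
    (by positivity)).trans ?_
  rw [mul_left_comm]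
  exact mul_le_mul_of_nonneg_left (SchwartzMap.le_seminorm ℝ k m (Dop j f) x) (norm_nonneg (L j))

/-- Estimates in the sup norm propagate to all Schwartz seminorms in a class of families which is
stable under multiplication by coordinates and partial derivatives. -/
theorem seminorm_induction {ι : Type*} (Good : (ι → ℝ) → Prop)
    (hmono : ∀ a b : ι → ℝ, (∀ i, 0 ≤ a i) → (∀ i, a i ≤ b i) → Good b → Good a)
    (hsum : ∀ (C : Fin n → ℝ) (a : Fin n → ι → ℝ), (∀ j, Good (a j)) →
      Good (fun i => ∑ j, C j * a j i))
    (𝒞 : Set (ι → Sch n)) (hX : ∀ u ∈ 𝒞, ∀ j, (fun i => Xop j (u i)) ∈ 𝒞)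
    (hD : ∀ u ∈ 𝒞, ∀ j, (fun i => Dop j (u i)) ∈ 𝒞)
    (h0 : ∀ u ∈ 𝒞, Good (fun i => SchwartzMap.seminorm ℝ 0 0 (u i))) (k m : ℕ) :
    ∀ u ∈ 𝒞, Good (fun i => SchwartzMap.seminorm ℝ k m (u i)) := by
  -- The weight `k` is raised at order zero by coordinates; the order `m` is then raised at fixed
  -- `k` by partial derivatives.
  induction m with
  | zero =>
    induction k with
    | zero => exact h0
    | succ k ih =>
      intro u hu
      refine hmono _ _ (fun i => apply_nonneg _ _) (fun i => ?_)
        (hsum (fun _ => 1) (fun j i => SchwartzMap.seminorm ℝ k 0 (Xop j (u i)))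
          fun j => ih _ (hX u hu j))
      simpa using seminorm_zero_le_sum k (u i)
  | succ m ih =>
    intro u hu
    obtain ⟨C, -, h⟩ := exists_seminorm_succ_le_sum (n := n) k m
    exact hmono _ _ (fun i => apply_nonneg _ _) (fun i => h (u i))
      (hsum C (fun j i => SchwartzMap.seminorm ℝ k m (Dop j (u i))) fun j => ih _ (hD u hu j))

/-! ### Locally bounded families -/

/-- All Schwartz seminorms of the family `u` are eventually bounded along the filter `l`. -/
def LocBdd {ι : Type*} (l : Filter ι) (u : ι → Sch n) : Prop :=
  ∀ k m, ∃ C, ∀ᶠ i in l, SchwartzMap.seminorm ℝ k m (u i) ≤ C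

theorem sup_norm_le (f : Sch n) (x : Cfg n) : ‖f x‖ ≤ SchwartzMap.seminorm ℝ 0 0 f :=
  SchwartzMap.norm_le_seminorm ℝ f x

theorem sup_norm_le_bound (f : Sch n) {M : ℝ} (hM : 0 ≤ M) (h : ∀ x, ‖f x‖ ≤ M) :
    SchwartzMap.seminorm ℝ 0 0 f ≤ M :=
  SchwartzMap.seminorm_le_bound ℝ 0 0 f hM fun x => by simpa using h x

theorem continuous_seminorm (k m : ℕ) :
    Continuous (SchwartzMap.seminorm ℝ k m : Seminorm ℝ (Sch n)) :=
  (schwartz_withSeminorms ℝ (Cfg n) ℂ).continuous_seminorm (k, m)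

namespace LocBdd

variable {ι : Type*} {l : Filter ι} {u v : ι → Sch n}

theorem of_class (𝒞 : Set (ι → Sch n)) (hX : ∀ u ∈ 𝒞, ∀ j, (fun i => Xop j (u i)) ∈ 𝒞)
    (hD : ∀ u ∈ 𝒞, ∀ j, (fun i => Dop j (u i)) ∈ 𝒞)
    (h0 : ∀ u ∈ 𝒞, ∃ C, ∀ᶠ i in l, SchwartzMap.seminorm ℝ 0 0 (u i) ≤ C) (hu : u ∈ 𝒞) :
    LocBdd l u := by
  intro k m
  refine seminorm_induction (fun a : ι → ℝ => ∃ C, ∀ᶠ i in l, |a i| ≤ C) ?_ ?_ 𝒞 hX hD ?_ k m u hu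
    |>.imp fun C hC => hC.mono fun i hi => (le_abs_self _).trans hi
  · rintro a b ha hab ⟨C, hC⟩
    exact ⟨C, hC.mono fun i hi => by
      rw [abs_of_nonneg (ha i)]; exact (hab i).trans ((le_abs_self _).trans hi)⟩
  · intro C a ha
    choose B hB using ha
    refine ⟨∑ j, |C j| * B j, (eventually_all.2 hB).mono fun i hi => ?_⟩
    refine (Finset.abs_sum_le_sum_abs _ _).trans (Finset.sum_le_sum fun j _ => ?_)
    rw [abs_mul]
    exact mul_le_mul_of_nonneg_left (hi j) (abs_nonneg _)
  · intro u hu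
    obtain ⟨C, hC⟩ := h0 u hu
    exact ⟨C, hC.mono fun i hi => by rwa [abs_of_nonneg (apply_nonneg _ _)]⟩

/-- A continuous seminorm is dominated by finitely many Schwartz seminorms. This makes local
boundedness stable under every continuous operator. -/
theorem bound_continuous (hu : LocBdd l u) (p : Seminorm ℝ (Sch n)) (hp : Continuous p) :
    ∃ C, ∀ᶠ i in l, p (u i) ≤ C := by
  obtain ⟨s, C, -, h⟩ := Seminorm.bound_of_continuous (schwartz_withSeminorms ℝ (Cfg n) ℂ) p hp
  choose B hB using hu
  refine ⟨C * ∑ q ∈ s, |B q.1 q.2|,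
    ((s.eventually_all).2 fun q _ => hB q.1 q.2).mono fun i hi => ?_⟩
  refine (h (u i)).trans ?_
  rw [smul_apply, NNReal.smul_def, smul_eq_mul]
  refine mul_le_mul_of_nonneg_left ?_ C.2
  refine Seminorm.finset_sup_apply_le (Finset.sum_nonneg fun _ _ => abs_nonneg _) fun q hq => ?_
  exact (hi q hq).trans ((le_abs_self _).trans
    (Finset.single_le_sum (f := fun q : ℕ × ℕ => |B q.1 q.2|) (fun _ _ => abs_nonneg _) hq))

theorem clm (hu : LocBdd l u) (A : Sch n →L[ℂ] Sch n) : LocBdd l (fun i => A (u i)) := by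
  intro k m
  let p : Seminorm ℝ (Sch n) :=
    (SchwartzMap.seminorm ℝ k m).comp ((A.restrictScalars ℝ : Sch n →L[ℝ] Sch n) : Sch n →ₗ[ℝ] Sch n)
  have hp : Continuous p := (continuous_seminorm k m).comp A.continuous
  exact hu.bound_continuous p hp

theorem of_tendsto {f : Sch n} (hu : Tendsto u l (𝓝 f)) : LocBdd l u := fun k m =>
  ⟨_, (((continuous_seminorm k m).tendsto f).comp hu).eventually_le_const
    (lt_add_one (SchwartzMap.seminorm ℝ k m f))⟩

theorem add (hu : LocBdd l u) (hv : LocBdd l v) : LocBdd l (fun i => u i + v i) := fun k m => by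
  obtain ⟨C, hC⟩ := hu k m
  obtain ⟨B, hB⟩ := hv k m
  exact ⟨C + B, hC.mp (hB.mono fun i h1 h2 => (map_add_le_add _ _ _).trans (add_le_add h2 h1))⟩

theorem smul (hu : LocBdd l u) {c : ι → ℂ} (hc : ∃ C, ∀ᶠ i in l, ‖c i‖ ≤ C) :
    LocBdd l (fun i => c i • u i) := fun k m => by
  obtain ⟨C, hC⟩ := hu k m
  obtain ⟨B, hB⟩ := hc
  refine ⟨B * C, hC.mp (hB.mono fun i h1 h2 => ?_)⟩
  have : SchwartzMap.seminorm ℝ k m (c i • u i) = ‖c i‖ * SchwartzMap.seminorm ℝ k m (u i) :=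
    map_smul_eq_mul (SchwartzMap.seminorm ℂ k m) (c i) (u i)
  rw [this]
  exact mul_le_mul h1 h2 (apply_nonneg _ _) ((norm_nonneg _).trans h1)

theorem zero : LocBdd l (fun _ => (0 : Sch n)) := fun k m => ⟨0, by simp⟩

theorem sum {κ : Type*} (s : Finset κ) {w : κ → ι → Sch n} (hw : ∀ a ∈ s, LocBdd l (w a)) :
    LocBdd l (fun i => ∑ a ∈ s, w a i) := by
  classical
  induction s using Finset.induction_on with
  | empty => simpa using zero
  | insert a s ha ih =>
    simp only [Finset.sum_insert ha]
    exact (hw a (by simp)).add (ih fun b hb => hw b (by simp [hb]))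

end LocBdd

/-- Convergence to zero in the Schwartz space follows from uniform convergence in a class of
families which is stable under multiplication by coordinates and partial derivatives. -/
theorem tendsto_zero_of_class {ι : Type*} {l : Filter ι} {u : ι → Sch n} (𝒞 : Set (ι → Sch n))
    (hX : ∀ u ∈ 𝒞, ∀ j, (fun i => Xop j (u i)) ∈ 𝒞)
    (hD : ∀ u ∈ 𝒞, ∀ j, (fun i => Dop j (u i)) ∈ 𝒞)
    (h0 : ∀ u ∈ 𝒞, Tendsto (fun i => SchwartzMap.seminorm ℝ 0 0 (u i)) l (𝓝 0)) (hu : u ∈ 𝒞) :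
    Tendsto u l (𝓝 0) := by
  rw [(schwartz_withSeminorms ℝ (Cfg n) ℂ).tendsto_nhds]
  rintro ⟨k, m⟩ ε hε
  have := seminorm_induction (fun a : ι → ℝ => Tendsto a l (𝓝 0))
    (fun a b ha hab hb => squeeze_zero ha hab hb)
    (fun C a ha => by
      simpa using tendsto_finsetSum Finset.univ fun j _ => (ha j).const_mul (C j))
    𝒞 hX hD h0 k m u hu
  filter_upwards [this.eventually_lt_const hε] with i hi
  simpa using hi

/-! ### Pointwise derivatives of curves -/

/-- Near `t`, the curve `u` is pointwise differentiable in time with derivative `v`. -/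
def PDeriv (u v : ℝ → Sch n) (t : ℝ) : Prop :=
  ∀ᶠ τ in 𝓝 t, ∀ x, HasDerivAt (fun σ => u σ x) (v τ x) τ

theorem hasDerivAt_line (f : Sch n) (j : Fin n) (x : Cfg n) (h : ℝ) :
    HasDerivAt (fun r : ℝ => f (x + r • EuclideanSpace.single j 1))
      (Dop j f (x + h • EuclideanSpace.single j 1)) h := by
  have h1 : HasDerivAt (fun r : ℝ => x + r • (EuclideanSpace.single j 1 : Cfg n))
      (EuclideanSpace.single j 1) h := by
    simpa using ((hasDerivAt_id h).smul_const (EuclideanSpace.single j (1:ℝ) : Cfg n)).const_add x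
  exact (f.hasFDerivAt _).comp_hasDerivAt h h1

/-- The mean value inequality is applied twice, first to `∂_j f`, then to `f` minus its
linearization. The bound is uniform in `x` and in families with bounded second derivatives. -/
theorem norm_difference_quotient_sub_le (f : Sch n) (j : Fin n) (x : Cfg n) {h : ℝ} (hh : h ≠ 0) :
    ‖h⁻¹ • (f (x + h • EuclideanSpace.single j 1) - f x) - Dop j f x‖ ≤
      |h| * SchwartzMap.seminorm ℝ 0 0 (Dop j (Dop j f)) := by
  set e : Cfg n := EuclideanSpace.single j 1
  set K := SchwartzMap.seminorm ℝ 0 0 (Dop j (Dop j f))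
  have h1 : ∀ r, ‖Dop j f (x + r • e) - Dop j f x‖ ≤ K * |r| := fun r => by
    have := Convex.norm_image_sub_le_of_norm_hasDerivWithin_le (s := Set.univ) (C := K)
      (f := fun r : ℝ => Dop j f (x + r • e))
      (fun r _ => (hasDerivAt_line (Dop j f) j x r).hasDerivWithinAt)
      (fun r _ => sup_norm_le _ _) convex_univ (Set.mem_univ 0) (Set.mem_univ r)
    simpa using this
  have h2 := Convex.norm_image_sub_le_of_norm_hasDerivWithin_le (s := Set.uIcc 0 h) (C := K * |h|)
      (f := fun r : ℝ => f (x + r • e) - r • Dop j f x)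
      (f' := fun r => Dop j f (x + r • e) - Dop j f x)
      (fun r _ => ((hasDerivAt_line f j x r).sub
        (by simpa using (hasDerivAt_id r).smul_const (Dop j f x))).hasDerivWithinAt)
      (fun r hr => (h1 r).trans (by
        have := Set.abs_sub_left_of_mem_uIcc hr
        simp only [sub_zero] at this
        exact mul_le_mul_of_nonneg_left this (apply_nonneg _ _))) (convex_uIcc 0 h)
      Set.left_mem_uIcc Set.right_mem_uIcc
  have h3 : h⁻¹ • (f (x + h • e) - f x) - Dop j f x =
      h⁻¹ • ((f (x + h • e) - h • Dop j f x) - (f (x + (0:ℝ) • e) - (0:ℝ) • Dop j f x)) := by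
    rw [zero_smul, zero_smul, add_zero, sub_zero, sub_right_comm, smul_sub h⁻¹ (_ - _),
      inv_smul_smul₀ hh]
  rw [h3, norm_smul, norm_inv, Real.norm_eq_abs, inv_mul_le_iff₀ (abs_pos.2 hh)]
  refine h2.trans (le_of_eq ?_)
  simp only [sub_zero, Real.norm_eq_abs]
  ring

theorem PDeriv.xop {u v : ℝ → Sch n} {t : ℝ} (h : PDeriv u v t) (j : Fin n) :
    PDeriv (fun τ => Xop j (u τ)) (fun τ => Xop j (v τ)) t :=
  Eventually.mono h fun τ hτ x => by simpa using (hτ x).const_mul ((x j : ℝ) : ℂ)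

/-- The time and space derivatives commute because the spatial difference quotients of `v` converge
uniformly in time near `t`, which the bound on `∂_j² v` guarantees. -/
theorem PDeriv.dop {u v : ℝ → Sch n} {t : ℝ} (h : PDeriv u v t) (hv : LocBdd (𝓝 t) v)
    (j : Fin n) : PDeriv (fun τ => Dop j (u τ)) (fun τ => Dop j (v τ)) t := by
  obtain ⟨C, hC⟩ := ((hv.clm (Dop j)).clm (Dop j)) 0 0
  obtain ⟨s, hs, hso, hts⟩ := eventually_nhds_iff.1 (Eventually.and h hC)
  refine eventually_nhds_iff.2 ⟨s, fun τ hτ x => ?_, hso, hts⟩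
  refine hasDerivAt_of_tendstoUniformlyOn (l := 𝓝[≠] (0:ℝ)) (s := s)
    (f := fun h τ => h⁻¹ • (u τ (x + h • EuclideanSpace.single j 1) - u τ x))
    (f' := fun h τ => h⁻¹ • (v τ (x + h • EuclideanSpace.single j 1) - v τ x))
    (g := fun τ => Dop j (u τ) x) (g' := fun τ => Dop j (v τ) x) hso ?_ ?_ ?_ hτ
  · rw [Metric.tendstoUniformlyOn_iff]
    intro ε hε
    have hlim : Tendsto (fun h : ℝ => |h| * C) (𝓝[≠] 0) (𝓝 0) := by
      have : Continuous fun h : ℝ => |h| * C := by fun_prop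
      simpa using (this.tendsto 0).mono_left nhdsWithin_le_nhds
    filter_upwards [hlim.eventually_lt_const hε, self_mem_nhdsWithin] with h hh hne τ hτ
    rw [dist_comm, dist_eq_norm]
    refine (norm_difference_quotient_sub_le (v τ) j x hne).trans_lt (lt_of_le_of_lt ?_ hh)
    exact mul_le_mul_of_nonneg_left (hs τ hτ).2 (abs_nonneg h)
  · exact Eventually.of_forall fun h τ hτ => (((hs τ hτ).1 _).sub ((hs τ hτ).1 _)).const_smul h⁻¹
  · intro τ _
    have := hasDerivAt_iff_tendsto_slope_zero.1 (hasDerivAt_line (u τ) j x 0)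
    simpa using this

/-- The mean value inequality makes `u` Lipschitz in the sup norm near `t`; the class of such
increments is stable under `x_j` and `∂_j`, so this upgrades to all seminorms. -/
theorem PDeriv.continuousAt {u v : ℝ → Sch n} {t : ℝ} (h : PDeriv u v t) (hv : LocBdd (𝓝 t) v) :
    ContinuousAt u t := by
  suffices hz : Tendsto (fun τ => u τ - u t) (𝓝 t) (𝓝 0) by
    have := hz.add_const (u t)
    simpa [ContinuousAt] using this
  refine tendsto_zero_of_class
    {w | ∃ u v : ℝ → Sch n, PDeriv u v t ∧ LocBdd (𝓝 t) v ∧ w = fun τ => u τ - u t} ?_ ?_ ?_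
    ⟨u, v, h, hv, rfl⟩
  · rintro _ ⟨u, v, h, hv, rfl⟩ j
    exact ⟨_, _, h.xop j, hv.clm _, by simp⟩
  · rintro _ ⟨u, v, h, hv, rfl⟩ j
    exact ⟨_, _, h.dop hv j, hv.clm _, by simp⟩
  · rintro _ ⟨u, v, h, hv, rfl⟩
    obtain ⟨C, hC⟩ := hv 0 0
    obtain ⟨ε, hε, hb⟩ := Metric.eventually_nhds_iff_ball.1 (Eventually.and h hC)
    have hC0 : 0 ≤ C := (apply_nonneg _ _).trans (hb t (Metric.mem_ball_self hε)).2
    refine squeeze_zero' (g := fun τ => C * ‖τ - t‖) (Eventually.of_forall fun _ => apply_nonneg _ _)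
      ?_ ?_
    · filter_upwards [Metric.ball_mem_nhds t hε] with τ hτ
      refine sup_norm_le_bound _ (by positivity) fun x => ?_
      exact Convex.norm_image_sub_le_of_norm_hasDerivWithin_le (s := Metric.ball t ε)
        (f := fun σ => u σ x) (f' := fun σ => v σ x)
        (fun σ hσ => ((hb σ hσ).1 x).hasDerivWithinAt)
        (fun σ hσ => (sup_norm_le _ _).trans (hb σ hσ).2) (convex_ball t ε)
        (Metric.mem_ball_self hε) hτ
    · have : Continuous fun τ : ℝ => C * ‖τ - t‖ := by fun_prop
      simpa using this.tendsto t

/-- The remainder is estimated in the sup norm by the mean value inequality for `u σ - σ v(t)`,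
whose derivative is small by continuity of `v`; stability of the class does the rest. -/
theorem PDeriv.hasCurveDerivAt {u v : ℝ → Sch n} {t : ℝ} (h : PDeriv u v t)
    (hv : LocBdd (𝓝 t) v) (hc : ContinuousAt v t) : HasCurveDerivAt u (v t) t := by
  suffices hz : Tendsto (fun h : ℝ => h⁻¹ • (u (t + h) - u t) - v t) (𝓝[≠] 0) (𝓝 0) by
    have := hz.add_const (v t)
    simpa [HasCurveDerivAt] using this
  refine tendsto_zero_of_class
    {w | ∃ u v : ℝ → Sch n, PDeriv u v t ∧ LocBdd (𝓝 t) v ∧ ContinuousAt v t ∧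
      w = fun h : ℝ => h⁻¹ • (u (t + h) - u t) - v t} ?_ ?_ ?_
    ⟨u, v, h, hv, hc, rfl⟩
  · rintro _ ⟨u, v, h, hv, hc, rfl⟩ j
    refine ⟨_, _, h.xop j, hv.clm _, (Xop j).continuous.continuousAt.comp hc, ?_⟩
    funext r
    ext x
    simp
  · rintro _ ⟨u, v, h, hv, hc, rfl⟩ j
    refine ⟨_, _, h.dop hv j, hv.clm _, (Dop j).continuous.continuousAt.comp hc, ?_⟩
    funext r
    simp
  · rintro _ ⟨u, v, h, hv, hc, rfl⟩
    have hc' : Tendsto (fun τ => SchwartzMap.seminorm ℝ 0 0 (v τ - v t)) (𝓝 t) (𝓝 0) := by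
      have h1 : Tendsto (fun τ => v τ - v t) (𝓝 t) (𝓝 0) := by
        simpa using hc.sub_const (v t)
      simpa [Function.comp_def] using ((continuous_seminorm 0 0).tendsto (0 : Sch n)).comp h1
    rw [Metric.tendsto_nhds]
    intro ε hε
    obtain ⟨δ, hδ, hb⟩ := Metric.eventually_nhds_iff_ball.1
      (Eventually.and h (hc'.eventually_lt_const (half_pos hε)))
    have hball : ∀ᶠ r : ℝ in 𝓝[≠] 0, r ∈ Metric.ball (0:ℝ) δ :=
      nhdsWithin_le_nhds (Metric.ball_mem_nhds 0 hδ)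
    filter_upwards [hball, self_mem_nhdsWithin] with r hr hr0
    rw [Real.dist_eq, sub_zero, abs_of_nonneg (apply_nonneg _ _)]
    refine lt_of_le_of_lt (sup_norm_le_bound _ (half_pos hε).le fun x => ?_) (half_lt_self hε)
    have hr' : t + r ∈ Metric.ball t δ := by simpa [Metric.mem_ball, Real.dist_eq] using hr
    have := Convex.norm_image_sub_le_of_norm_hasDerivWithin_le (s := Metric.ball t δ) (C := ε / 2)
      (f := fun σ => u σ x - σ • v t x) (f' := fun σ => v σ x - v t x)
      (fun σ hσ => (((hb σ hσ).1 x).sub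
        (by simpa using (hasDerivAt_id σ).smul_const (v t x))).hasDerivWithinAt)
      (fun σ hσ => (sup_norm_le (v σ - v t) x).trans (hb σ hσ).2.le) (convex_ball t δ)
      (Metric.mem_ball_self hδ) hr'
    have h3 : (r⁻¹ • (u (t + r) - u t) - v t) x =
        r⁻¹ • ((u (t + r) x - (t + r) • v t x) - (u t x - t • v t x)) := by
      have h4 : (u (t + r) x - (t + r) • v t x) - (u t x - t • v t x) =
          (u (t + r) x - u t x) - r • v t x := by
        rw [add_smul]; abel
      rw [h4, smul_sub _ _ (r • v t x), inv_smul_smul₀ hr0]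
      simp [smul_sub]
    rw [h3, norm_smul, norm_inv, inv_mul_le_iff₀ (norm_pos_iff.2 hr0)]
    refine this.trans (le_of_eq ?_)
    rw [add_sub_cancel_left, mul_comm]

end NonlocalGPE
end

noncomputable section

namespace NonlocalGPE

open Filter LineDeriv

variable {n : ℕ}

/-! ### Differentiable and smooth curves of Schwartz functions -/

namespace HasCurveDerivAt

section general
variable {V W : Type*} [AddCommGroup V] [Module ℝ V] [TopologicalSpace V]
  [AddCommGroup W] [Module ℝ W] [TopologicalSpace W] {u v : ℝ → V} {u' v' : V} {t : ℝ}

theorem add [ContinuousAdd V] (hu : HasCurveDerivAt u u' t) (hv : HasCurveDerivAt v v' t) :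
    HasCurveDerivAt (fun τ => u τ + v τ) (u' + v') t := by
  refine (Tendsto.add hu hv).congr fun r => ?_
  rw [← smul_add, add_sub_add_comm]

theorem sum [ContinuousAdd V] {κ : Type*} (s : Finset κ) {w : κ → ℝ → V} {w' : κ → V}
    (h : ∀ i ∈ s, HasCurveDerivAt (w i) (w' i) t) :
    HasCurveDerivAt (fun τ => ∑ i ∈ s, w i τ) (∑ i ∈ s, w' i) t := by
  refine (tendsto_finsetSum s fun i hi => h i hi).congr fun r => ?_
  rw [← Finset.smul_sum, Finset.sum_sub_distrib]

theorem clm (A : V →L[ℝ] W) (hu : HasCurveDerivAt u u' t) :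
    HasCurveDerivAt (fun τ => A (u τ)) (A u') t := by
  refine ((A.continuous.tendsto _).comp hu).congr fun r => ?_
  simp

theorem continuousAt [ContinuousAdd V] [ContinuousSMul ℝ V] (hu : HasCurveDerivAt u u' t) :
    ContinuousAt u t := by
  have h1 : Tendsto (fun r : ℝ => u t + r • (r⁻¹ • (u (t + r) - u t))) (𝓝[≠] 0) (𝓝 (u t)) := by
    have h0 : Tendsto (fun r : ℝ => r) (𝓝[≠] 0) (𝓝 0) := tendsto_id.mono_left nhdsWithin_le_nhds
    simpa using (h0.smul hu).const_add (u t)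
  have h2 : Tendsto (fun r : ℝ => u (t + r)) (𝓝[≠] 0) (𝓝 (u t)) := by
    refine h1.congr' ?_
    filter_upwards [self_mem_nhdsWithin] with r hr
    rw [smul_inv_smul₀ hr]
    abel
  have h3 : Tendsto (fun r : ℝ => u (t + r)) (𝓝 0) (𝓝 (u t)) := by
    rw [← nhdsNE_sup_pure, tendsto_sup]
    exact ⟨h2, by simpa using tendsto_pure_nhds (fun r : ℝ => u (t + r)) 0⟩
  have h4 : Tendsto (fun τ : ℝ => τ - t) (𝓝 t) (𝓝 0) := by
    have : Continuous fun τ : ℝ => τ - t := by fun_prop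
    simpa using this.tendsto t
  simpa [Function.comp_def, ContinuousAt] using h3.comp h4

theorem hasDerivAt {E : Type*} [NormedAddCommGroup E] [NormedSpace ℝ E] {u : ℝ → E} {u' : E}
    {t : ℝ} (h : HasCurveDerivAt u u' t) : HasDerivAt u u' t :=
  hasDerivAt_iff_tendsto_slope_zero.2 h

end general

theorem smul {u : ℝ → Sch n} {u' : Sch n} {t : ℝ} {c : ℝ → ℂ} {c' : ℂ}
    (hu : HasCurveDerivAt u u' t) (hc : HasDerivAt c c' t) :
    HasCurveDerivAt (fun τ => c τ • u τ) (c' • u t + c t • u') t := by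
  have hcont : ContinuousAt u t := hu.continuousAt
  have hlim : Tendsto (fun h : ℝ => t + h) (𝓝[≠] 0) (𝓝 t) := by
    have : Continuous fun h : ℝ => t + h := by fun_prop
    simpa using (this.tendsto 0).mono_left nhdsWithin_le_nhds
  have h1 := (hasDerivAt_iff_tendsto_slope_zero.1 hc).smul (hcont.tendsto.comp hlim)
  have h2 := Tendsto.const_smul hu (c t)
  refine (h1.add h2).congr fun r => ?_
  simp only [Function.comp_def]
  rw [smul_assoc, smul_comm (c t) r⁻¹, ← smul_add, sub_smul, smul_sub]
  congr 1
  abel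

theorem apply {u : ℝ → Sch n} {u' : Sch n} {t : ℝ} (h : HasCurveDerivAt u u' t) (x : Cfg n) :
    HasDerivAt (fun τ => u τ x) (u' x) t := by
  let A : Sch n →L[ℝ] ℂ :=
    (BoundedContinuousFunction.evalCLM ℝ x).comp
      (SchwartzMap.toBoundedContinuousFunctionCLM ℝ (Cfg n) ℂ)
  exact (h.clm A).hasDerivAt

end HasCurveDerivAt

theorem IsSmoothCurve.exists_deriv {u : ℝ → Sch n} (hu : IsSmoothCurve u) :
    ∃ v, IsSmoothCurve v ∧ ∀ t, HasCurveDerivAt u (v t) t := by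
  obtain ⟨d, rfl, hd⟩ := hu
  exact ⟨d 1, ⟨fun k => d (k + 1), rfl, fun k t => hd (k + 1) t⟩, hd 0⟩

theorem IsSmoothCurve.continuous {u : ℝ → Sch n} (hu : IsSmoothCurve u) : Continuous u := by
  obtain ⟨v, -, hv⟩ := hu.exists_deriv
  exact continuous_iff_continuousAt.2 fun t => (hv t).continuousAt

theorem IsSmoothCurve.clm {u : ℝ → Sch n} (hu : IsSmoothCurve u) (A : Sch n →L[ℂ] Sch n) :
    IsSmoothCurve (fun t => A (u t)) := by
  obtain ⟨d, rfl, hd⟩ := hu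
  exact ⟨fun k t => A (d k t), rfl, fun k t => (hd k t).clm (A.restrictScalars ℝ)⟩

/-- A class of curves of which every member has a derivative in the class consists of smooth
curves. -/
theorem isSmoothCurve_of_class (𝒦 : Set (ℝ → Sch n))
    (h : ∀ u ∈ 𝒦, ∃ v ∈ 𝒦, ∀ t, HasCurveDerivAt u (v t) t) {u : ℝ → Sch n} (hu : u ∈ 𝒦) :
    IsSmoothCurve u := by
  choose! D hD hD' using h
  have hmem : ∀ k, D^[k] u ∈ 𝒦 := fun k => by
    induction k with
    | zero => exact hu
    | succ k ih => rw [Function.iterate_succ_apply']; exact hD _ ih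
  refine ⟨fun k => D^[k] u, rfl, fun k t => ?_⟩
  simp only [Function.iterate_succ_apply']
  exact hD' _ (hmem k) t

/-- A locally bounded pointwise solution of `∂_t u = ∑ c_i(t) A_i u` with smooth coefficients `c_i`
and continuous operators `A_i` is a smooth curve. -/
theorem isSmoothCurve_of_pointwise_equation {ι : Type} [Fintype ι] {c : ι → ℝ → ℂ}
    (hc : ∀ i, ContDiff ℝ ∞ (c i)) (A : ι → Sch n →L[ℂ] Sch n) {u : ℝ → Sch n}
    (hb : ∀ t, LocBdd (𝓝 t) u)
    (hu : ∀ t x, HasDerivAt (fun τ => u τ x) ((∑ i, c i t • A i (u t)) x) t) :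
    IsSmoothCurve u := by
  set v : ℝ → Sch n := fun t => ∑ i, c i t • A i (u t) with hv
  have hcb : ∀ i t, ∃ C, ∀ᶠ τ in 𝓝 t, ‖c i τ‖ ≤ C := fun i t =>
    ⟨_, ((hc i).continuous.norm.tendsto t).eventually_le_const (lt_add_one _)⟩
  have hvb : ∀ t, LocBdd (𝓝 t) v := fun t =>
    LocBdd.sum _ fun i _ => ((hb t).clm (A i)).smul (hcb i t)
  have hp : ∀ t, PDeriv u v t := fun t => Eventually.of_forall fun τ x => hu τ x
  have huc : Continuous u := continuous_iff_continuousAt.2 fun t => (hp t).continuousAt (hvb t)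
  have hvc : Continuous v := continuous_finsetSum _ fun i _ =>
    (hc i).continuous.smul ((A i).continuous.comp huc)
  have hud : ∀ t, HasCurveDerivAt u (v t) t := fun t =>
    (hp t).hasCurveDerivAt (hvb t) hvc.continuousAt
  -- The class of finite sums `∑ a_i(t) B_i u(t)` is closed under differentiation: the product rule
  -- differentiates `a_i` or replaces `u'` by the right-hand side of the equation, whence the index
  -- set `κ ⊕ κ × ι` below.
  refine isSmoothCurve_of_class
    {w | ∃ (κ : Type) (_ : Fintype κ) (a : κ → ℝ → ℂ) (B : κ → Sch n →L[ℂ] Sch n),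
      (∀ i, ContDiff ℝ ∞ (a i)) ∧ w = fun t => ∑ i, a i t • B i (u t)} ?_
    ⟨Unit, inferInstance, fun _ _ => 1, fun _ => ContinuousLinearMap.id ℂ _,
      fun _ => contDiff_const, by simp⟩
  rintro _ ⟨κ, _, a, B, ha, rfl⟩
  refine ⟨fun t => ∑ i : κ ⊕ κ × ι, (Sum.elim (fun i => deriv (a i))
      (fun p τ => a p.1 τ * c p.2 τ) i : ℝ → ℂ) t •
      (Sum.elim B (fun p => (B p.1).comp (A p.2)) i : Sch n →L[ℂ] Sch n) (u t),
    ⟨κ ⊕ κ × ι, inferInstance, _, _, ?_, rfl⟩, fun t => ?_⟩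
  · rintro (i | p)
    · exact (contDiff_infty_iff_deriv.1 (ha i)).2
    · exact (ha p.1).mul (hc p.2)
  · have h1 : ∀ i, HasCurveDerivAt (fun τ => a i τ • B i (u τ))
        (deriv (a i) t • B i (u t) + a i t • B i (v t)) t := fun i =>
      ((hud t).clm ((B i).restrictScalars ℝ)).smul
        ((ha i).differentiable (by simp) t).hasDerivAt
    have h2 := HasCurveDerivAt.sum Finset.univ fun i _ => h1 i
    convert h2 using 1
    simp [Fintype.sum_sum_type, Fintype.sum_prod_type, Finset.sum_add_distrib, hv,
      Finset.smul_sum, mul_smul]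

end NonlocalGPE
end

/-! ### Global solvability of linear evolution problems and of the Hamilton–Ehrenfest system. -/

noncomputable section

namespace NonlocalGPE

open Filter Set

/-! ### From local to global solutions of evolution problems -/

section gluing

variable {X : Type*} {P : (ℝ → X) → ℝ → Prop}

/-- Switching from `u` to `u₁` at `c` creates no defect: uniqueness on the overlap makes both curves
agree near `c`, so the glued curve has the germ of `u` there. -/
theorem exists_extend_right (hgerm : ∀ u v t, u =ᶠ[𝓝 t] v → P u t → P v t)
    (huniq : ∀ u v a b c, c ∈ Ioo a b → (∀ t ∈ Ioo a b, P u t) → (∀ t ∈ Ioo a b, P v t) →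
      u c = v c → ∀ t ∈ Ioo a b, u t = v t)
    {u u₁ : ℝ → X} {a b a₁ b₁ c : ℝ} (hu : ∀ t ∈ Ioo a b, P u t) (hu₁ : ∀ t ∈ Ioo a₁ b₁, P u₁ t)
    (hc : c ∈ Ioo a b) (hc₁ : c ∈ Ioo a₁ b₁) (h : u₁ c = u c) :
    ∃ w, (∀ t ≤ c, w t = u t) ∧ ∀ t ∈ Ioo a b₁, P w t := by
  refine ⟨fun t => if t ≤ c then u t else u₁ t, fun t ht => if_pos ht, fun t ht => ?_⟩
  have hag : ∀ t ∈ Ioo (max a a₁) (min b b₁), u t = u₁ t := by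
    refine huniq u u₁ _ _ c ⟨max_lt hc.1 hc₁.1, lt_min hc.2 hc₁.2⟩
      (fun t ht => hu t ⟨(le_max_left _ _).trans_lt ht.1, ht.2.trans_le (min_le_left _ _)⟩)
      (fun t ht => hu₁ t ⟨(le_max_right _ _).trans_lt ht.1, ht.2.trans_le (min_le_right _ _)⟩) h.symm
  rcases lt_trichotomy t c with htc | rfl | htc
  · refine hgerm u _ t ?_ (hu t ⟨ht.1, htc.trans hc.2⟩)
    filter_upwards [Iio_mem_nhds htc] with τ hτ
    exact (if_pos (le_of_lt hτ)).symm
  · refine hgerm u _ t ?_ (hu t hc)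
    filter_upwards [Ioo_mem_nhds (max_lt hc.1 hc₁.1) (lt_min hc.2 hc₁.2)] with τ hτ
    by_cases hτc : τ ≤ t
    · exact (if_pos hτc).symm
    · rw [if_neg hτc]; exact hag τ hτ
  · refine hgerm u₁ _ t ?_ (hu₁ t ⟨hc₁.1.trans htc, ht.2⟩)
    filter_upwards [Ioi_mem_nhds htc] with τ hτ
    exact (if_neg (not_le.2 hτ)).symm

theorem exists_extend_left (hgerm : ∀ u v t, u =ᶠ[𝓝 t] v → P u t → P v t)
    (huniq : ∀ u v a b c, c ∈ Ioo a b → (∀ t ∈ Ioo a b, P u t) → (∀ t ∈ Ioo a b, P v t) →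
      u c = v c → ∀ t ∈ Ioo a b, u t = v t)
    {u u₁ : ℝ → X} {a b a₁ b₁ c : ℝ} (hu : ∀ t ∈ Ioo a b, P u t) (hu₁ : ∀ t ∈ Ioo a₁ b₁, P u₁ t)
    (hc : c ∈ Ioo a b) (hc₁ : c ∈ Ioo a₁ b₁) (h : u₁ c = u c) :
    ∃ w, (∀ t, c ≤ t → w t = u t) ∧ ∀ t ∈ Ioo a₁ b, P w t := by
  refine ⟨fun t => if c ≤ t then u t else u₁ t, fun t ht => if_pos ht, fun t ht => ?_⟩
  have hag : ∀ t ∈ Ioo (max a a₁) (min b b₁), u t = u₁ t := by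
    refine huniq u u₁ _ _ c ⟨max_lt hc.1 hc₁.1, lt_min hc.2 hc₁.2⟩
      (fun t ht => hu t ⟨(le_max_left _ _).trans_lt ht.1, ht.2.trans_le (min_le_left _ _)⟩)
      (fun t ht => hu₁ t ⟨(le_max_right _ _).trans_lt ht.1, ht.2.trans_le (min_le_right _ _)⟩) h.symm
  rcases lt_trichotomy t c with htc | rfl | htc
  · refine hgerm u₁ _ t ?_ (hu₁ t ⟨ht.1, htc.trans hc₁.2⟩)
    filter_upwards [Iio_mem_nhds htc] with τ hτ
    exact (if_neg (not_le.2 hτ)).symm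
  · refine hgerm u _ t ?_ (hu t hc)
    filter_upwards [Ioo_mem_nhds (max_lt hc.1 hc₁.1) (lt_min hc.2 hc₁.2)] with τ hτ
    by_cases hτc : t ≤ τ
    · exact (if_pos hτc).symm
    · rw [if_neg hτc]; exact hag τ hτ
  · refine hgerm u _ t ?_ (hu t ⟨hc.1.trans htc, ht.2⟩)
    filter_upwards [Ioi_mem_nhds htc] with τ hτ
    exact (if_pos (le_of_lt hτ)).symm

/-- Local existence near every time and uniqueness give global existence. -/
theorem exists_global (hgerm : ∀ u v t, u =ᶠ[𝓝 t] v → P u t → P v t)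
    (huniq : ∀ u v a b c, c ∈ Ioo a b → (∀ t ∈ Ioo a b, P u t) → (∀ t ∈ Ioo a b, P v t) →
      u c = v c → ∀ t ∈ Ioo a b, u t = v t)
    (hloc : ∀ s, ∃ δ > 0, ∀ c ∈ Ioo (s - δ) (s + δ), ∀ x, ∃ u : ℝ → X, u c = x ∧
      ∀ t ∈ Ioo (s - δ) (s + δ), P u t) (s : ℝ) (x : X) :
    ∃ u : ℝ → X, u s = x ∧ ∀ t, P u t := by
  -- Half-widths of intervals about `s` carrying a solution. A finite supremum `R` would be exceeded
  -- by gluing local solutions at both ends.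
  let 𝒜 : Set ℝ := {T | 0 < T ∧ ∃ u : ℝ → X, u s = x ∧ ∀ t ∈ Ioo (s - T) (s + T), P u t}
  have hdown : ∀ T ∈ 𝒜, ∀ T', 0 < T' → T' ≤ T → T' ∈ 𝒜 := by
    rintro T ⟨_, u, hus, hu⟩ T' h0 hT
    exact ⟨h0, u, hus, fun t ht => hu t ⟨by linarith [ht.1], by linarith [ht.2]⟩⟩
  have hne : 𝒜.Nonempty := by
    obtain ⟨δ, hδ, h⟩ := hloc s
    obtain ⟨u, hus, hu⟩ := h s ⟨by linarith, by linarith⟩ x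
    exact ⟨δ, hδ, u, hus, hu⟩
  have hunb : ¬ BddAbove 𝒜 := by
    intro hbdd
    set R := sSup 𝒜
    obtain ⟨T₀, hT₀⟩ := hne
    have hR : 0 < R := hT₀.1.trans_le (le_csSup hbdd hT₀)
    obtain ⟨δ₁, hδ₁, h₁⟩ := hloc (s + R)
    obtain ⟨δ₂, hδ₂, h₂⟩ := hloc (s - R)
    -- With `δ ≤ R`, the switching points `s ± (R - δ/2)` enclose `s`, so the value there survives;
    -- `T > R - δ/4` puts them inside the interval already reached.
    set δ := min (min δ₁ δ₂) R
    have hδ : 0 < δ := lt_min (lt_min hδ₁ hδ₂) hR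
    have hle₁ : δ ≤ δ₁ := (min_le_left _ _).trans (min_le_left _ _)
    have hle₂ : δ ≤ δ₂ := (min_le_left _ _).trans (min_le_right _ _)
    have hleR : δ ≤ R := min_le_right _ _
    obtain ⟨T, hT, hTlt⟩ := exists_lt_of_lt_csSup ⟨T₀, hT₀⟩ (show R - δ / 4 < R by linarith)
    obtain ⟨hT0, u, hus, hu⟩ := hT
    have hTR : T ≤ R := le_csSup hbdd ⟨hT0, u, hus, hu⟩
    obtain ⟨u₁, hu₁c, hu₁⟩ := h₁ (s + R - δ / 2) ⟨by linarith, by linarith⟩ (u (s + R - δ / 2))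
    obtain ⟨w, hw, hwP⟩ := exists_extend_right hgerm huniq hu hu₁
      (c := s + R - δ / 2) ⟨by linarith, by linarith⟩ ⟨by linarith, by linarith⟩ hu₁c
    obtain ⟨u₂, hu₂c, hu₂⟩ := h₂ (s - R + δ / 2) ⟨by linarith, by linarith⟩ (w (s - R + δ / 2))
    obtain ⟨y, hy, hyP⟩ := exists_extend_left hgerm huniq hwP hu₂
      (c := s - R + δ / 2) ⟨by linarith, by linarith⟩ ⟨by linarith, by linarith⟩ hu₂c
    have hmem : R + δ ∈ 𝒜 := ⟨by linarith, y, by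
      rw [hy s (by linarith), hw s (by linarith), hus],
      fun t ht => hyP t ⟨by linarith [ht.1], by linarith [ht.2]⟩⟩
    have := le_csSup hbdd hmem
    linarith
  have hall : ∀ T, 0 < T → ∃ u : ℝ → X, u s = x ∧ ∀ t ∈ Ioo (s - T) (s + T), P u t := by
    intro T hT
    obtain ⟨T', hT', hlt⟩ := not_bddAbove_iff.1 hunb T
    exact (hdown T' hT' T hT hlt.le).2
  have : Nonempty X := ⟨x⟩
  choose! U hU hUP using hall
  have hpos : ∀ t : ℝ, 0 < |t - s| + 1 := fun t => by positivity
  -- The selected solution varies with `t`, but by uniqueness it agrees near a given `t` with the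
  -- single solution of half-width `|t - s| + 2`.
  refine ⟨fun t => U (|t - s| + 1) t, hU _ (hpos s), fun t => ?_⟩
  refine hgerm (U (|t - s| + 2)) _ t ?_ (hUP _ (by positivity) t ?_)
  · have hcont : Continuous fun τ : ℝ => |τ - s| := by fun_prop
    filter_upwards [(hcont.tendsto t).eventually_lt_const (lt_add_one |t - s|)] with τ hτ
    have h := abs_lt.1 (lt_add_one |τ - s|)
    refine (huniq (U (|τ - s| + 1)) (U (|t - s| + 2)) (s - (|τ - s| + 1)) (s + (|τ - s| + 1)) s
      ⟨by linarith [hpos τ], by linarith [hpos τ]⟩ (hUP _ (hpos τ))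
      (fun r hr => hUP _ (by positivity) r ⟨by linarith [hr.1], by linarith [hr.2]⟩)
      (by rw [hU _ (hpos τ), hU _ (by positivity)]) τ ?_).symm
    constructor <;> cases abs_cases (τ - s) <;> linarith
  · constructor <;> cases abs_cases (t - s) <;> linarith

end gluing

/-! ### Linear ordinary differential equations -/

section linearODE

variable {E : Type*} [NormedAddCommGroup E] [NormedSpace ℝ E]

theorem linearODE_unique_Ioo {L : ℝ → E →L[ℝ] E} {b : ℝ → E} (hL : Continuous L) {u v : ℝ → E}
    {α β c : ℝ} (hc : c ∈ Ioo α β) (hu : ∀ t ∈ Ioo α β, HasDerivAt u (L t (u t) + b t) t)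
    (hv : ∀ t ∈ Ioo α β, HasDerivAt v (L t (v t) + b t) t) (h : u c = v c) :
    ∀ t ∈ Ioo α β, u t = v t := by
  obtain ⟨K, hK⟩ := (isCompact_Icc (a := α) (b := β)).exists_bound_of_continuousOn hL.continuousOn
  refine ODE_solution_unique_of_mem_Ioo (v := fun t x => L t x + b t) (s := fun _ => univ)
    (K := K.toNNReal) (fun t ht => ?_) hc (fun t ht => ⟨hu t ht, trivial⟩)
    (fun t ht => ⟨hv t ht, trivial⟩) h
  refine LipschitzOnWith.of_dist_le_mul fun x _ y _ => ?_
  rw [dist_add_right, dist_eq_norm, dist_eq_norm, ← map_sub]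
  exact ((L t).le_opNorm _).trans (mul_le_mul_of_nonneg_right
    ((hK t (Ioo_subset_Icc_self ht)).trans (Real.le_coe_toNNReal K)) (norm_nonneg _))

theorem linearODE_unique {L : ℝ → E →L[ℝ] E} {b : ℝ → E} (hL : Continuous L) {u v : ℝ → E} {c : ℝ}
    (hu : ∀ t, HasDerivAt u (L t (u t) + b t) t) (hv : ∀ t, HasDerivAt v (L t (v t) + b t) t)
    (h : u c = v c) : u = v := by
  funext t
  refine linearODE_unique_Ioo hL (α := min c t - 1) (β := max c t + 1)
    ⟨by linarith [min_le_left c t], by linarith [le_max_left c t]⟩ (fun t _ => hu t)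
    (fun t _ => hv t) h t ⟨by linarith [min_le_right c t], by linarith [le_max_right c t]⟩

/-- For a linear equation the Picard–Lindelöf step depends only on a bound for `‖L‖` and not on the
initial value, because the ball may grow with that value. This uniformity is what `exists_global`
requires. -/
theorem linearODE_exists [CompleteSpace E] {L : ℝ → E →L[ℝ] E} {b : ℝ → E} (hL : Continuous L)
    (hb : Continuous b) (s : ℝ) (x : E) :
    ∃ u : ℝ → E, u s = x ∧ ∀ t, HasDerivAt u (L t (u t) + b t) t := by
  refine exists_global (P := fun u t => HasDerivAt u (L t (u t) + b t) t) ?_ ?_ ?_ s x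
  · intro u v t huv hu
    rw [← huv.eq_of_nhds]
    exact hu.congr_of_eventuallyEq huv.symm
  · intro u v α β c hc hu hv h
    exact linearODE_unique_Ioo hL hc hu hv h
  · intro s
    obtain ⟨K, hK⟩ := (isCompact_Icc (a := s - 1) (b := s + 1)).exists_bound_of_continuousOn
      hL.continuousOn
    obtain ⟨B, hB⟩ := (isCompact_Icc (a := s - 1) (b := s + 1)).exists_bound_of_continuousOn
      hb.continuousOn
    have hs : s ∈ Icc (s - 1) (s + 1) := ⟨by linarith, by linarith⟩
    have hK0 : 0 ≤ K := (norm_nonneg _).trans (hK s hs)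
    have hB0 : 0 ≤ B := (norm_nonneg _).trans (hB s hs)
    -- In the ball of radius `a` about `x` the field is at most `(2K + 1)a`, and the time to either
    -- end is at most `2δ`; this `δ` gives `(2K + 1)a · 2δ ≤ a`.
    set δ : ℝ := 1 / (4 * (K + 1)) with hδdef
    have hδ : 0 < δ := by positivity
    have hδ1 : δ ≤ 1 := by
      rw [hδdef, div_le_one (by positivity)]; linarith
    have hδK : 4 * (K + 1) * δ = 1 := by rw [hδdef]; field_simp
    refine ⟨δ, hδ, fun c hc x => ?_⟩
    have hsub : Icc (s - δ) (s + δ) ⊆ Icc (s - 1) (s + 1) :=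
      Icc_subset_Icc (by linarith) (by linarith)
    set a : ℝ := ‖x‖ + B + 1
    have ha : 0 ≤ a := by positivity
    have hpl : IsPicardLindelof (fun t y => L t y + b t) (tmin := s - δ) (tmax := s + δ)
        ⟨c, hc.1.le, hc.2.le⟩ x a.toNNReal 0 ((2 * K + 1) * a).toNNReal K.toNNReal := by
      refine ⟨fun t ht => ?_, fun y _ => ?_, fun t ht y hy => ?_, ?_⟩
      · refine LipschitzOnWith.of_dist_le_mul fun y _ z _ => ?_
        rw [dist_add_right, dist_eq_norm, dist_eq_norm, ← map_sub]
        exact ((L t).le_opNorm _).trans (mul_le_mul_of_nonneg_right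
          ((hK t (hsub ht)).trans (Real.le_coe_toNNReal K)) (norm_nonneg _))
      · exact ((hL.clm_apply continuous_const).add hb).continuousOn
      · rw [Real.coe_toNNReal _ (by positivity)]
        rw [Real.coe_toNNReal _ ha, Metric.mem_closedBall, dist_eq_norm] at hy
        have hy' : ‖y‖ ≤ 2 * a := by
          have := norm_sub_norm_le y x
          have hxa : ‖x‖ ≤ a := by simp only [a]; linarith
          linarith
        have hBa : B ≤ a := by simp only [a]; linarith [norm_nonneg x]
        calc ‖L t y + b t‖ ≤ K * (2 * a) + a :=
              (norm_add_le _ _).trans (add_le_add (((L t).le_opNorm _).trans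
                (mul_le_mul (hK t (hsub ht)) hy' (norm_nonneg _) hK0)) ((hB t (hsub ht)).trans hBa))
          _ = (2 * K + 1) * a := by ring
      · rw [Real.coe_toNNReal _ (by positivity), Real.coe_toNNReal _ ha]
        have hm : max (s + δ - c) (c - (s - δ)) ≤ 2 * δ :=
          max_le (by linarith [hc.1]) (by linarith [hc.2])
        calc (2 * K + 1) * a * max (s + δ - c) (c - (s - δ)) ≤ (2 * K + 1) * a * (2 * δ) := by gcongr
          _ = (4 * (K + 1) * δ) * a - 2 * δ * a := by ring
          _ ≤ a - (0 : NNReal) := by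
            rw [hδK]
            have : 0 ≤ 2 * δ * a := by positivity
            simp only [one_mul, NNReal.coe_zero, sub_zero]
            linarith
    obtain ⟨u, huc, hu⟩ := hpl.exists_eq_forall_mem_Icc_hasDerivWithinAt₀
    exact ⟨u, huc, fun t ht =>
      (hu t (Ioo_subset_Icc_self ht)).hasDerivAt (Icc_mem_nhds ht.1 ht.2)⟩

variable {ι κ : Type*} [Fintype ι] [Fintype κ]

/-- The linear map `x ↦ A x`. -/
def mulVecCLM (A : Matrix ι ι ℝ) : (ι → ℝ) →L[ℝ] (ι → ℝ) :=
  LinearMap.toContinuousLinearMap A.mulVecLin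

theorem continuous_mulVecCLM {A : ℝ → Matrix ι ι ℝ} (hA : ∀ j k, Continuous fun t => A t j k) :
    Continuous fun t => mulVecCLM (A t) := by
  refine continuous_clm_apply.2 fun x => continuous_pi fun j => ?_
  simp only [mulVecCLM, LinearMap.coe_toContinuousLinearMap', Matrix.mulVecLin_apply,
    Matrix.mulVec, dotProduct]
  exact continuous_finsetSum _ fun k _ => (hA j k).mul continuous_const

theorem vectorODE_existsUnique {A : ℝ → Matrix ι ι ℝ} {b : ℝ → ι → ℝ}
    (hA : ∀ j k, Continuous fun t => A t j k) (hb : ∀ j, Continuous fun t => b t j)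
    (s : ℝ) (x : ι → ℝ) :
    ∃! z : ℝ → ι → ℝ, z s = x ∧ ∀ t j, HasDerivAt (fun τ => z τ j) (((A t).mulVec (z t) + b t) j) t := by
  obtain ⟨u, hus, hu⟩ := linearODE_exists (continuous_mulVecCLM hA) (continuous_pi hb) s x
  refine ⟨u, ⟨hus, fun t j => hasDerivAt_pi.1 (hu t) j⟩, ?_⟩
  rintro v ⟨hvs, hv⟩
  exact linearODE_unique (continuous_mulVecCLM hA) (b := b) (c := s)
    (fun t => hasDerivAt_pi.2 fun j => hv t j) hu (by rw [hvs, hus])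

/-- The linear map `Y ↦ A Y + Y B` on matrices. -/
def matrixMulCLM (A : Matrix ι ι ℝ) (B : Matrix κ κ ℝ) : (ι → κ → ℝ) →L[ℝ] (ι → κ → ℝ) :=
  LinearMap.toContinuousLinearMap
    { toFun := fun Y => A * Matrix.of Y + Matrix.of Y * B
      map_add' := fun Y Z => by
        change A * (Matrix.of Y + Matrix.of Z) + (Matrix.of Y + Matrix.of Z) * B = _
        rw [Matrix.mul_add, Matrix.add_mul]; abel
      map_smul' := fun r Y => by
        change A * (r • Matrix.of Y) + (r • Matrix.of Y) * B = _
        rw [Matrix.mul_smul, Matrix.smul_mul, ← smul_add]; rfl }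

theorem matrixMulCLM_apply (A : Matrix ι ι ℝ) (B : Matrix κ κ ℝ) (Y : ι → κ → ℝ) :
    matrixMulCLM A B Y = A * Matrix.of Y + Matrix.of Y * B := rfl

theorem continuous_matrixMulCLM {A : ℝ → Matrix ι ι ℝ} {B : ℝ → Matrix κ κ ℝ}
    (hA : ∀ j k, Continuous fun t => A t j k) (hB : ∀ j k, Continuous fun t => B t j k) :
    Continuous fun t => matrixMulCLM (A t) (B t) := by
  refine continuous_clm_apply.2 fun x => continuous_pi fun j => continuous_pi fun k => ?_
  simp only [matrixMulCLM_apply, Matrix.add_apply, Matrix.mul_apply]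
  exact (continuous_finsetSum _ fun l _ => (hA j l).mul continuous_const).add
    (continuous_finsetSum _ fun l _ => continuous_const.mul (hB l k))

theorem matrixODE_existsUnique {A : ℝ → Matrix ι ι ℝ} {B : ℝ → Matrix κ κ ℝ}
    (hA : ∀ j k, Continuous fun t => A t j k) (hB : ∀ j k, Continuous fun t => B t j k)
    (s : ℝ) (Y₀ : Matrix ι κ ℝ) :
    ∃! Y : ℝ → Matrix ι κ ℝ, Y s = Y₀ ∧
      ∀ t j k, HasDerivAt (fun τ => Y τ j k) ((A t * Y t + Y t * B t) j k) t := by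
  have hL := continuous_matrixMulCLM hA hB
  obtain ⟨u, hus, hu⟩ := linearODE_exists hL (b := fun _ => 0) continuous_const s
    (Y₀ : ι → κ → ℝ)
  refine ⟨u, ⟨hus, fun t j k => ?_⟩, ?_⟩
  · have := hasDerivAt_pi.1 (hasDerivAt_pi.1 (hu t) j) k
    rw [add_zero] at this
    exact this
  · rintro v ⟨hvs, hv⟩
    refine linearODE_unique hL (b := fun _ => 0) (c := s) (u := (v : ℝ → ι → κ → ℝ))
      (fun t => hasDerivAt_pi.2 fun j => hasDerivAt_pi.2 fun k => ?_) hu (by rw [hvs, hus])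
    rw [add_zero]
    exact hv t j k

end linearODE

variable {n : ℕ}

/-! ### The Hamilton–Ehrenfest system -/

namespace Data

variable (Q : Data n)

theorem continuous_hzz (κt : ℝ) (j k : PIdx n) : Continuous fun t => Q.hzz κt t j k := by
  simp only [hzz, Matrix.add_apply, Matrix.smul_apply, smul_eq_mul]
  exact (Q.Hzz_smooth j k).continuous.add (continuous_const.mul (Q.Wzz_smooth j k).continuous)

/-- The Hamilton--Ehrenfest system has unique global solutions. -/
theorem existsUnique_isHESSolution (κt s : ℝ) (g₀ : Moments n) :
    ∃! g : ℝ → Moments n, Q.IsHESSolution κt g ∧ g s = g₀ := by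
  have h1 : ∀ j k, Continuous fun t => (Q.Hzz t + κt • (Q.Wzz t + Q.Wzw t)) j k := fun j k => by
    simp only [Matrix.add_apply, Matrix.smul_apply, smul_eq_mul]
    exact (Q.Hzz_smooth j k).continuous.add (continuous_const.mul
      ((Q.Wzz_smooth j k).continuous.add (Q.Wzw_smooth j k).continuous))
  have hJ : ∀ {A : ℝ → Matrix (PIdx n) (PIdx n) ℝ}, (∀ j k, Continuous fun t => A t j k) →
      ∀ j k, Continuous fun t => (Matrix.J (Fin n) ℝ * A t) j k := fun hA j k => by
    simp only [Matrix.mul_apply]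
    exact continuous_finsetSum _ fun l _ => continuous_const.mul (hA l k)
  have hJ' : ∀ j k, Continuous fun t => (-(Q.hzz κt t * Matrix.J (Fin n) ℝ)) j k := fun j k => by
    simp only [Matrix.neg_apply, Matrix.mul_apply]
    exact (continuous_finsetSum _ fun l _ => (Q.continuous_hzz κt j l).mul continuous_const).neg
  have hJz : ∀ j, Continuous fun t => (Matrix.J (Fin n) ℝ).mulVec (Q.Hz t) j := fun j => by
    simp only [Matrix.mulVec, dotProduct]
    exact continuous_finsetSum _ fun l _ => continuous_const.mul (Q.Hz_smooth l).continuous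
  -- The system decouples: the equation for `z` is affine and free of `Δ`, the one for `Δ` is linear
  -- and free of `z`.
  obtain ⟨z, ⟨hzs, hz⟩, hzu⟩ := vectorODE_existsUnique (hJ h1) hJz s g₀.1
  obtain ⟨D, ⟨hDs, hD⟩, hDu⟩ := matrixODE_existsUnique (hJ (Q.continuous_hzz κt)) hJ' s g₀.2
  have e1 : ∀ t (y : PIdx n → ℝ), (Matrix.J (Fin n) ℝ).mulVec (Q.hz κt t y) =
      (Matrix.J (Fin n) ℝ * (Q.Hzz t + κt • (Q.Wzz t + Q.Wzw t))).mulVec y +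
        (Matrix.J (Fin n) ℝ).mulVec (Q.Hz t) := fun t y => by
    rw [Data.hz, Matrix.mulVec_add, Matrix.mulVec_mulVec, add_comm]
  have e2 : ∀ t (Y : Matrix (PIdx n) (PIdx n) ℝ), Matrix.J (Fin n) ℝ * Q.hzz κt t * Y -
      Y * Q.hzz κt t * Matrix.J (Fin n) ℝ = Matrix.J (Fin n) ℝ * Q.hzz κt t * Y +
        Y * -(Q.hzz κt t * Matrix.J (Fin n) ℝ) := fun t Y => by
    rw [Matrix.mul_neg, ← Matrix.mul_assoc, sub_eq_add_neg]
  refine ⟨fun t => (z t, D t), ⟨⟨fun t j => ?_, fun t j k => ?_⟩, Prod.ext hzs hDs⟩, ?_⟩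
  · rw [e1]; exact hz t j
  · rw [e2]; exact hD t j k
  · rintro g ⟨⟨hg1, hg2⟩, hgs⟩
    have h1 := hzu (fun t => (g t).1) ⟨congrArg Prod.fst hgs, fun t j => by rw [← e1]; exact hg1 t j⟩
    have h2 := hDu (fun t => (g t).2) ⟨congrArg Prod.snd hgs, fun t j k => by rw [← e2]; exact hg2 t j k⟩
    funext t
    exact Prod.ext (congrFun h1 t) (congrFun h2 t)

theorem hes_spec (κt s : ℝ) (g₀ : Moments n) :
    Q.IsHESSolution κt (Q.hes κt s g₀) ∧ Q.hes κt s g₀ s = g₀ :=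
  Classical.epsilon_spec (Q.existsUnique_isHESSolution κt s g₀).exists

theorem hes_eq {κt s : ℝ} {g₀ : Moments n} {g : ℝ → Moments n} (h : Q.IsHESSolution κt g)
    (hs : g s = g₀) : Q.hes κt s g₀ = g :=
  (Q.existsUnique_isHESSolution κt s g₀).unique (Q.hes_spec κt s g₀) ⟨h, hs⟩

end Data

end NonlocalGPE
end

/-! ### Canonical commutation relations, symmetric operators and the evolution of moments. -/

noncomputable section

namespace NonlocalGPE

open Filter MeasureTheory

variable {n : ℕ}

/-! ### The algebra of momentum and position operators -/

/-- The operators `ẑ` on the Schwartz space. -/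
def Zop (hbar : ℝ) : PIdx n → (Sch n →L[ℂ] Sch n)
  | Sum.inl j => (-Complex.I * (hbar : ℂ)) • Dop j
  | Sum.inr j => Xop j

theorem zhat_coe (hbar : ℝ) (j : PIdx n) (f : Sch n) : zhat hbar j f = Zop hbar j f := by
  funext x
  rcases j with j | j
  · simp [zhat, Zop, Dop_apply]
  · simp [zhat, Zop]

/-- The operators `Δẑ = ẑ - z` on the Schwartz space. -/
def dZop (hbar : ℝ) (z : PIdx n → ℝ) (j : PIdx n) : Sch n →L[ℂ] Sch n :=
  Zop hbar j - (z j : ℂ) • 1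

theorem dZop_apply (hbar : ℝ) (z : PIdx n → ℝ) (j : PIdx n) (f : Sch n) :
    dZop hbar z j f = Zop hbar j f - (z j : ℂ) • f := rfl

theorem dzhat_coe (hbar : ℝ) (z : PIdx n → ℝ) (j : PIdx n) (f : Sch n) :
    dzhat hbar z j f = dZop hbar z j f := by
  funext x
  simp [dzhat, zhat_coe, dZop_apply]

@[simp] theorem dZop_zero (hbar : ℝ) (j : PIdx n) : dZop hbar 0 j = Zop hbar j := by
  simp [dZop]

theorem Dop_Xop (j k : Fin n) (f : Sch n) :
    Dop j (Xop k f) = Xop k (Dop j f) + (if j = k then (1 : ℂ) else 0) • f := by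
  ext x
  have h1 : HasFDerivAt (fun y : Cfg n => ((y k : ℝ) : ℂ))
      (Complex.ofRealCLM ∘L (EuclideanSpace.proj (𝕜 := ℝ) k)) x :=
    (Complex.ofRealCLM ∘L (EuclideanSpace.proj (𝕜 := ℝ) k)).hasFDerivAt
  have h2 : (Xop k f : Cfg n → ℂ) = fun y => ((y k : ℝ) : ℂ) * f y := by
    funext y; simp
  have h3 : fderiv ℝ (fun y : Cfg n => ((y k : ℝ) : ℂ) * f y) x = _ :=
    (h1.mul (f.hasFDerivAt x)).fderiv
  rw [Dop_apply, h2, h3]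
  by_cases h : j = k
  · subst h; simp [Dop_apply]
  · simp [Dop_apply, h, Ne.symm h]

theorem Dop_comm (j k : Fin n) (f : Sch n) : Dop j (Dop k f) = Dop k (Dop j f) := by
  ext x
  have hs : ContDiffAt ℝ 2 f x := (f.contDiffAt 2)
  have h := hs.isSymmSndFDerivAt (by simp)
  have key : ∀ v w : Cfg n, fderiv ℝ (fun y => fderiv ℝ f y w) x v = fderiv ℝ (fderiv ℝ f) x v w := by
    intro v w
    have hd : DifferentiableAt ℝ (fderiv ℝ f) x :=
      (hs.fderiv_right (m := 1) (by norm_num)).differentiableAt (by norm_num)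
    have := (hd.hasFDerivAt.clm_apply (hasFDerivAt_const w x)).fderiv
    rw [this]
    simp
  change fderiv ℝ (fun y => fderiv ℝ f y (EuclideanSpace.single k 1)) x (EuclideanSpace.single j 1) =
    fderiv ℝ (fun y => fderiv ℝ f y (EuclideanSpace.single j 1)) x (EuclideanSpace.single k 1)
  rw [key, key]
  exact h _ _

/-- The canonical commutation relations `[ẑ_j, ẑ_k] = iħ J_jk`, obtained from the Leibniz rule and
the symmetry of second derivatives. -/
theorem Zop_comm (hbar : ℝ) (j k : PIdx n) : (Zop hbar j : Sch n →L[ℂ] Sch n) * Zop hbar k =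
    Zop hbar k * Zop hbar j + (Complex.I * hbar * (Matrix.J (Fin n) ℝ j k : ℝ)) • 1 := by
  refine ContinuousLinearMap.ext fun f => ?_
  rcases j with j | j <;> rcases k with k | k <;>
    simp only [Zop, mul_apply_eq_comp, add_apply, smul_apply, map_smul,
      Matrix.J, Matrix.fromBlocks_apply₁₁, Matrix.fromBlocks_apply₁₂,
      Matrix.fromBlocks_apply₂₁, Matrix.fromBlocks_apply₂₂, Matrix.zero_apply, Matrix.neg_apply,
      Complex.ofReal_zero, mul_zero, zero_smul, add_zero, Matrix.one_apply]
  · rw [Dop_comm]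
  · rw [Dop_Xop, smul_add, smul_smul]
    congr 2
    split_ifs <;> simp
  · rw [Dop_Xop, smul_add, smul_smul, add_assoc]
    simp only [@eq_comm _ j k]
    split_ifs <;> ext x <;> simp
  · ext x; simp; ring

theorem dZop_comm (hbar : ℝ) (z : PIdx n → ℝ) (j k : PIdx n) : dZop hbar z j * dZop hbar z k =
    dZop hbar z k * dZop hbar z j + (Complex.I * hbar * (Matrix.J (Fin n) ℝ j k : ℝ)) • 1 := by
  simp only [dZop, mul_sub, sub_mul, Zop_comm hbar j k, smul_mul_assoc, mul_smul_comm, one_mul,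
    mul_one, smul_sub, smul_smul, mul_comm (z k : ℂ) (z j : ℂ)]
  abel

/-- The operator `c + ⟨v, Δẑ⟩ + ½⟨Δẑ, S Δẑ⟩`, where `Δẑ = ẑ - z`. -/
def quadOp (hbar : ℝ) (z : PIdx n → ℝ) (c : ℝ) (v : PIdx n → ℝ)
    (S : Matrix (PIdx n) (PIdx n) ℝ) : Sch n →L[ℂ] Sch n :=
  (c : ℂ) • 1 + ∑ j, (v j : ℂ) • dZop hbar z j +
    (1 / 2 : ℂ) • ∑ j, ∑ k, (S j k : ℂ) • (dZop hbar z j * dZop hbar z k)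

/-- Commutators of the `Δẑ_j` are scalars, so a quadratic operator has affine commutators with them:
the linear Hamiltonian vector field. Symmetry of `S` merges the two quadratic contributions and
cancels the factor `½`; antisymmetry of `J` produces the sign. -/
theorem quadOp_comm (hbar : ℝ) (z : PIdx n → ℝ) (c : ℝ) (v : PIdx n → ℝ)
    {S : Matrix (PIdx n) (PIdx n) ℝ} (hS : S.IsSymm) (l : PIdx n) :
    quadOp hbar z c v S * dZop hbar z l - dZop hbar z l * quadOp hbar z c v S =
      (-(Complex.I * hbar)) • ((((Matrix.J (Fin n) ℝ).mulVec v l : ℝ) : ℂ) • 1 +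
        ∑ k, (((Matrix.J (Fin n) ℝ * S) l k : ℝ) : ℂ) • dZop hbar z k) := by
  set D := dZop (n := n) hbar z
  set J := Matrix.J (Fin n) ℝ
  have hJ : ∀ j, (J j l : ℂ) = -(J l j : ℂ) := fun j => by
    have : J.transpose j l = -J j l := by rw [Matrix.J_transpose]; rfl
    rw [← Complex.ofReal_neg, ← neg_eq_iff_eq_neg.2 this.symm.symm]
    simp [Matrix.transpose_apply]
  have h1 : ∀ j, D j * D l - D l * D j = (Complex.I * hbar * (J j l : ℝ)) • 1 := fun j => by
    rw [dZop_comm hbar z j l]; abel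
  have h2 : ∀ j k, D j * D k * D l - D l * (D j * D k) =
      (Complex.I * hbar * (J k l : ℝ)) • D j + (Complex.I * hbar * (J j l : ℝ)) • D k := fun j k => by
    have : D j * D k * D l - D l * (D j * D k) =
      D j * (D k * D l - D l * D k) + (D j * D l - D l * D j) * D k := by noncomm_ring
    rw [this, h1, h1, mul_smul_comm, smul_mul_assoc, mul_one, one_mul]
  have e1 : quadOp hbar z c v S * D l - D l * quadOp hbar z c v S =
      ∑ j, (v j : ℂ) • (D j * D l - D l * D j) +
        (1 / 2 : ℂ) • ∑ j, ∑ k, (S j k : ℂ) • (D j * D k * D l - D l * (D j * D k)) := by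
    simp only [quadOp, add_mul, mul_add, smul_mul_assoc, mul_smul_comm, Finset.sum_mul,
      Finset.mul_sum, one_mul, mul_one, smul_sub, Finset.sum_sub_distrib]
    abel
  rw [e1]
  simp only [h1, h2]
  have e2 : ∑ j, ∑ k, (S j k : ℂ) • ((Complex.I * hbar * (J k l : ℝ)) • D j +
      (Complex.I * hbar * (J j l : ℝ)) • D k) =
      (2 : ℂ) • ∑ j, ∑ k, (S j k : ℂ) • (Complex.I * hbar * (J j l : ℝ)) • D k := by
    simp only [smul_add, Finset.sum_add_distrib]
    rw [Finset.sum_comm, two_smul]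
    congr 1
    refine Finset.sum_congr rfl fun j _ => Finset.sum_congr rfl fun k _ => ?_
    rw [hS.apply]
  rw [e2, smul_smul, Finset.sum_comm, show (1 / 2 : ℂ) * 2 = 1 by norm_num, one_smul]
  simp only [smul_add, Finset.smul_sum, Matrix.mulVec, dotProduct, Matrix.mul_apply,
    Complex.ofReal_sum, Finset.sum_smul, Complex.ofReal_mul, smul_smul, hJ]
  congr 1
  · refine Finset.sum_congr rfl fun j _ => ?_
    congr 1; ring
  · refine Finset.sum_congr rfl fun j _ => Finset.sum_congr rfl fun k _ => ?_
    congr 1; ring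

/-- Change of the centre of a quadratic operator. -/
theorem quadOp_recenter (hbar : ℝ) (z : PIdx n → ℝ) (c : ℝ) (v : PIdx n → ℝ)
    {S : Matrix (PIdx n) (PIdx n) ℝ} (hS : S.IsSymm) :
    quadOp hbar 0 c v S =
      quadOp hbar z (c + v ⬝ᵥ z + 1 / 2 * (z ⬝ᵥ S.mulVec z)) (v + S.mulVec z) S := by
  have hZ : ∀ j, (Zop hbar j : Sch n →L[ℂ] Sch n) = dZop hbar z j + (z j : ℂ) • 1 := fun j => by
    simp [dZop]
  simp only [quadOp, dZop_zero, hZ]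
  set D := dZop (n := n) hbar z
  have e1 : ∑ j, ∑ k, (S j k : ℂ) • ((D j + (z j : ℂ) • 1) * (D k + (z k : ℂ) • 1)) =
      ∑ j, ∑ k, (S j k : ℂ) • (D j * D k) + (2 : ℂ) • ∑ j, ∑ k, ((S j k : ℂ) * z k) • D j +
        (∑ j, ∑ k, (z j : ℂ) * (S j k * z k)) • 1 := by
    have e2 : ∑ j, ∑ k, ((S j k : ℂ) * z j) • D k = ∑ j, ∑ k, ((S j k : ℂ) * z k) • D j := by
      rw [Finset.sum_comm]
      refine Finset.sum_congr rfl fun j _ => Finset.sum_congr rfl fun k _ => ?_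
      rw [hS.apply]
    rw [two_smul]
    nth_rewrite 1 [← e2]
    simp only [Finset.sum_smul, ← Finset.sum_add_distrib]
    refine Finset.sum_congr rfl fun j _ => Finset.sum_congr rfl fun k _ => ?_
    simp only [mul_add, add_mul, smul_mul_assoc, mul_smul_comm, one_mul, mul_one, smul_add, smul_smul]
    rw [show (S j k : ℂ) * ((z k : ℂ) * z j) = z j * (S j k * z k) by ring]
    abel
  rw [e1]
  simp only [smul_add, smul_smul, Finset.sum_add_distrib, Pi.add_apply, Complex.ofReal_add, add_smul,
    Matrix.mulVec, dotProduct, Complex.ofReal_sum, Complex.ofReal_mul, Finset.mul_sum,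
    Finset.sum_smul, Finset.smul_sum]
  have h12 : ∀ a : ℂ, (1 / 2 : ℂ) * (2 * a) = a := fun a => by ring
  simp only [h12, Complex.ofReal_div, Complex.ofReal_one, Complex.ofReal_ofNat]
  abel

end NonlocalGPE
end

noncomputable section

namespace NonlocalGPE

open Filter MeasureTheory

variable {n : ℕ}

/-! ### The `L²` inner product on the Schwartz space -/

/-- The embedding of the Schwartz space into `L²`. -/
def toL2 : Sch n →L[ℂ] Lp ℂ 2 (volume : Measure (Cfg n)) := SchwartzMap.toLpCLM ℂ ℂ 2 volume

/-- The `L²` inner product `⟨f|g⟩`. -/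
def ip (f g : Sch n) : ℂ := inner ℂ (toL2 f) (toL2 g)

theorem ip_eq_integral (f g : Sch n) : ip f g = ∫ x, (starRingEnd ℂ) (f x) * g x := by
  refine (SchwartzMap.inner_toL2_toL2_eq f g volume).trans ?_
  simp [mul_comm]

theorem ip_add_left (f f' g : Sch n) : ip (f + f') g = ip f g + ip f' g := by
  simp [ip, inner_add_left]

theorem ip_add_right (f g g' : Sch n) : ip f (g + g') = ip f g + ip f g' := by
  simp [ip, inner_add_right]

theorem ip_sub_right (f g g' : Sch n) : ip f (g - g') = ip f g - ip f g' := by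
  simp [ip, inner_sub_right]

theorem ip_smul_left (c : ℂ) (f g : Sch n) : ip (c • f) g = (starRingEnd ℂ) c * ip f g := by
  simp [ip, inner_smul_left]

theorem ip_smul_right (c : ℂ) (f g : Sch n) : ip f (c • g) = c * ip f g := by
  simp [ip, inner_smul_right]

theorem ip_sum_left {κ : Type*} (s : Finset κ) (f : κ → Sch n) (g : Sch n) :
    ip (∑ i ∈ s, f i) g = ∑ i ∈ s, ip (f i) g := by
  simp [ip, sum_inner]

theorem ip_sum_right {κ : Type*} (s : Finset κ) (f : Sch n) (g : κ → Sch n) :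
    ip f (∑ i ∈ s, g i) = ∑ i ∈ s, ip f (g i) := by
  simp [ip, inner_sum]

theorem ip_conj (f g : Sch n) : (starRingEnd ℂ) (ip g f) = ip f g := inner_conj_symm _ _

theorem ip_self (f : Sch n) : ip f f = (normSq f : ℂ) := by
  rw [ip_eq_integral, normSq, ← integral_complex_ofReal]
  congr 1
  funext x
  rw [mul_comm, Complex.mul_conj, Complex.normSq_eq_norm_sq]

theorem normSq_eq_norm_toL2 (f : Sch n) : normSq f = ‖toL2 f‖ ^ 2 := by
  have h : ((normSq f : ℝ) : ℂ) = ((‖toL2 f‖ ^ 2 : ℝ) : ℂ) := by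
    rw [← ip_self, ip, inner_self_eq_norm_sq_to_K]; simp
  exact_mod_cast h

theorem eq_zero_of_normSq_eq_zero {f : Sch n} (h : normSq f = 0) : f = 0 := by
  rw [normSq_eq_norm_toL2, sq_eq_zero_iff, norm_eq_zero] at h
  refine SchwartzMap.injective_toLp 2 volume ?_
  change toL2 f = toL2 0
  rw [h, map_zero]

theorem normSq_zero : normSq (0 : Cfg n → ℂ) = 0 := by simp [normSq]

theorem HasCurveDerivAt.ip {u v : ℝ → Sch n} {u' v' : Sch n} {t : ℝ} (hu : HasCurveDerivAt u u' t)
    (hv : HasCurveDerivAt v v' t) :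
    HasDerivAt (fun τ => NonlocalGPE.ip (u τ) (v τ))
      (NonlocalGPE.ip (u t) v' + NonlocalGPE.ip u' (v t)) t :=
  ((hu.clm (toL2.restrictScalars ℝ)).hasDerivAt).inner ℂ ((hv.clm (toL2.restrictScalars ℝ)).hasDerivAt)

theorem continuousAt_ip {u v : ℝ → Sch n} {t : ℝ} (hu : ContinuousAt u t) (hv : ContinuousAt v t) :
    ContinuousAt (fun τ => ip (u τ) (v τ)) t :=
  (toL2.continuous.continuousAt.comp hu).inner (toL2.continuous.continuousAt.comp hv)

/-! ### Symmetric operators -/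

/-- Symmetric operators on the Schwartz space. -/
def IsSym (A : Sch n →L[ℂ] Sch n) : Prop := ∀ f g, ip (A f) g = ip f (A g)

theorem isSym_one : IsSym (1 : Sch n →L[ℂ] Sch n) := fun _ _ => rfl

theorem IsSym.add {A B : Sch n →L[ℂ] Sch n} (hA : IsSym A) (hB : IsSym B) : IsSym (A + B) :=
  fun f g => by simp [ip_add_left, ip_add_right, hA f g, hB f g]

theorem IsSym.smul {A : Sch n →L[ℂ] Sch n} (hA : IsSym A) (c : ℝ) : IsSym ((c : ℂ) • A) :=
  fun f g => by
    rw [smul_apply, smul_apply, ip_smul_left, ip_smul_right, hA f g, Complex.conj_ofReal]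

theorem IsSym.sum {κ : Type*} (s : Finset κ) {A : κ → Sch n →L[ℂ] Sch n} (hA : ∀ i, IsSym (A i)) :
    IsSym (∑ i ∈ s, A i) :=
  fun f g => by simp [ip_sum_left, ip_sum_right, fun i => hA i f g]

theorem IsSym.im_eq_zero {A : Sch n →L[ℂ] Sch n} (hA : IsSym A) (f : Sch n) :
    (ip f (A f)).im = 0 := by
  rw [← Complex.conj_eq_iff_im, ip_conj, hA]

theorem IsSym.ofReal_re {A : Sch n →L[ℂ] Sch n} (hA : IsSym A) (f : Sch n) :
    ((ip f (A f)).re : ℂ) = ip f (A f) :=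
  Complex.ext (by simp) (by simp [hA.im_eq_zero f])

/-- Integration by parts for the momenta, reality of the coordinates for the positions. -/
theorem isSym_Zop (hbar : ℝ) (j : PIdx n) : IsSym (Zop (n := n) hbar j) := by
  intro f g
  rcases j with j | j
  · have hB := SchwartzMap.integral_bilinear_lineDerivOp_right_eq_neg_left (μ := volume) f g
      ((ContinuousLinearMap.mul ℝ ℂ).comp (Complex.conjCLE : ℂ →L[ℝ] ℂ))
      (EuclideanSpace.single j (1 : ℝ))
    have h : ip f (Dop j g) = -ip (Dop j f) g := by
      rw [ip_eq_integral, ip_eq_integral]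
      exact hB
    simp only [Zop, smul_apply, ip_smul_left, ip_smul_right, h]
    simp
  · simp only [Zop, ip_eq_integral, Xop_apply]
    congr 1
    funext x
    simp only [map_mul, Complex.conj_ofReal]
    ring

theorem isSym_dZop (hbar : ℝ) (z : PIdx n → ℝ) (j : PIdx n) : IsSym (dZop (n := n) hbar z j) := by
  intro f g
  have := ((isSym_Zop hbar j).add (isSym_one.smul (-(z j)))) f g
  simpa [dZop, sub_eq_add_neg] using this

/-- The adjoint of `Δẑ_j Δẑ_k` is `Δẑ_k Δẑ_j`, and symmetry of `S` absorbs the exchange. -/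
theorem isSym_quadOp (hbar : ℝ) (z : PIdx n → ℝ) (c : ℝ) (v : PIdx n → ℝ)
    {S : Matrix (PIdx n) (PIdx n) ℝ} (hS : S.IsSymm) : IsSym (quadOp hbar z c v S) := by
  refine ((isSym_one.smul c).add (IsSym.sum _ fun j => (isSym_dZop hbar z j).smul (v j))).add ?_
  intro f g
  have h2 : ∀ j k, ip ((dZop hbar z j * dZop hbar z k) f) g =
      ip f ((dZop hbar z k * dZop hbar z j) g) := fun j k => by
    rw [mul_apply_eq_comp, mul_apply_eq_comp, isSym_dZop, isSym_dZop]
  simp only [smul_apply, sum_apply, ip_smul_left, ip_smul_right, ip_sum_left, ip_sum_right, h2,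
    Complex.conj_ofReal]
  rw [Finset.sum_comm]
  simp only [hS.apply]
  congr 1
  simp only [map_div₀, map_one, map_ofNat]

/-! ### Moments -/

theorem mean_coe {A : (Cfg n → ℂ) → (Cfg n → ℂ)} {f : Sch n} {B : Sch n →L[ℂ] Sch n}
    (h : A f = B f) : mean A f = (normSq f)⁻¹ * (ip f (B f)).re := by
  rw [mean, h, ip_eq_integral]

theorem zMean_apply (hbar : ℝ) (f : Sch n) (j : PIdx n) :
    zMean hbar f j = (normSq f)⁻¹ * (ip f (Zop hbar j f)).re :=
  mean_coe (zhat_coe hbar j f)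

theorem DeltaMean_apply (hbar : ℝ) (f : Sch n) (j k : PIdx n) :
    DeltaMean hbar f j k = (normSq f)⁻¹ * (1 / 2 *
      (ip f ((dZop hbar (zMean hbar f) j * dZop hbar (zMean hbar f) k +
        dZop hbar (zMean hbar f) k * dZop hbar (zMean hbar f) j) f)).re) := by
  rw [DeltaMean, Matrix.of_apply, mean_coe
    (B := dZop hbar (zMean hbar f) j * dZop hbar (zMean hbar f) k +
        dZop hbar (zMean hbar f) k * dZop hbar (zMean hbar f) j)]
  · ring
  · funext x
    simp [dzhat_coe]

/-- The form without division also covers `f = 0`, where the mean is zero by convention. -/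
theorem ip_Zop (hbar : ℝ) (f : Sch n) (j : PIdx n) :
    ip f (Zop hbar j f) = (normSq f : ℂ) * zMean hbar f j := by
  by_cases h : normSq f = 0
  · rw [eq_zero_of_normSq_eq_zero h]; simp [ip, normSq_zero]
  · rw [zMean_apply, ← (isSym_Zop hbar j).ofReal_re, ← Complex.ofReal_mul, mul_inv_cancel_left₀ h]
    simp

theorem ip_dZop (hbar : ℝ) (z : PIdx n → ℝ) (f : Sch n) (j : PIdx n) :
    ip f (dZop hbar z j f) = (normSq f : ℂ) * ((zMean hbar f j - z j : ℝ) : ℂ) := by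
  rw [dZop_apply, ip_sub_right, ip_Zop, ip_smul_right, ip_self]
  push_cast
  ring

theorem normSq_mul_DeltaMean (hbar : ℝ) (f : Sch n) (j k : PIdx n) :
    (normSq f : ℂ) * DeltaMean hbar f j k = 1 / 2 *
      (ip f (dZop hbar (zMean hbar f) j (dZop hbar (zMean hbar f) k f)) +
        ip f (dZop hbar (zMean hbar f) k (dZop hbar (zMean hbar f) j f))) := by
  by_cases h : normSq f = 0
  · rw [eq_zero_of_normSq_eq_zero h]; simp [ip, normSq_zero]
  · have hs : IsSym (dZop hbar (zMean hbar f) j * dZop hbar (zMean hbar f) k +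
        dZop hbar (zMean hbar f) k * dZop hbar (zMean hbar f) j : Sch n →L[ℂ] Sch n) := fun u v => by
      simp only [add_apply, mul_apply_eq_comp, ip_add_left, ip_add_right, isSym_dZop _ _ _ _ _]
      rw [add_comm]
    rw [DeltaMean_apply, Complex.ofReal_mul, Complex.ofReal_inv,
      mul_inv_cancel_left₀ (by exact_mod_cast h), Complex.ofReal_mul, hs.ofReal_re]
    simp [ip_add_right]

theorem DeltaMean_symm (hbar : ℝ) (f : Sch n) (j k : PIdx n) :
    DeltaMean hbar f j k = DeltaMean hbar f k j := by
  rw [DeltaMean_apply, DeltaMean_apply, add_comm]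

/-! ### Evolution of the norm and of the moments -/

section evolution

variable {hbar : ℝ} {u : ℝ → Sch n} {z : ℝ → PIdx n → ℝ} {c : ℝ → ℝ} {v : ℝ → PIdx n → ℝ}
  {S : ℝ → Matrix (PIdx n) (PIdx n) ℝ}

/-- Heisenberg's equation: the two terms of the product rule combine into a commutator because `L`
is symmetric and `-i/ħ` is imaginary. -/
theorem ip_generator (hbar : ℝ) {L : Sch n →L[ℂ] Sch n} (hL : IsSym L) (A : Sch n →L[ℂ] Sch n)
    (f : Sch n) : ip f (A ((-(Complex.I / hbar)) • L f)) + ip ((-(Complex.I / hbar)) • L f) (A f) =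
      Complex.I / hbar * ip f ((L * A - A * L) f) := by
  simp only [map_smul, ip_smul_left, ip_smul_right, hL f, sub_apply, mul_apply_eq_comp, ip_sub_right]
  simp
  ring

theorem hasDerivAt_re {f : ℝ → ℂ} {f' : ℂ} {t : ℝ} (h : HasDerivAt f f' t) :
    HasDerivAt (fun τ => (f τ).re) f'.re t :=
  Complex.reCLM.hasFDerivAt.comp_hasDerivAt t h

theorem hasDerivAt_normSq {t : ℝ} {L : Sch n →L[ℂ] Sch n} (hL : IsSym L)
    (hu : HasCurveDerivAt u ((-(Complex.I / hbar)) • L (u t)) t) :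
    HasDerivAt (fun τ => normSq (u τ)) 0 t := by
  have h := hu.ip hu
  have h1 := ip_generator hbar hL 1 (u t)
  simp only [one_apply_eq_self, mul_one, one_mul, sub_self] at h1
  rw [h1] at h
  have h2 : ip (u t) ((0 : Sch n →L[ℂ] Sch n) (u t)) = 0 := by simp [ip]
  rw [h2, mul_zero] at h
  simpa only [ip_self, Complex.ofReal_re, Complex.zero_re] using hasDerivAt_re h

theorem normSq_eq_of_evolution {a b : ℝ} {L : ℝ → Sch n →L[ℂ] Sch n} (hL : ∀ t, IsSym (L t))
    (hu : ∀ t ∈ Set.Ioo a b, HasCurveDerivAt u ((-(Complex.I / hbar)) • L t (u t)) t) {s t : ℝ}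
    (hs : s ∈ Set.Ioo a b) (ht : t ∈ Set.Ioo a b) : normSq (u s) = normSq (u t) := by
  have hd : ∀ t ∈ Set.Ioo a b, HasDerivAt (fun τ => normSq (u τ)) 0 t := fun t ht =>
    hasDerivAt_normSq (hL t) (hu t ht)
  exact isOpen_Ioo.is_const_of_deriv_eq_zero isPreconnected_Ioo
    (fun r hr => (hd r hr).differentiableAt.differentiableWithinAt) (fun r hr => (hd r hr).deriv) hs ht

theorem hbar_cancel (hbar0 : hbar ≠ 0) (a : ℂ) :
    Complex.I / hbar * (-(Complex.I * hbar) * a) = a := by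
  have : (hbar : ℂ) ≠ 0 := by exact_mod_cast hbar0
  field_simp
  simp

/-- Ehrenfest's theorem, exact for quadratic generators. The centre `z` is not assumed to be the
mean; the deviation term is what later forces the two to coincide. -/
theorem hasDerivAt_ip_Zop (hbar0 : hbar ≠ 0) {t : ℝ} {z : PIdx n → ℝ} {c : ℝ} {v : PIdx n → ℝ}
    {S : Matrix (PIdx n) (PIdx n) ℝ} (hS : S.IsSymm)
    (hu : HasCurveDerivAt u ((-(Complex.I / hbar)) • quadOp hbar z c v S (u t)) t) (l : PIdx n) :
    HasDerivAt (fun τ => ip (u τ) (Zop hbar l (u τ)))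
      ((normSq (u t) : ℂ) * (((Matrix.J (Fin n) ℝ).mulVec v l +
        (Matrix.J (Fin n) ℝ * S).mulVec (zMean hbar (u t) - z) l : ℝ) : ℂ)) t := by
  have h := hu.ip (hu.clm ((Zop hbar l).restrictScalars ℝ))
  have hZ : Zop hbar l = dZop hbar z l + ((z l : ℝ) : ℂ) • (1 : Sch n →L[ℂ] Sch n) := by
    simp [dZop]
  have hcomm : quadOp hbar z c v S * Zop hbar l - Zop hbar l * quadOp hbar z c v S =
      quadOp hbar z c v S * dZop hbar z l - dZop hbar z l * quadOp hbar z c v S := by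
    rw [hZ]
    simp only [mul_add, add_mul, mul_smul_comm, smul_mul_assoc, mul_one, one_mul]
    abel
  have h1 := ip_generator hbar (isSym_quadOp hbar z c v hS) (Zop hbar l) (u t)
  rw [hcomm, quadOp_comm hbar z c v hS, smul_apply, ip_smul_right, hbar_cancel hbar0] at h1
  refine HasDerivAt.congr_deriv h (h1.trans (Eq.symm ?_))
  simp only [add_apply, smul_apply, sum_apply, ip_add_right, ip_sum_right, ip_smul_right, ip_dZop,
    one_apply_eq_self, ip_self, Matrix.mulVec, dotProduct, Pi.sub_apply]
  push_cast
  rw [mul_add, Finset.mul_sum, Finset.mul_sum]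
  congr 1
  · rw [Finset.sum_mul]; exact Finset.sum_congr rfl fun j _ => by ring
  · exact Finset.sum_congr rfl fun j _ => by ring

/-- The commutator of the generator with `Δẑ_j Δẑ_k` contains first-order terms with coefficients `J
v`. The motion `ż = J v` of the centre cancels them, leaving only second-order products. -/
theorem hasDerivAt_ip_dZop_dZop (hbar0 : hbar ≠ 0) {t : ℝ} {c : ℝ} {v : PIdx n → ℝ}
    {S : Matrix (PIdx n) (PIdx n) ℝ} (hS : S.IsSymm)
    (hu : HasCurveDerivAt u ((-(Complex.I / hbar)) • quadOp hbar (z t) c v S (u t)) t)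
    (hz : ∀ j, HasDerivAt (fun τ => z τ j) ((Matrix.J (Fin n) ℝ).mulVec v j) t) (j k : PIdx n) :
    HasDerivAt (fun τ => ip (u τ) (dZop hbar (z τ) j (dZop hbar (z τ) k (u τ))))
      (∑ l, ((Matrix.J (Fin n) ℝ * S) j l : ℂ) * ip (u t) (dZop hbar (z t) l (dZop hbar (z t) k (u t))) +
        ∑ l, ((Matrix.J (Fin n) ℝ * S) k l : ℂ) *
          ip (u t) (dZop hbar (z t) j (dZop hbar (z t) l (u t)))) t := by
  set J := Matrix.J (Fin n) ℝ
  set L := quadOp hbar (z t) c v S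
  set D := dZop (n := n) hbar (z t)
  have hd : ∀ (l : PIdx n) {w : ℝ → Sch n} {w' : Sch n}, HasCurveDerivAt w w' t →
      HasCurveDerivAt (fun τ => dZop hbar (z τ) l (w τ))
        (D l w' - ((J.mulVec v l : ℝ) : ℂ) • w t) t := by
    intro l w w' hw
    have hz' : HasDerivAt (fun τ => -((z τ l : ℝ) : ℂ)) (-((J.mulVec v l : ℝ) : ℂ)) t :=
      (hz l).ofReal_comp.neg
    have := (hw.clm ((Zop hbar l).restrictScalars ℝ)).add (hw.smul hz')
    convert this using 1
    · funext τ; simp [dZop_apply, sub_eq_add_neg]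
    · simp only [D, dZop_apply, ContinuousLinearMap.coe_restrictScalars', neg_smul]; abel
  have h := hu.ip (hd j (hd k hu))
  have hL : ∀ l, L * D l - D l * L = (-(Complex.I * hbar)) • (((J.mulVec v l : ℝ) : ℂ) • 1 +
      ∑ m, (((J * S) l m : ℝ) : ℂ) • D m) := fun l => quadOp_comm hbar (z t) c v hS l
  have h2 : L * (D j * D k) - D j * D k * L = (-(Complex.I * hbar)) •
      (((J.mulVec v j : ℝ) : ℂ) • D k + ((J.mulVec v k : ℝ) : ℂ) • D j +
        (∑ m, (((J * S) j m : ℝ) : ℂ) • (D m * D k) + ∑ m, (((J * S) k m : ℝ) : ℂ) • (D j * D m))) := by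
    have : L * (D j * D k) - D j * D k * L =
      (L * D j - D j * L) * D k + D j * (L * D k - D k * L) := by noncomm_ring
    rw [this, hL, hL]
    simp only [smul_mul_assoc, mul_smul_comm, add_mul, mul_add, Finset.sum_mul, Finset.mul_sum,
      one_mul, mul_one, smul_add]
    abel
  have h1 := ip_generator hbar (isSym_quadOp hbar (z t) c v hS) (D j * D k) (u t)
  change _ = Complex.I / hbar * ip (u t) ((L * (D j * D k) - D j * D k * L) (u t)) at h1
  rw [h2, smul_apply, ip_smul_right, hbar_cancel hbar0] at h1
  convert h using 1
  simp only [map_sub, map_smul, ip_sub_right, mul_apply_eq_comp] at h1 ⊢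
  have h3 : ∀ a b d e : ℂ, a - b - d + e = (a + e) - b - d := fun a b d e => by ring
  rw [h3, h1]
  simp only [add_apply, smul_apply, sum_apply, ip_add_right, ip_sum_right, ip_smul_right,
    mul_apply_eq_comp]
  ring

end evolution

end NonlocalGPE
end

/-! ### Comparison of the nonlocal equation with the linear associated equation. -/

noncomputable section

namespace NonlocalGPE

open Filter MeasureTheory

variable {n : ℕ}

namespace Data

variable (Q : Data n)

theorem hzz_isSymm (κt t : ℝ) : (Q.hzz κt t).IsSymm :=
  (Q.Hzz_symm t).add ((Q.Wzz_symm t).smul κt)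

/-- The operator of the linear associated Schrödinger equation on the Schwartz space. -/
def laseOp (κt t : ℝ) (g : Moments n) : Sch n →L[ℂ] Sch n :=
  quadOp Q.hbar g.1 (Q.h0 κt t g) (Q.hz κt t g.1) (Q.hzz κt t)

theorem isSym_laseOp (κt t : ℝ) (g : Moments n) : IsSym (Q.laseOp κt t g) :=
  isSym_quadOp _ _ _ _ (Q.hzz_isSymm κt t)

theorem lase_coe (κt t : ℝ) (g : Moments n) (f : Sch n) (x : Cfg n) :
    Q.lase κt t g f x = Q.laseOp κt t g f x := by
  simp only [lase, laseOp, quadOp, dzhat_coe, add_apply, smul_apply, sum_apply, mul_apply_eq_comp,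
    one_apply_eq_self, smul_eq_mul]

/-- The operator of the nonlocal equation with the nonlinear term evaluated in the state `ψ`. -/
def gpeOp (t : ℝ) (ψ : Sch n) : Sch n →L[ℂ] Sch n :=
  quadOp Q.hbar 0
    (Q.kappa / 2 * ∑ j, ∑ k, Q.Www t j k * (ip ψ (Zop Q.hbar j (Zop Q.hbar k ψ))).re)
    (Q.Hz t + Q.kappa • (Q.Wzw t).mulVec fun k => (ip ψ (Zop Q.hbar k ψ)).re)
    (Q.hzz (Q.kappa * normSq ψ) t)

theorem isSym_gpeOp (t : ℝ) (ψ : Sch n) : IsSym (Q.gpeOp t ψ) :=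
  isSym_quadOp _ _ _ _ (Q.hzz_isSymm _ t)

/-- On the product `ψ(x) ψ(y)` each `ẑ` acts on the first factor and each `ŵ` on the second, so the
integral over `y` leaves inner products. -/
theorem Hartree_coe (t : ℝ) (ψ : Sch n) (x : Cfg n) :
    Q.Hartree t ψ x =
      (1 / 2) * ∑ j, ∑ k, (Q.Wzz t j k : ℂ) * (Zop Q.hbar j (Zop Q.hbar k ψ) x * ip ψ ψ) +
      ∑ j, ∑ k, (Q.Wzw t j k : ℂ) * (Zop Q.hbar j ψ x * ip ψ (Zop Q.hbar k ψ)) +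
      (1 / 2) * ∑ j, ∑ k, (Q.Www t j k : ℂ) *
        (ψ x * ip ψ (Zop Q.hbar j (Zop Q.hbar k ψ))) := by
  have hl : ∀ (j : PIdx n) (f : Sch n) (c : ℂ) (x : Cfg n),
      zhat Q.hbar j (fun x' => f x' * c) x = Zop Q.hbar j f x * c := by
    intro j f c x
    rcases j with j | j
    · simp only [zhat, Zop, smul_apply, Dop_apply, smul_eq_mul]
      rw [fderiv_mul_const f.differentiableAt]
      simp only [smul_apply, smul_eq_mul]
      ring
    · simp only [zhat, Zop, Xop_apply]
      ring
  have hr : ∀ (j : PIdx n) (f : Sch n) (c : ℂ) (x : Cfg n),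
      zhat Q.hbar j (fun x' => c * f x') x = c * Zop Q.hbar j f x := by
    intro j f c x
    simp only [mul_comm c]
    exact hl j f c x
  -- For fixed `x`, the integrand without `ψ*` is itself a Schwartz function of `y`; linearity of
  -- `ip` then replaces the integrability of separate terms.
  let χ : Sch n :=
    (1 / 2 : ℂ) • ∑ j, ∑ k, (Q.Wzz t j k : ℂ) • (Zop Q.hbar j (Zop Q.hbar k ψ) x • ψ) +
      ∑ j, ∑ k, (Q.Wzw t j k : ℂ) • (Zop Q.hbar j ψ x • Zop Q.hbar k ψ) +
      (1 / 2 : ℂ) • ∑ j, ∑ k, (Q.Www t j k : ℂ) • (ψ x • Zop Q.hbar j (Zop Q.hbar k ψ))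
  have hχ : Q.Hartree t ψ x = ip ψ χ := by
    rw [Hartree, ip_eq_integral]
    congr 1
    funext y
    congr 1
    have hw : ∀ (k : PIdx n) (F : Cfg n → Cfg n → ℂ) (x : Cfg n),
        what₂ Q.hbar k F x = zhat Q.hbar k (F x) := fun _ _ _ => rfl
    have hr' : ∀ (k : PIdx n) (x : Cfg n), zhat Q.hbar k (fun y' => ψ x * ψ y') =
        fun y' => ψ x * Zop Q.hbar k ψ y' := fun k x => funext fun y' => hr k ψ (ψ x) y'
    simp only [Vop, zhat₁, hw, hr', hl, hr, χ, add_apply, smul_apply, sum_apply, smul_eq_mul]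
  rw [hχ]
  simp only [χ, ip_add_right, ip_smul_right, ip_sum_right]

theorem gpe_coe (t : ℝ) (ψ : Sch n) (x : Cfg n) :
    Q.Hop t ψ x + (Q.kappa : ℂ) * Q.Hartree t ψ x = Q.gpeOp t ψ ψ x := by
  have h1 : ∀ k, (((ip ψ (Zop Q.hbar k ψ)).re : ℝ) : ℂ) = ip ψ (Zop Q.hbar k ψ) := fun k =>
    (isSym_Zop Q.hbar k).ofReal_re ψ
  have h2 : ((∑ j, ∑ k, Q.Www t j k * (ip ψ (Zop Q.hbar j (Zop Q.hbar k ψ))).re : ℝ) : ℂ) =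
      ∑ j, ∑ k, (Q.Www t j k : ℂ) * ip ψ (Zop Q.hbar j (Zop Q.hbar k ψ)) := by
    -- The products `ẑ_j ẑ_k` need not be symmetric separately; the full sum is, being `quadOp` with
    -- matrix `2 W_ww`. Hence taking real parts in `gpeOp` loses nothing.
    have hs : IsSym (∑ j, ∑ k, (Q.Www t j k : ℂ) •
        (Zop Q.hbar j * Zop Q.hbar k : Sch n →L[ℂ] Sch n)) := by
      have := isSym_quadOp Q.hbar 0 0 0 ((Q.Www_symm t).smul 2)
      simpa [quadOp, Finset.smul_sum, smul_smul] using this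
    have := hs.ofReal_re ψ
    simp only [sum_apply, smul_apply, ip_sum_right, ip_smul_right, mul_apply_eq_comp,
      Complex.re_sum, Complex.re_ofReal_mul] at this
    exact this
  rw [Hartree_coe, ip_self]
  simp only [Hop, zhat_coe, gpeOp, quadOp, dZop_zero, add_apply, smul_apply, sum_apply,
    mul_apply_eq_comp, one_apply_eq_self, smul_eq_mul]
  have e1 : ∑ j, ∑ k, (Q.hzz (Q.kappa * normSq ψ) t j k : ℂ) * Zop Q.hbar j (Zop Q.hbar k ψ) x =
      ∑ j, ∑ k, (Q.Hzz t j k : ℂ) * Zop Q.hbar j (Zop Q.hbar k ψ) x +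
        Q.kappa * ∑ j, ∑ k, (Q.Wzz t j k : ℂ) * (Zop Q.hbar j (Zop Q.hbar k ψ) x * normSq ψ) := by
    simp only [Finset.mul_sum, ← Finset.sum_add_distrib]
    refine Finset.sum_congr rfl fun j _ => Finset.sum_congr rfl fun k _ => ?_
    simp only [hzz, Matrix.add_apply, Matrix.smul_apply, smul_eq_mul]
    push_cast
    ring
  have e2 : ∑ j, (((Q.Hz t + Q.kappa • (Q.Wzw t).mulVec fun k => (ip ψ (Zop Q.hbar k ψ)).re) j : ℝ) : ℂ)
      * Zop Q.hbar j ψ x = ∑ j, (Q.Hz t j : ℂ) * Zop Q.hbar j ψ x +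
        Q.kappa * ∑ j, ∑ k, (Q.Wzw t j k : ℂ) * (Zop Q.hbar j ψ x * ip ψ (Zop Q.hbar k ψ)) := by
    simp only [Finset.mul_sum, ← Finset.sum_add_distrib]
    refine Finset.sum_congr rfl fun j _ => ?_
    simp only [Pi.add_apply, Pi.smul_apply, smul_eq_mul, Matrix.mulVec, dotProduct,
      Complex.ofReal_add, Complex.ofReal_mul, Complex.ofReal_sum, h1, add_mul, Finset.mul_sum,
      Finset.sum_mul]
    congr 1
    exact Finset.sum_congr rfl fun k _ => by ring
  have e3 : ∑ j, ∑ k, (Q.Www t j k : ℂ) * (ψ x * ip ψ (Zop Q.hbar j (Zop Q.hbar k ψ))) =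
      (∑ j, ∑ k, (Q.Www t j k : ℂ) * ip ψ (Zop Q.hbar j (Zop Q.hbar k ψ))) * ψ x := by
    simp only [Finset.sum_mul]
    exact Finset.sum_congr rfl fun j _ => Finset.sum_congr rfl fun k _ => by ring
  rw [e1, e2, e3, Complex.ofReal_mul, h2]
  push_cast
  ring

/-- In the state `ψ`, the nonlocal equation has the operator of the linear associated Schrödinger
equation at the moments of `ψ`. -/
theorem gpeOp_eq_laseOp (t : ℝ) (ψ : Sch n) :
    Q.gpeOp t ψ ψ = Q.laseOp (Q.kappa * normSq ψ) t (moments Q.hbar ψ) ψ := by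
  by_cases hψ : ψ = 0
  · rw [hψ, map_zero, map_zero]
  have hN : normSq ψ ≠ 0 := fun h => hψ (eq_zero_of_normSq_eq_zero h)
  have hm : (fun k => (ip ψ (Zop Q.hbar k ψ)).re) = normSq ψ • zMean Q.hbar ψ := by
    funext k
    simp [ip_Zop]
  -- Uncentred second moments are centred ones plus products of means. Symmetry of `W_ww` makes the
  -- operator ordering irrelevant. This yields the trace term of `𝔥`.
  have hW : ∑ j, ∑ k, Q.Www t j k * (ip ψ (Zop Q.hbar j (Zop Q.hbar k ψ))).re =
      normSq ψ * ((Q.Www t * DeltaMean Q.hbar ψ).trace +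
        zMean Q.hbar ψ ⬝ᵥ (Q.Www t).mulVec (zMean Q.hbar ψ)) := by
    set z := zMean Q.hbar ψ with hz
    have hD : ∀ j k, ip ψ (dZop Q.hbar z j (dZop Q.hbar z k ψ)) =
        ip ψ (Zop Q.hbar j (Zop Q.hbar k ψ)) - normSq ψ * (z j * z k : ℝ) := fun j k => by
      rw [dZop_apply, ip_sub_right, ip_smul_right, ip_dZop, ← hz, sub_self, dZop_apply, map_sub,
        map_smul, ip_sub_right, ip_smul_right, ip_Zop, ← hz]
      push_cast
      ring
    have hre : ∀ j k, normSq ψ * DeltaMean Q.hbar ψ j k = 1 / 2 *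
        ((ip ψ (Zop Q.hbar j (Zop Q.hbar k ψ))).re + (ip ψ (Zop Q.hbar k (Zop Q.hbar j ψ))).re) -
          normSq ψ * (z j * z k) := fun j k => by
      have := congrArg Complex.re (normSq_mul_DeltaMean Q.hbar ψ j k)
      rw [← hz, hD, hD, ← Complex.ofReal_mul, Complex.ofReal_re] at this
      rw [this, ← Complex.ofReal_mul, ← Complex.ofReal_mul,
        show (1 / 2 : ℂ) = ((1 / 2 : ℝ) : ℂ) by norm_num, Complex.re_ofReal_mul]
      simp only [Complex.add_re, Complex.sub_re, Complex.ofReal_re]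
      ring
    have hsym : ∑ j, ∑ k, Q.Www t j k * (ip ψ (Zop Q.hbar k (Zop Q.hbar j ψ))).re =
        ∑ j, ∑ k, Q.Www t j k * (ip ψ (Zop Q.hbar j (Zop Q.hbar k ψ))).re := by
      rw [Finset.sum_comm]
      simp only [(Q.Www_symm t).apply]
    have htr : normSq ψ * (Q.Www t * DeltaMean Q.hbar ψ).trace =
        ∑ j, ∑ k, Q.Www t j k * (normSq ψ * DeltaMean Q.hbar ψ j k) := by
      simp only [Matrix.trace, Matrix.diag, Matrix.mul_apply, Finset.mul_sum]
      refine Finset.sum_congr rfl fun j _ => Finset.sum_congr rfl fun k _ => ?_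
      rw [DeltaMean_symm Q.hbar ψ k j]
      ring
    have hq : normSq ψ * (z ⬝ᵥ (Q.Www t).mulVec z) =
        ∑ j, ∑ k, Q.Www t j k * (normSq ψ * (z j * z k)) := by
      simp only [dotProduct, Matrix.mulVec, Finset.mul_sum]
      exact Finset.sum_congr rfl fun j _ => Finset.sum_congr rfl fun k _ => by ring
    rw [mul_add, htr, hq]
    simp only [hre, mul_sub, Finset.sum_sub_distrib, sub_add_cancel]
    simp only [mul_left_comm _ (1 / 2 : ℝ), mul_add, ← Finset.mul_sum, Finset.sum_add_distrib, hsym]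
    ring
  -- With the centre at the mean, the constant and linear coefficients become `𝔥` and `𝔥_z`; the
  -- quadratic part is unchanged.
  rw [gpeOp, quadOp_recenter Q.hbar (zMean Q.hbar ψ) _ _ (Q.hzz_isSymm _ t), laseOp, hm, hW]
  congr 2
  · simp only [h0, moments, hzz, add_dotProduct, Matrix.add_mulVec, Matrix.smul_mulVec,
      dotProduct_add, dotProduct_smul, smul_dotProduct, Matrix.mulVec_smul, smul_eq_mul]
    rw [dotProduct_comm ((Q.Wzw t).mulVec _)]
    ring
  · simp only [hz, moments, hzz, Matrix.add_mulVec, Matrix.smul_mulVec, Matrix.mulVec_smul, smul_add,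
      smul_smul]
    abel

/-! ### Solutions of the linear and of the nonlocal equation -/

/-- `u` is a solution of the linear associated Schrödinger equation along `g` at the time `t`. -/
def IsLaseAt (κt : ℝ) (g : ℝ → Moments n) (u : ℝ → Sch n) (t : ℝ) : Prop :=
  HasCurveDerivAt u ((-(Complex.I / Q.hbar)) • Q.laseOp κt t (g t) (u t)) t

theorem hbar_ne_zero : (Q.hbar : ℂ) ≠ 0 := by exact_mod_cast Q.hbar_pos.ne'

theorem deriv_eq_iff (d a : ℂ) :
    -Complex.I * (Q.hbar : ℂ) * d + a = 0 ↔ d = -(Complex.I / Q.hbar) * a := by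
  have := Q.hbar_ne_zero
  constructor
  · intro h
    have ha : a = Complex.I * Q.hbar * d := by linear_combination h
    rw [ha]
    field_simp
    simp
  · rintro rfl
    field_simp
    simp

variable {Q}

theorem IsLaseAt.normSq_eq {κt : ℝ} {g : ℝ → Moments n} {u : ℝ → Sch n} {a b s t : ℝ}
    (hu : ∀ t ∈ Set.Ioo a b, Q.IsLaseAt κt g u t) (hs : s ∈ Set.Ioo a b) (ht : t ∈ Set.Ioo a b) :
    normSq (u s) = normSq (u t) :=
  normSq_eq_of_evolution (fun t => Q.isSym_laseOp κt t (g t)) hu hs ht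

/-- The difference of two solutions solves the same linear equation, so its norm is constant and
vanishes throughout. -/
theorem IsLaseAt.unique {κt : ℝ} {g : ℝ → Moments n} {u w : ℝ → Sch n} {a b s t : ℝ}
    (hu : ∀ t ∈ Set.Ioo a b, Q.IsLaseAt κt g u t) (hw : ∀ t ∈ Set.Ioo a b, Q.IsLaseAt κt g w t)
    (hs : s ∈ Set.Ioo a b) (h : u s = w s) (ht : t ∈ Set.Ioo a b) : u t = w t := by
  have hd : ∀ t ∈ Set.Ioo a b, Q.IsLaseAt κt g (fun τ => u τ + (-1 : ℂ) • w τ) t := fun t ht => by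
    have h1 := (hu t ht).add ((hw t ht).smul (hasDerivAt_const t (-1 : ℂ)))
    unfold IsLaseAt
    convert h1 using 1
    simp only [map_add, map_smul, smul_add, zero_smul, zero_add]
    rw [smul_comm]
  have h0 := IsLaseAt.normSq_eq hd hs ht
  have h1 : u s + (-1 : ℂ) • w s = 0 := by rw [h]; simp
  simp only [h1] at h0
  have h2 := eq_zero_of_normSq_eq_zero (h0.symm.trans normSq_zero)
  simpa [← sub_eq_add_neg, sub_eq_zero] using h2

theorem mem_Ioo_cover (s t : ℝ) : s ∈ Set.Ioo (min s t - 1) (max s t + 1) ∧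
    t ∈ Set.Ioo (min s t - 1) (max s t + 1) := by
  have h1 := min_le_left s t
  have h2 := min_le_right s t
  have h3 := le_max_left s t
  have h4 := le_max_right s t
  exact ⟨⟨by linarith, by linarith⟩, ⟨by linarith, by linarith⟩⟩

theorem IsLaseAt.eq_of_eq {κt : ℝ} {g : ℝ → Moments n} {u w : ℝ → Sch n} {s : ℝ}
    (hu : ∀ t, Q.IsLaseAt κt g u t) (hw : ∀ t, Q.IsLaseAt κt g w t) (h : u s = w s) : u = w :=
  funext fun t => IsLaseAt.unique (fun t _ => hu t) (fun t _ => hw t) (mem_Ioo_cover s t).1 h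
    (mem_Ioo_cover s t).2

/-- The moments along a curve generated by quadratic operators with matrix `S` which are centred at
the first moments of the curve. -/
theorem hasDerivAt_moments {hbar : ℝ} (hbar0 : hbar ≠ 0) {u : ℝ → Sch n} {c : ℝ → ℝ}
    {v : ℝ → PIdx n → ℝ} {S : ℝ → Matrix (PIdx n) (PIdx n) ℝ} (hS : ∀ t, (S t).IsSymm)
    (hN : ∀ s t, normSq (u s) = normSq (u t)) (h0 : normSq (u 0) ≠ 0)
    (hu : ∀ t, HasCurveDerivAt u ((-(Complex.I / hbar)) •
      quadOp hbar (zMean hbar (u t)) (c t) (v t) (S t) (u t)) t) :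
    (∀ t j, HasDerivAt (fun τ => zMean hbar (u τ) j) ((Matrix.J (Fin n) ℝ).mulVec (v t) j) t) ∧
    (∀ t j k, HasDerivAt (fun τ => DeltaMean hbar (u τ) j k)
      ((Matrix.J (Fin n) ℝ * S t * DeltaMean hbar (u t) -
        DeltaMean hbar (u t) * S t * Matrix.J (Fin n) ℝ) j k) t) := by
  set N := normSq (u 0)
  have hNt : ∀ t, normSq (u t) = N := fun t => hN t 0
  have hz : ∀ t j, HasDerivAt (fun τ => zMean hbar (u τ) j)
      ((Matrix.J (Fin n) ℝ).mulVec (v t) j) t := by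
    intro t j
    have h1 := (hasDerivAt_re (hasDerivAt_ip_Zop hbar0 (hS t) (hu t) j)).const_mul N⁻¹
    have h2 : (fun τ => zMean hbar (u τ) j) = fun τ => N⁻¹ * (ip (u τ) (Zop hbar j (u τ))).re := by
      funext τ
      rw [zMean_apply, hNt]
    rw [h2]
    refine h1.congr_deriv ?_
    rw [sub_self, Matrix.mulVec_zero, Pi.zero_apply, add_zero, ← Complex.ofReal_mul,
      Complex.ofReal_re, hNt, inv_mul_cancel_left₀ h0]
  refine ⟨hz, fun t j k => ?_⟩
  have h1 := hasDerivAt_ip_dZop_dZop (z := fun τ => zMean hbar (u τ)) hbar0 (hS t) (hu t) (hz t) j k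
  -- Both operator orders are differentiated, since `Δ` is defined by the symmetrized product.
  have h2 := hasDerivAt_ip_dZop_dZop (z := fun τ => zMean hbar (u τ)) hbar0 (hS t) (hu t) (hz t) k j
  have h3 := (hasDerivAt_re ((h1.add h2).const_mul (1 / 2 : ℂ))).const_mul N⁻¹
  have h4 : (fun τ => DeltaMean hbar (u τ) j k) = fun τ => N⁻¹ * ((1 / 2 : ℂ) *
      (ip (u τ) (dZop hbar (zMean hbar (u τ)) j (dZop hbar (zMean hbar (u τ)) k (u τ))) +
        ip (u τ) (dZop hbar (zMean hbar (u τ)) k (dZop hbar (zMean hbar (u τ)) j (u τ))))).re := by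
    funext τ
    rw [← normSq_mul_DeltaMean, hNt, ← Complex.ofReal_mul, Complex.ofReal_re,
      inv_mul_cancel_left₀ h0]
  rw [h4]
  refine h3.congr_deriv ?_
  set z := zMean hbar (u t)
  set Δ := DeltaMean hbar (u t)
  set A := Matrix.J (Fin n) ℝ * S t
  -- With `A = J S`, this brings the equation to the form `Δ̇ = A Δ + Δ Aᵀ` that the two orders
  -- produce.
  have hAt : S t * Matrix.J (Fin n) ℝ = -A.transpose := by
    rw [Matrix.transpose_mul, Matrix.J_transpose, (hS t).eq, Matrix.mul_neg, neg_neg]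
  have h5 : (1 / 2 : ℂ) * ((∑ l, (A j l : ℂ) * ip (u t) (dZop hbar z l (dZop hbar z k (u t))) +
        ∑ l, (A k l : ℂ) * ip (u t) (dZop hbar z j (dZop hbar z l (u t)))) +
      (∑ l, (A k l : ℂ) * ip (u t) (dZop hbar z l (dZop hbar z j (u t))) +
        ∑ l, (A j l : ℂ) * ip (u t) (dZop hbar z k (dZop hbar z l (u t))))) =
      ((N * (A * Δ + Δ * A.transpose) j k : ℝ) : ℂ) := by
    have h6 : ∀ l m, (N : ℂ) * Δ l m = 1 / 2 * (ip (u t) (dZop hbar z l (dZop hbar z m (u t))) +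
        ip (u t) (dZop hbar z m (dZop hbar z l (u t)))) := fun l m => by
      rw [← hNt t]; exact normSq_mul_DeltaMean hbar (u t) l m
    simp only [Matrix.add_apply, Matrix.mul_apply, Matrix.transpose_apply, Complex.ofReal_mul,
      Complex.ofReal_add, Complex.ofReal_sum, mul_add, Finset.mul_sum]
    have h7 : ∀ l, (N : ℂ) * ((A j l : ℂ) * Δ l k) = A j l * ((N : ℂ) * Δ l k) := fun l => by ring
    have h8 : ∀ l, (N : ℂ) * ((Δ j l : ℂ) * A k l) = A k l * ((N : ℂ) * Δ j l) := fun l => by ring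
    simp only [h7, h8, h6, ← Finset.sum_add_distrib]
    exact Finset.sum_congr rfl fun l _ => by ring
  refine (congrArg (fun a : ℂ => N⁻¹ * a.re) h5).trans ?_
  simp only [Complex.ofReal_re]
  rw [inv_mul_cancel_left₀ h0, Matrix.mul_assoc Δ, hAt, Matrix.mul_neg, sub_neg_eq_add]

/-- Along a nonzero solution of the linear associated Schrödinger equation, the moments follow the
solution of the Hamilton--Ehrenfest system if they do so at one time. -/
theorem IsLaseAt.moments_eq {κt : ℝ} {g : ℝ → Moments n} (hg : Q.IsHESSolution κt g)
    {u : ℝ → Sch n} (hu : ∀ t, Q.IsLaseAt κt g u t) {s : ℝ} (h0 : u s ≠ 0)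
    (hs : moments Q.hbar (u s) = g s) (t : ℝ) : moments Q.hbar (u t) = g t := by
  have hN : ∀ r t, normSq (u r) = normSq (u t) := fun r t =>
    IsLaseAt.normSq_eq (fun t _ => hu t) (mem_Ioo_cover r t).1 (mem_Ioo_cover r t).2
  have hN0 : ∀ t, normSq (u t) ≠ 0 := fun t h => h0 (eq_zero_of_normSq_eq_zero ((hN s t).trans h))
  have hJ : ∀ j k, Continuous fun t => (Matrix.J (Fin n) ℝ * Q.hzz κt t) j k := fun j k => by
    simp only [Matrix.mul_apply]
    exact continuous_finsetSum _ fun l _ => continuous_const.mul (Q.continuous_hzz κt l k)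
  -- The generator is centred at `g`, not yet known to be the mean. The deviation satisfies the
  -- homogeneous equation `ḋ = J 𝔥_zz d` with `d(s) = 0`, hence vanishes; only then does
  -- `hasDerivAt_moments` apply.
  have hz : (fun t => zMean Q.hbar (u t) - (g t).1) = fun _ => 0 := by
    refine (vectorODE_existsUnique hJ (b := fun _ => 0) (fun _ => continuous_const) s 0).unique
      ⟨?_, fun t j => ?_⟩ ⟨rfl, fun t j => ?_⟩
    · have := congrArg Prod.fst hs
      exact sub_eq_zero.2 this
    · have h1 := (hasDerivAt_re (hasDerivAt_ip_Zop Q.hbar_pos.ne' (Q.hzz_isSymm κt t)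
        (hu t) j)).const_mul (normSq (u s))⁻¹
      have h2 : (fun τ => (zMean Q.hbar (u τ) - (g τ).1) j) = fun τ => (normSq (u s))⁻¹ *
          (ip (u τ) (Zop Q.hbar j (u τ))).re - (g τ).1 j := by
        funext τ
        rw [Pi.sub_apply, zMean_apply, hN s τ]
      rw [h2]
      refine (h1.sub (hg.1 t j)).congr_deriv ?_
      rw [← Complex.ofReal_mul, Complex.ofReal_re, hN s t, inv_mul_cancel_left₀ (hN0 t)]
      simp
    · simpa using hasDerivAt_const t (0 : ℝ)
  have hz' : ∀ t, (g t).1 = zMean Q.hbar (u t) := fun t => (sub_eq_zero.1 (congrFun hz t)).symm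
  have hmom := hasDerivAt_moments Q.hbar_pos.ne' (u := u) (c := fun t => Q.h0 κt t (g t))
    (v := fun t => Q.hz κt t (g t).1) (S := Q.hzz κt) (Q.hzz_isSymm κt) hN (hN0 0)
    (fun t => by rw [← hz']; exact hu t)
  have hsol : Q.IsHESSolution κt (fun t => moments Q.hbar (u t)) := by
    refine ⟨fun t j => ?_, hmom.2⟩
    have := hmom.1 t j
    rw [hz'] at this
    exact this
  exact congrFun ((Q.existsUnique_isHESSolution κt s (g s)).unique ⟨hsol, hs⟩ ⟨hg, rfl⟩) t

/-- A curve generated by the operators of the nonlocal equation has constant norm. -/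
theorem normSq_eq_of_gpe {u : ℝ → Sch n}
    (hu : ∀ t, HasCurveDerivAt u ((-(Complex.I / Q.hbar)) • Q.gpeOp t (u t) (u t)) t) (s t : ℝ) :
    normSq (u s) = normSq (u t) :=
  normSq_eq_of_evolution (L := fun t => Q.gpeOp t (u t)) (fun t => Q.isSym_gpeOp t (u t))
    (fun t _ => hu t) (mem_Ioo_cover s t).1 (mem_Ioo_cover s t).2

/-- A nonzero solution of the nonlocal equation solves the linear associated Schrödinger equation
along its moments, and the moments solve the Hamilton--Ehrenfest system. -/
theorem lase_of_gpe {u : ℝ → Sch n}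
    (hu : ∀ t, HasCurveDerivAt u ((-(Complex.I / Q.hbar)) • Q.gpeOp t (u t) (u t)) t) {κt : ℝ}
    (hκ : ∀ t, κt = Q.kappa * normSq (u t)) :
    (∀ t, Q.IsLaseAt κt (fun t => moments Q.hbar (u t)) u t) ∧
      (u 0 ≠ 0 → Q.IsHESSolution κt (fun t => moments Q.hbar (u t))) := by
  have h1 : ∀ t, Q.IsLaseAt κt (fun t => moments Q.hbar (u t)) u t := fun t => by
    unfold IsLaseAt
    rw [hκ t, ← gpeOp_eq_laseOp]
    exact hu t
  refine ⟨h1, fun h0 => ?_⟩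
  exact hasDerivAt_moments Q.hbar_pos.ne' (u := u) (c := fun t => Q.h0 κt t (moments Q.hbar (u t)))
    (v := fun t => Q.hz κt t (zMean Q.hbar (u t))) (S := Q.hzz κt) (Q.hzz_isSymm κt)
    (normSq_eq_of_gpe hu) (fun h => h0 (eq_zero_of_normSq_eq_zero h)) h1

end Data

end NonlocalGPE
end

/-! ### Gaussian wave operators and their action on momenta and positions. -/

noncomputable section

namespace NonlocalGPE

open Filter

variable {n : ℕ}

theorem hasDerivAt_cfg {y : ℝ → Cfg n} {y' : Cfg n} {t : ℝ}
    (h : ∀ j, HasDerivAt (fun τ => y τ j) (y' j) t) : HasDerivAt y y' t :=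
  HasFDerivAt.comp_hasDerivAt (f := fun τ => (y τ).ofLp) t
    (PiLp.hasFDerivAt_toLp (𝕜 := ℝ) 2 (y t).ofLp) (hasDerivAt_pi.2 h)

/-- The chain rule for the evaluation of a curve of Schwartz functions along a moving point. -/
theorem HasCurveDerivAt.eval {w : ℝ → Sch n} {w' : Sch n} {t : ℝ} (hw : HasCurveDerivAt w w' t)
    {z : ℝ → Cfg n} {z' : Cfg n} (hz : HasDerivAt z z' t) :
    HasDerivAt (fun τ => w τ (z τ)) (w' (z t) + ∑ j, (z' j : ℂ) * Dop j (w t) (z t)) t := by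
  rw [← fderiv_apply_eq_sum]
  have h2 : HasDerivAt (fun τ => w t (z τ)) (fderiv ℝ (w t) (z t) z') t :=
    ((w t).hasFDerivAt (z t)).comp_hasDerivAt t hz
  have hzc : Tendsto (fun h : ℝ => z (t + h)) (𝓝[≠] 0) (𝓝 (z t)) := by
    have h3 : Tendsto (fun h : ℝ => t + h) (𝓝[≠] 0) (𝓝 t) := by
      have : Continuous fun h : ℝ => t + h := by fun_prop
      simpa using (this.tendsto 0).mono_left nhdsWithin_le_nhds
    exact hz.continuousAt.tendsto.comp h3
  rw [hasDerivAt_iff_tendsto_slope_zero] at h2 ⊢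
  have h1 : Tendsto (fun h : ℝ => (h⁻¹ • (w (t + h) - w t)) (z (t + h))) (𝓝[≠] 0) (𝓝 (w' (z t))) := by
    have h4 : Tendsto (fun h : ℝ => (h⁻¹ • (w (t + h) - w t) - w') (z (t + h))) (𝓝[≠] 0) (𝓝 0) := by
      refine squeeze_zero_norm (fun h => sup_norm_le _ _) ?_
      have h5 : Tendsto (fun h : ℝ => h⁻¹ • (w (t + h) - w t) - w') (𝓝[≠] 0) (𝓝 0) := by
        simpa using Tendsto.sub_const hw w'
      simpa [Function.comp_def] using ((continuous_seminorm 0 0).tendsto (0 : Sch n)).comp h5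
    have h5 := h4.add ((w'.continuous.tendsto (z t)).comp hzc)
    simpa using h5
  refine (h1.add h2).congr fun h => ?_
  simp only [smul_apply, sub_apply, ← smul_add]
  congr 1
  ring

/-! ### Gaussian wave operators -/

/-- Parameters of the operators `f ↦ exp(s + i/ħ (⟨P, y⟩ + ½⟨y, C y⟩)) f(A y)`, `y = x - X`. -/
structure Wave (n : ℕ) where
  s : ℂ
  P : Fin n → ℝ
  X : Fin n → ℝ
  A : Matrix (Fin n) (Fin n) ℝ
  B : Matrix (Fin n) (Fin n) ℝ
  C : Matrix (Fin n) (Fin n) ℝ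
  A_mul_B : A * B = 1
  C_symm : C.IsSymm

namespace Wave

/-- The linear change of coordinates `y ↦ A y`. -/
def lin (γ : Wave n) : Cfg n ≃L[ℝ] Cfg n :=
  (LinearEquiv.ofLinearMap (Matrix.toEuclideanLin γ.A) (Matrix.toEuclideanLin γ.B)
    (by rw [← Matrix.toLpLin_mul_same, γ.A_mul_B]; simp)
    (by rw [← Matrix.toLpLin_mul_same, mul_eq_one_comm.1 γ.A_mul_B]; simp)).toContinuousLinearEquiv

theorem lin_apply (γ : Wave n) (y : Cfg n) (j : Fin n) : γ.lin y j = γ.A.mulVec y.ofLp j := rfl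

theorem lin_symm_apply (γ : Wave n) (y : Cfg n) (j : Fin n) :
    γ.lin.symm y j = γ.B.mulVec y.ofLp j := rfl

/-- The phase `⟨P, y⟩ + ½⟨y, C y⟩`. -/
def phase (γ : Wave n) (y : Cfg n) : ℝ :=
  ∑ j, γ.P j * y j + 1 / 2 * ∑ j, ∑ k, γ.C j k * (y j * y k)

/-- The factor `exp(s + i/ħ (⟨P, y⟩ + ½⟨y, C y⟩))`. -/
def factor (hbar : ℝ) (γ : Wave n) (y : Cfg n) : ℂ :=
  Complex.exp (γ.s + Complex.I / hbar * (γ.phase y : ℝ))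

end Wave

/-- All derivatives are `iᵐ e^{ir}`, of modulus one. -/
theorem hasTemperateGrowth_cexp_mul_I :
    Function.HasTemperateGrowth (fun r : ℝ => Complex.exp (r * Complex.I)) := by
  have hd : ∀ r : ℝ, HasDerivAt (fun r : ℝ => Complex.exp (r * Complex.I))
      (Complex.exp (r * Complex.I) * Complex.I) r := fun r => by
    have := ((Complex.ofRealCLM.hasDerivAt (x := r)).mul_const Complex.I).cexp
    simpa using this
  have hi : ∀ m, iteratedDeriv m (fun r : ℝ => Complex.exp (r * Complex.I)) =
      fun r : ℝ => Complex.I ^ m * Complex.exp (r * Complex.I) := by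
    intro m
    induction m with
    | zero => simp
    | succ m ih =>
      rw [iteratedDeriv_succ, ih]
      funext r
      rw [((hd r).const_mul (Complex.I ^ m)).deriv]
      ring
  refine ⟨(Complex.ofRealCLM.contDiff.mul contDiff_const).cexp, fun m => ⟨0, 1, fun r => ?_⟩⟩
  rw [norm_iteratedFDeriv_eq_norm_iteratedDeriv, hi]
  simp [Complex.norm_exp_ofReal_mul_I]

namespace Wave

theorem phase_hasTemperateGrowth (γ : Wave n) : Function.HasTemperateGrowth γ.phase := by
  have h : ∀ j, Function.HasTemperateGrowth (fun y : Cfg n => y j) := fun j =>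
    (EuclideanSpace.proj (𝕜 := ℝ) j).hasTemperateGrowth
  unfold phase
  refine (Function.HasTemperateGrowth.sum fun j _ => (Function.HasTemperateGrowth.const _).mul (h j)).add
    ((Function.HasTemperateGrowth.const _).mul (Function.HasTemperateGrowth.sum fun j _ =>
      Function.HasTemperateGrowth.sum fun k _ =>
        (Function.HasTemperateGrowth.const _).mul ((h j).mul (h k))))

theorem factor_eq (hbar : ℝ) (γ : Wave n) (y : Cfg n) :
    γ.factor hbar y = Complex.exp γ.s * Complex.exp ((hbar⁻¹ * γ.phase y : ℝ) * Complex.I) := by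
  rw [factor, Complex.exp_add]
  congr 2
  push_cast
  ring

theorem norm_factor (hbar : ℝ) (γ : Wave n) (y : Cfg n) :
    ‖γ.factor hbar y‖ = ‖Complex.exp γ.s‖ := by
  rw [factor_eq, norm_mul, Complex.norm_exp_ofReal_mul_I, mul_one]

theorem factor_hasTemperateGrowth (hbar : ℝ) (γ : Wave n) :
    Function.HasTemperateGrowth (γ.factor hbar) := by
  have : γ.factor hbar = fun y => Complex.exp γ.s *
      (fun r : ℝ => Complex.exp (r * Complex.I)) (hbar⁻¹ * γ.phase y) := by
    funext y; exact γ.factor_eq hbar y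
  rw [this]
  exact (Function.HasTemperateGrowth.const _).mul (hasTemperateGrowth_cexp_mul_I.comp
    ((Function.HasTemperateGrowth.const _).mul γ.phase_hasTemperateGrowth))

/-- The operator `f ↦ exp(s + i/ħ (⟨P, y⟩ + ½⟨y, C y⟩)) f(A y)`, `y = x - X`. -/
def op (hbar : ℝ) (γ : Wave n) : Sch n →L[ℂ] Sch n :=
  SchwartzMap.compSubConstCLM ℂ (WithLp.toLp 2 γ.X) ∘L SchwartzMap.smulLeftCLM ℂ (γ.factor hbar) ∘L
    SchwartzMap.compCLMOfContinuousLinearEquiv ℂ γ.lin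

theorem op_apply (hbar : ℝ) (γ : Wave n) (f : Sch n) (x : Cfg n) :
    γ.op hbar f x = γ.factor hbar (x - WithLp.toLp 2 γ.X) * f (γ.lin (x - WithLp.toLp 2 γ.X)) := by
  simp [op, SchwartzMap.smulLeftCLM_apply_apply (γ.factor_hasTemperateGrowth hbar)]

/-- The operators are invertible. -/
theorem exists_op_comp_eq_one (hbar : ℝ) (γ : Wave n) :
    ∃ R : Sch n →L[ℂ] Sch n, ∀ f, γ.op hbar (R f) = f := by
  -- Negating `s`, `P` and `C` inverts the factor pointwise; the translation and the linear
  -- substitution are undone separately.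
  let γ' : Wave n := { γ with s := -γ.s, P := -γ.P, C := -γ.C, C_symm := γ.C_symm.neg }
  have hmul : ∀ y, γ.factor hbar y * γ'.factor hbar y = 1 := fun y => by
    rw [factor, factor, ← Complex.exp_add, Complex.exp_eq_one_iff]
    refine ⟨0, ?_⟩
    simp [γ', phase]
    ring
  refine ⟨SchwartzMap.compCLMOfContinuousLinearEquiv ℂ γ.lin.symm ∘L
    SchwartzMap.smulLeftCLM ℂ (γ'.factor hbar) ∘L
    SchwartzMap.compSubConstCLM ℂ (-WithLp.toLp 2 γ.X), fun f => ?_⟩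
  ext x
  rw [op_apply]
  simp [SchwartzMap.smulLeftCLM_apply_apply (γ'.factor_hasTemperateGrowth hbar)]
  rw [← mul_assoc, hmul, one_mul]

theorem hasDerivAt_phase {γ : ℝ → Wave n} {P' : Fin n → ℝ} {C' : Matrix (Fin n) (Fin n) ℝ} {t : ℝ}
    (hP : ∀ j, HasDerivAt (fun τ => (γ τ).P j) (P' j) t)
    (hC : ∀ j k, HasDerivAt (fun τ => (γ τ).C j k) (C' j k) t) {y : ℝ → Cfg n} {y' : Fin n → ℝ}
    (hy : ∀ j, HasDerivAt (fun τ => y τ j) (y' j) t) :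
    HasDerivAt (fun τ => (γ τ).phase (y τ)) (∑ j, (P' j * y t j + (γ t).P j * y' j) +
      (1 / 2 * ∑ j, ∑ k, C' j k * (y t j * y t k) + ∑ j, ∑ k, (γ t).C j k * (y t k * y' j))) t := by
  have h1 := HasDerivAt.fun_sum (u := Finset.univ) fun j _ => (hP j).mul (hy j)
  have h2 := HasDerivAt.fun_sum (u := Finset.univ) fun j _ =>
    HasDerivAt.fun_sum (u := Finset.univ) fun k _ => (hC j k).mul ((hy j).mul (hy k))
  refine (h1.add (h2.const_mul (1 / 2))).congr_deriv ?_
  congr 1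
  have h3 : ∑ j, ∑ k, (γ t).C j k * (y t j * y' k) = ∑ j, ∑ k, (γ t).C j k * (y t k * y' j) := by
    rw [Finset.sum_comm]
    exact Finset.sum_congr rfl fun j _ => Finset.sum_congr rfl fun k _ => by
      rw [(γ t).C_symm.apply]
  simp only [Pi.mul_apply, mul_add, Finset.sum_add_distrib, mul_comm (y' _), h3]
  ring

/-- The derivative of a curve of wave operators applied to a curve of Schwartz functions and
evaluated along a moving point. -/
theorem hasDerivAt_op (hbar : ℝ) {γ : ℝ → Wave n} {s' : ℂ} {P' X' : Fin n → ℝ}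
    {A' C' : Matrix (Fin n) (Fin n) ℝ} {t : ℝ} (hs : HasDerivAt (fun τ => (γ τ).s) s' t)
    (hP : ∀ j, HasDerivAt (fun τ => (γ τ).P j) (P' j) t)
    (hX : ∀ j, HasDerivAt (fun τ => (γ τ).X j) (X' j) t)
    (hA : ∀ j k, HasDerivAt (fun τ => (γ τ).A j k) (A' j k) t)
    (hC : ∀ j k, HasDerivAt (fun τ => (γ τ).C j k) (C' j k) t)
    {w : ℝ → Sch n} {w' : Sch n} (hw : HasCurveDerivAt w w' t) {x : ℝ → Cfg n} {x' : Fin n → ℝ}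
    (hx : ∀ j, HasDerivAt (fun τ => x τ j) (x' j) t) {y y' : Fin n → ℝ}
    (hy : y = (x t).ofLp - (γ t).X) (hy' : y' = x' - X') :
    HasDerivAt (fun τ => (γ τ).op hbar (w τ) (x τ))
      ((s' + Complex.I / hbar * ((∑ j, (P' j * y j + (γ t).P j * y' j) +
        (1 / 2 * ∑ j, ∑ k, C' j k * (y j * y k) + ∑ j, ∑ k, (γ t).C j k * (y k * y' j)) : ℝ) : ℂ)) *
          (γ t).op hbar (w t) (x t) + (γ t).op hbar w' (x t) +
        ∑ m, (((A'.mulVec y + (γ t).A.mulVec y') m : ℝ) : ℂ) * (γ t).op hbar (Dop m (w t)) (x t))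
      t := by
  have hyd : ∀ j, HasDerivAt (fun τ => (x τ - WithLp.toLp 2 (γ τ).X) j) (y' j) t := fun j => by
    rw [hy']; exact (hx j).sub (hX j)
  have h1 := hasDerivAt_phase hP hC hyd
  have h2 : HasDerivAt (fun τ => (γ τ).factor hbar (x τ - WithLp.toLp 2 (γ τ).X))
      ((γ t).factor hbar (x t - WithLp.toLp 2 (γ t).X) * (s' + Complex.I / hbar * _)) t :=
    (hs.add (h1.ofReal_comp.const_mul (Complex.I / hbar))).cexp
  have hl : HasDerivAt (fun τ => (γ τ).lin (x τ - WithLp.toLp 2 (γ τ).X))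
      (WithLp.toLp 2 (A'.mulVec y + (γ t).A.mulVec y')) t := by
    refine hasDerivAt_cfg fun j => ?_
    simp only [lin_apply, Matrix.mulVec, dotProduct]
    have h := HasDerivAt.fun_sum (u := Finset.univ) fun k _ => (hA j k).mul (hyd k)
    refine h.congr_deriv ?_
    rw [Finset.sum_add_distrib, hy]
    rfl
  have h3 := h2.mul (hw.eval hl)
  have h4 : ∀ j, (x t - WithLp.toLp 2 (γ t).X) j = y j := fun j => by rw [hy]; rfl
  simp only [op_apply]
  refine h3.congr_deriv ?_
  simp only [h4]
  rw [mul_add ((γ t).factor _ _) (w' _), ← add_assoc]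
  congr 1
  · congr 1
    ring
  · rw [Finset.mul_sum]
    exact Finset.sum_congr rfl fun m _ => by ring

/-- The transformed momentum operators `Aᵀ p̂`. -/
def mom (hbar : ℝ) (γ : Wave n) (j : Fin n) : Sch n →L[ℂ] Sch n :=
  ∑ m, (γ.A m j : ℂ) • Zop hbar (Sum.inl m)

theorem mom_apply (hbar : ℝ) (γ : Wave n) (j : Fin n) (f : Sch n) :
    γ.mom hbar j f = ∑ m, (γ.A m j : ℂ) • Zop hbar (Sum.inl m) f := by
  simp [mom]

/-- This is `hasDerivAt_op` with frozen parameters and the point moving along the `j`-th axis. -/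
theorem Dop_op (hbar : ℝ) (γ : Wave n) (j : Fin n) (f : Sch n) (x : Cfg n) :
    Dop j (γ.op hbar f) x = Complex.I / hbar *
      (γ.P j + ∑ l, (γ.C j l : ℂ) * (x l - γ.X l)) * γ.op hbar f x +
        ∑ m, (γ.A m j : ℂ) * γ.op hbar (Dop m f) x := by
  have hc : HasCurveDerivAt (fun _ : ℝ => f) 0 0 := by simp [HasCurveDerivAt]
  have h1 := hasDerivAt_op hbar (γ := fun _ => γ) (s' := 0) (P' := 0) (X' := 0) (A' := 0) (C' := 0)
    (t := (0 : ℝ)) (hasDerivAt_const _ _) (fun j => hasDerivAt_const _ _)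
    (fun j => hasDerivAt_const _ _) (fun j k => hasDerivAt_const _ _)
    (fun j k => hasDerivAt_const _ _) hc
    (x := fun r => x + r • EuclideanSpace.single j 1) (x' := Pi.single j 1) (fun k => by
      have := ((hasDerivAt_id (0 : ℝ)).mul_const ((Pi.single j 1 : Fin n → ℝ) k)).const_add (x k)
      rw [one_mul] at this
      refine this.congr_of_eventuallyEq (Eventually.of_forall fun r => ?_)
      simp [Pi.single_apply]) rfl rfl
  have h2 := h1.unique (hasDerivAt_line (γ.op hbar f) j x 0)
  simp only [zero_smul, add_zero] at h2
  rw [← h2]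
  simp [Pi.single_apply]

/-- Since `B` inverts `A`, the coordinates of `x - X` are recovered from those of `A(x - X)`; this
moves multiplication by `x_j` through the wave operator. -/
theorem sum_B_op_Xop (hbar : ℝ) (γ : Wave n) (j : Fin n) (f : Sch n) (x : Cfg n) :
    ∑ k, (γ.B j k : ℂ) * γ.op hbar (Xop k f) x = (x j - γ.X j) * γ.op hbar f x := by
  set y := x - WithLp.toLp 2 γ.X
  have h1 : γ.lin.symm (γ.lin y) j = x j - γ.X j := by
    rw [ContinuousLinearEquiv.symm_apply_apply]; rfl
  have h2 : ((x j - γ.X j : ℝ) : ℂ) = ∑ k, (γ.B j k : ℂ) * (γ.lin y k : ℂ) := by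
    rw [← h1, lin_symm_apply]
    simp [Matrix.mulVec, dotProduct]
  rw [← Complex.ofReal_sub, h2, Finset.sum_mul]
  refine Finset.sum_congr rfl fun k _ => ?_
  rw [op_apply, op_apply, Xop_apply]
  ring

/-- Conjugation rule for momenta: the phase contributes `P + C(x - X)` and the substitution
contributes `Aᵀ p̂`. -/
theorem dZop_inl_op {hbar : ℝ} (hbar0 : hbar ≠ 0) (γ : Wave n) (j : Fin n) (f : Sch n) :
    dZop hbar (Sum.elim γ.P γ.X) (Sum.inl j) (γ.op hbar f) =
      ∑ l, (γ.C j l : ℂ) • dZop hbar (Sum.elim γ.P γ.X) (Sum.inr l) (γ.op hbar f) +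
        γ.op hbar (γ.mom hbar j f) := by
  ext x
  have h0 : (hbar : ℂ) ≠ 0 := by exact_mod_cast hbar0
  have h1 : -Complex.I * hbar * (Complex.I / hbar) = 1 := by
    field_simp; simp
  have h2 : γ.op hbar (γ.mom hbar j f) x =
      -Complex.I * hbar * ∑ m, (γ.A m j : ℂ) * γ.op hbar (Dop m f) x := by
    simp only [mom_apply, Zop, smul_apply, map_sum, map_smul, _root_.sum_apply,
      smul_eq_mul, Finset.mul_sum]
    exact Finset.sum_congr rfl fun m _ => by ring
  simp only [dZop_apply, Zop, smul_apply, sub_apply, add_apply, _root_.sum_apply, smul_eq_mul,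
    Dop_op, Sum.elim_inl, Sum.elim_inr, Xop_apply, h2]
  rw [mul_add, ← mul_assoc, ← mul_assoc, h1, one_mul, add_mul, Finset.sum_mul]
  have h3 : ∀ l, (γ.C j l : ℂ) * ((x l : ℂ) * γ.op hbar f x - γ.X l * γ.op hbar f x) =
    (γ.C j l : ℂ) * (x l - γ.X l) * γ.op hbar f x := fun l => by ring
  simp only [h3]
  ring

/-- Locally bounded parameters and a locally bounded family give a locally bounded family. -/
theorem locBdd_op {ι : Type*} {l : Filter ι} (hbar : ℝ) {γ : ι → Wave n}
    (hs : ∃ K, ∀ᶠ i in l, ‖Complex.exp (γ i).s‖ ≤ K)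
    (hP : ∀ j, ∃ K, ∀ᶠ i in l, ‖((γ i).P j : ℂ)‖ ≤ K)
    (hX : ∀ j, ∃ K, ∀ᶠ i in l, ‖((γ i).X j : ℂ)‖ ≤ K)
    (hA : ∀ j k, ∃ K, ∀ᶠ i in l, ‖((γ i).A j k : ℂ)‖ ≤ K)
    (hB : ∀ j k, ∃ K, ∀ᶠ i in l, ‖((γ i).B j k : ℂ)‖ ≤ K)
    (hC : ∀ j k, ∃ K, ∀ᶠ i in l, ‖((γ i).C j k : ℂ)‖ ≤ K)
    {f : ι → Sch n} (hf : LocBdd l f) : LocBdd l (fun i => (γ i).op hbar (f i)) := by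
  -- Coordinates and derivatives pass through the wave operator with bounded coefficients, so the
  -- class is stable and only the sup norm must be checked; the phase has modulus one.
  refine LocBdd.of_class {u | ∃ f : ι → Sch n, LocBdd l f ∧ u = fun i => (γ i).op hbar (f i)}
    ?_ ?_ ?_ ⟨f, hf, rfl⟩
  · rintro _ ⟨f, hf, rfl⟩ j
    refine ⟨fun i => ∑ k, ((γ i).B j k : ℂ) • Xop k (f i) + ((γ i).X j : ℂ) • f i,
      (LocBdd.sum _ fun k _ => (hf.clm (Xop k)).smul (hB j k)).add (hf.smul (hX j)), ?_⟩
    funext i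
    ext x
    simp only [map_add, map_sum, map_smul, add_apply, _root_.sum_apply, smul_apply,
      smul_eq_mul, sum_B_op_Xop, Xop_apply]
    ring
  · rintro _ ⟨f, hf, rfl⟩ j
    refine ⟨fun i => (Complex.I / hbar) • (((γ i).P j : ℂ) • f i +
      ∑ l, ((γ i).C j l : ℂ) • ∑ k, ((γ i).B l k : ℂ) • Xop k (f i)) +
      ∑ m, ((γ i).A m j : ℂ) • Dop m (f i), ?_, ?_⟩
    · refine LocBdd.add (LocBdd.smul (LocBdd.add (hf.smul (hP j)) (LocBdd.sum _ fun l _ =>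
        LocBdd.smul (LocBdd.sum _ fun k _ => (hf.clm (Xop k)).smul (hB l k)) (hC j l)))
        ⟨‖Complex.I / hbar‖, Eventually.of_forall fun _ => le_rfl⟩)
        (LocBdd.sum _ fun m _ => (hf.clm (Dop m)).smul (hA m j))
    · funext i
      ext x
      simp only [map_add, map_sum, map_smul, add_apply, _root_.sum_apply, smul_apply,
        smul_eq_mul, sum_B_op_Xop, Dop_op]
      rw [mul_assoc, add_mul, Finset.sum_mul]
      simp only [mul_assoc]
  · rintro _ ⟨f, hf, rfl⟩
    obtain ⟨K, hK⟩ := hs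
    obtain ⟨M, hM⟩ := hf 0 0
    refine ⟨K * M, hK.mp (hM.mono fun i h1 h2 => ?_)⟩
    have hK0 : 0 ≤ K := (norm_nonneg _).trans h2
    refine sup_norm_le_bound _ (mul_nonneg hK0 ((apply_nonneg _ _).trans h1)) fun x => ?_
    rw [op_apply, norm_mul, norm_factor]
    exact mul_le_mul h2 ((sup_norm_le _ _).trans h1) (norm_nonneg _) hK0

end Wave

end NonlocalGPE
end

noncomputable section

namespace NonlocalGPE

open Filter

variable {n : ℕ}

theorem exists_eventually_norm_le {E : Type*} [NormedAddCommGroup E] {c : ℝ → E} {t : ℝ}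
    (hc : ContinuousAt c t) : ∃ K, ∀ᶠ τ in 𝓝 t, ‖c τ‖ ≤ K :=
  ⟨_, hc.norm.eventually_le_const (lt_add_one ‖c t‖)⟩

theorem exists_eventually_norm_ofReal_le {c : ℝ → ℝ} {t : ℝ}
    (hc : ContinuousAt c t) : ∃ K, ∀ᶠ τ in 𝓝 t, ‖(c τ : ℂ)‖ ≤ K :=
  exists_eventually_norm_le (Complex.continuous_ofReal.continuousAt.comp hc)

/-! ### Trajectory concentrated functions -/

/-- The isotropic dilation `x ↦ c x`. -/
def dilation {c : ℝ} (hc : c ≠ 0) : Cfg n ≃L[ℝ] Cfg n :=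
  ContinuousLinearEquiv.smulLeft (Units.mk0 c hc)

theorem dilation_apply {c : ℝ} (hc : c ≠ 0) (x : Cfg n) : dilation hc x = c • x := rfl

/-- Every smooth curve of Schwartz functions is trajectory concentrated, the trajectory being
constant. -/
theorem mem_Pt_of_isSmoothCurve {hbar : ℝ} (h : 0 < hbar) {u : ℝ → Sch n} (hu : IsSmoothCurve u) :
    u ∈ Pt hbar := by
  have hc : Real.sqrt hbar ≠ 0 := (Real.sqrt_pos.2 h).ne'
  refine ⟨fun t => SchwartzMap.compCLMOfContinuousLinearEquiv ℂ (dilation hc) (u t), fun _ => 0,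
    fun _ => 0, fun _ => 0, hu.clm _, contDiff_const, contDiff_const, contDiff_const,
    fun t x => ?_⟩
  simp [dilation_apply, smul_smul, inv_mul_cancel₀ hc]

/-- As `ħ` is fixed, a dilation by `√ħ` undoes the scaling, with zero phase and centre. -/
theorem P0_eq_univ {hbar : ℝ} (h : 0 < hbar) : (P0 hbar : Set (Sch n)) = Set.univ := by
  have hc : Real.sqrt hbar ≠ 0 := (Real.sqrt_pos.2 h).ne'
  refine Set.eq_univ_of_forall fun ψ => ⟨SchwartzMap.compCLMOfContinuousLinearEquiv ℂ
    (dilation hc) ψ, 0, 0, 0, fun x => ?_⟩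
  simp [dilation_apply, smul_smul, inv_mul_cancel₀ hc]

/-- Trajectory concentrated functions are locally bounded in the Schwartz space and pointwise
differentiable in time. -/
theorem locBdd_and_differentiable_of_mem_Pt {hbar : ℝ} (h : 0 < hbar) {u : ℝ → Sch n}
    (hu : u ∈ Pt hbar) :
    (∀ t, LocBdd (𝓝 t) u) ∧ ∀ t x, DifferentiableAt ℝ (fun τ => u τ x) t := by
  obtain ⟨φ, S, P, X, hφ, hS, hP, hX, hu⟩ := hu
  have hc : Real.sqrt hbar ≠ 0 := (Real.sqrt_pos.2 h).ne'
  -- A trajectory concentrated function is a wave operator with `A = ħ^{-1/2}`, `C = 0` and `s =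
  -- iS/ħ`, applied to the smooth curve `φ`.
  let γ : ℝ → Wave n := fun t =>
    { s := Complex.I / hbar * (S t : ℂ), P := (P t).ofLp, X := (X t).ofLp
      A := (Real.sqrt hbar)⁻¹ • 1, B := Real.sqrt hbar • 1, C := 0
      A_mul_B := by simp [smul_smul, mul_inv_cancel₀ hc]
      C_symm := Matrix.isSymm_zero }
  have huγ : u = fun t => (γ t).op hbar (φ t) := by
    funext t
    ext x
    have h1 : (γ t).lin (x - X t) = (Real.sqrt hbar)⁻¹ • (x - X t) := by
      ext j
      rw [Wave.lin_apply]
      simp [γ, Matrix.smul_mulVec]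
    have h2 : (γ t).phase (x - X t) = inner ℝ (P t) (x - X t) := by
      simp [γ, Wave.phase, PiLp.inner_apply, mul_comm]
    rw [hu, Wave.op_apply, mul_comm]
    change _ = (γ t).factor hbar (x - X t) * φ t ((γ t).lin (x - X t))
    rw [h1, Wave.factor, h2]
    simp only [γ]
    congr 2
    push_cast
    ring
  have hS1 : ∀ t, HasDerivAt S (deriv S t) t := fun t =>
    (hS.differentiable (by simp) t).hasDerivAt
  have hPj : ∀ j, ContDiff ℝ ∞ fun t => P t j := fun j => contDiff_euclidean.1 hP j
  have hXj : ∀ j, ContDiff ℝ ∞ fun t => X t j := fun j => contDiff_euclidean.1 hX j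
  constructor
  · intro t
    rw [huγ]
    have hs : ∃ K, ∀ᶠ τ in 𝓝 t, ‖Complex.exp (γ τ).s‖ ≤ K := by
      refine ⟨1, Eventually.of_forall fun τ => ?_⟩
      have : (γ τ).s = ((hbar⁻¹ * S τ : ℝ) : ℂ) * Complex.I := by
        simp only [γ]; push_cast; ring
      rw [this, Complex.norm_exp_ofReal_mul_I]
    exact Wave.locBdd_op (γ := γ) (f := φ) hbar hs
      (fun j => exists_eventually_norm_ofReal_le (c := fun τ => P τ j) (hPj j).continuous.continuousAt)
      (fun j => exists_eventually_norm_ofReal_le (c := fun τ => X τ j) (hXj j).continuous.continuousAt)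
      (fun j k => ⟨‖((γ t).A j k : ℂ)‖, Eventually.of_forall fun _ => le_refl _⟩)
      (fun j k => ⟨‖((γ t).B j k : ℂ)‖, Eventually.of_forall fun _ => le_refl _⟩)
      (fun j k => ⟨‖((γ t).C j k : ℂ)‖, Eventually.of_forall fun _ => le_refl _⟩)
      (LocBdd.of_tendsto hφ.continuous.continuousAt)
  · intro t x
    obtain ⟨φ', hφ'⟩ := hφ.exists_deriv
    rw [huγ]
    exact (Wave.hasDerivAt_op hbar (γ := γ) (x := fun _ => x) (x' := 0)
      ((hS1 t).ofReal_comp.const_mul (Complex.I / hbar))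
      (fun j => ((hPj j).differentiable (by simp) t).hasDerivAt)
      (fun j => ((hXj j).differentiable (by simp) t).hasDerivAt)
      (fun j k => hasDerivAt_const t _) (fun j k => hasDerivAt_const t _)
      (hφ'.2 t) (fun j => hasDerivAt_const t _) rfl rfl).differentiableAt

end NonlocalGPE
end

/-! ### Regularity of solutions and coefficients. -/

noncomputable section

namespace NonlocalGPE

open Filter Asymptotics

variable {n : ℕ}

/-! ### Families of quadratic operators -/

/-- The index set of the monomials of degree at most two in `ẑ`. -/
abbrev QIdx (n : ℕ) : Type := Unit ⊕ PIdx n ⊕ (PIdx n × PIdx n)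

/-- The monomials of degree at most two in `ẑ`. -/
def quadBasis (hbar : ℝ) : QIdx n → (Sch n →L[ℂ] Sch n)
  | Sum.inl _ => 1
  | Sum.inr (Sum.inl j) => Zop hbar j
  | Sum.inr (Sum.inr p) => Zop hbar p.1 * Zop hbar p.2

/-- The coefficients of `c + ⟨v, ẑ⟩ + ½⟨ẑ, S ẑ⟩`. -/
def quadCoeff (c : ℝ) (v : PIdx n → ℝ) (S : Matrix (PIdx n) (PIdx n) ℝ) : QIdx n → ℝ
  | Sum.inl _ => c
  | Sum.inr (Sum.inl j) => v j
  | Sum.inr (Sum.inr p) => 1 / 2 * S p.1 p.2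

/-- All dependence on time and state is moved into scalar coefficients of finitely many fixed
operators, which reduces boundedness, continuity and smoothness to scalars. -/
theorem quadOp_zero_apply (hbar c : ℝ) (v : PIdx n → ℝ) (S : Matrix (PIdx n) (PIdx n) ℝ)
    (f : Sch n) :
    quadOp hbar 0 c v S f = ∑ i, (quadCoeff c v S i : ℂ) • quadBasis hbar i f := by
  simp only [quadOp, Fintype.sum_sum_type, Fintype.sum_prod_type, quadCoeff, quadBasis, dZop_zero,
    add_apply, smul_apply, sum_apply, Finset.univ_unique, Finset.sum_singleton, add_assoc]
  push_cast
  simp only [Finset.smul_sum, smul_add, smul_smul]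

theorem LocBdd.sum_smul {κ : Type*} [Fintype κ] {t : ℝ} {c : κ → ℝ → ℂ}
    (hc : ∀ i, c i =O[𝓝 t] (1 : ℝ → ℝ)) (A : κ → Sch n →L[ℂ] Sch n) {u : ℝ → Sch n}
    (hu : LocBdd (𝓝 t) u) : LocBdd (𝓝 t) (fun τ => ∑ i, c i τ • A i (u τ)) :=
  LocBdd.sum _ fun i _ => (hu.clm (A i)).smul (by
    obtain ⟨K, hK⟩ := (hc i).bound
    exact ⟨K, hK.mono fun τ h => by simpa using h⟩)

theorem continuousAt_sum_smul {κ : Type*} [Fintype κ] {t : ℝ} {c : κ → ℝ → ℂ}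
    (hc : ∀ i, ContinuousAt (c i) t) (A : κ → Sch n →L[ℂ] Sch n) {u : ℝ → Sch n}
    (hu : ContinuousAt u t) : ContinuousAt (fun τ => ∑ i, c i τ • A i (u τ)) t :=
  tendsto_finsetSum _ fun i _ => (hc i).smul ((A i).continuous.continuousAt.comp hu)

theorem LocBdd.isBigO_ip {t : ℝ} {u : ℝ → Sch n} (hu : LocBdd (𝓝 t) u) (A : Sch n →L[ℂ] Sch n) :
    (fun τ => (ip (u τ) (A (u τ))).re) =O[𝓝 t] (1 : ℝ → ℝ) := by
  have h : ∀ {w : ℝ → Sch n}, LocBdd (𝓝 t) w → (fun τ => toL2 (w τ)) =O[𝓝 t] (1 : ℝ → ℝ) := by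
    intro w hw
    let p : Seminorm ℝ (Sch n) := (normSeminorm ℝ (MeasureTheory.Lp ℂ 2
      (MeasureTheory.volume : MeasureTheory.Measure (Cfg n)))).comp
        ((toL2.restrictScalars ℝ : Sch n →L[ℝ] _) : Sch n →ₗ[ℝ] _)
    obtain ⟨C, hC⟩ := hw.bound_continuous p (continuous_norm.comp toL2.continuous)
    exact IsBigO.of_bound C (hC.mono fun τ hτ => by
      have : ‖toL2 (w τ)‖ ≤ C := hτ
      simpa using this)
  have h2 := (h hu).norm_left.mul (h (hu.clm A)).norm_left
  refine (IsBigO.of_bound 1 (Eventually.of_forall fun τ => ?_)).trans (h2.trans (by simp [Pi.one_def, isBigO_refl]))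
  rw [one_mul, norm_mul, norm_norm, norm_norm]
  exact (Complex.abs_re_le_norm _).trans (norm_inner_le_norm _ _)

namespace Data

variable (Q : Data n)

/-- The coefficients of the operator of the nonlocal equation. -/
def gpeCoeff (t : ℝ) (ψ : Sch n) : QIdx n → ℝ :=
  quadCoeff (Q.kappa / 2 * ∑ j, ∑ k, Q.Www t j k * (ip ψ (Zop Q.hbar j (Zop Q.hbar k ψ))).re)
    (Q.Hz t + Q.kappa • (Q.Wzw t).mulVec fun k => (ip ψ (Zop Q.hbar k ψ)).re)
    (Q.hzz (Q.kappa * normSq ψ) t)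

theorem gpeOp_apply (t : ℝ) (ψ f : Sch n) :
    Q.gpeOp t ψ f = ∑ i, (Q.gpeCoeff t ψ i : ℂ) • quadBasis Q.hbar i f :=
  quadOp_zero_apply _ _ _ _ f

theorem normSq_eq_re_ip (ψ : Sch n) : normSq ψ = (ip ψ ((1 : Sch n →L[ℂ] Sch n) ψ)).re := by
  simp [ip_self]

theorem isBigO_gpeCoeff {t : ℝ} {u : ℝ → Sch n} (hu : LocBdd (𝓝 t) u) (i : QIdx n) :
    (fun τ => (Q.gpeCoeff τ (u τ) i : ℂ)) =O[𝓝 t] (1 : ℝ → ℝ) := by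
  have hR : ∀ {f g : ℝ → ℝ}, f =O[𝓝 t] (1 : ℝ → ℝ) → g =O[𝓝 t] (1 : ℝ → ℝ) →
      (fun τ => f τ * g τ) =O[𝓝 t] (1 : ℝ → ℝ) := fun hf hg => by
    simpa [Pi.one_def] using hf.mul hg
  have hC : ∀ {f : ℝ → ℝ}, Continuous f → f =O[𝓝 t] (1 : ℝ → ℝ) := fun hf =>
    (hf.tendsto t).isBigO_one ℝ
  suffices h : (fun τ => Q.gpeCoeff τ (u τ) i) =O[𝓝 t] (1 : ℝ → ℝ) by
    refine (IsBigO.of_bound 1 (Eventually.of_forall fun τ => ?_)).trans h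
    simp
  rcases i with _ | j | ⟨j, k⟩
  · simp only [gpeCoeff, quadCoeff]
    refine hR (hC continuous_const) (IsBigO.fun_sum fun j _ => IsBigO.fun_sum fun k _ =>
      hR (hC (Q.Www_smooth j k).continuous) (hu.isBigO_ip (Zop Q.hbar j * Zop Q.hbar k)))
  · simp only [gpeCoeff, quadCoeff, Pi.add_apply, Pi.smul_apply, smul_eq_mul, Matrix.mulVec,
      dotProduct]
    exact (hC (Q.Hz_smooth j).continuous).add (hR (hC continuous_const) (IsBigO.fun_sum fun k _ =>
      hR (hC (Q.Wzw_smooth j k).continuous) (hu.isBigO_ip (Zop Q.hbar k))))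
  · simp only [gpeCoeff, quadCoeff, hzz, Matrix.add_apply, Matrix.smul_apply, smul_eq_mul,
      normSq_eq_re_ip]
    exact hR (hC continuous_const) ((hC (Q.Hzz_smooth j k).continuous).add (hR
      (hR (hC continuous_const) (hu.isBigO_ip 1)) (hC (Q.Wzz_smooth j k).continuous)))

theorem continuousAt_gpeCoeff {t : ℝ} {u : ℝ → Sch n} (hu : ContinuousAt u t) (i : QIdx n) :
    ContinuousAt (fun τ => (Q.gpeCoeff τ (u τ) i : ℂ)) t := by
  have hip : ∀ A : Sch n →L[ℂ] Sch n, ContinuousAt (fun τ => (ip (u τ) (A (u τ))).re) t :=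
    fun A => Complex.continuous_re.continuousAt.comp
      (continuousAt_ip hu (A.continuous.continuousAt.comp hu))
  refine Complex.continuous_ofReal.continuousAt.comp ?_
  rcases i with _ | j | ⟨j, k⟩
  · simp only [gpeCoeff, quadCoeff]
    exact continuousAt_const.mul (tendsto_finsetSum _ fun j _ => tendsto_finsetSum _ fun k _ =>
      (Q.Www_smooth j k).continuous.continuousAt.mul (hip (Zop Q.hbar j * Zop Q.hbar k)))
  · simp only [gpeCoeff, quadCoeff, Pi.add_apply, Pi.smul_apply, smul_eq_mul, Matrix.mulVec,
      dotProduct]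
    exact (Q.Hz_smooth j).continuous.continuousAt.add (continuousAt_const.mul
      (tendsto_finsetSum _ fun k _ =>
        (Q.Wzw_smooth j k).continuous.continuousAt.mul (hip (Zop Q.hbar k))))
  · simp only [gpeCoeff, quadCoeff, hzz, Matrix.add_apply, Matrix.smul_apply, smul_eq_mul,
      normSq_eq_re_ip]
    exact continuousAt_const.mul ((Q.Hzz_smooth j k).continuous.continuousAt.add
      ((continuousAt_const.mul (hip 1)).mul (Q.Wzz_smooth j k).continuous.continuousAt))

/-- Solutions of the nonlocal equation are differentiable curves in the Schwartz space. -/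
theorem IsGPESolution.hasCurveDerivAt {Q : Data n} {u : ℝ → Sch n} (hu : Q.IsGPESolution u) (t : ℝ) :
    HasCurveDerivAt u ((-(Complex.I / Q.hbar)) • Q.gpeOp t (u t) (u t)) t := by
  obtain ⟨hb, hd⟩ := locBdd_and_differentiable_of_mem_Pt Q.hbar_pos hu.1
  have hp : PDeriv u (fun t => (-(Complex.I / Q.hbar)) • Q.gpeOp t (u t) (u t)) t := by
    refine Eventually.of_forall fun τ x => ?_
    have h1 := hu.2 τ x
    rw [add_assoc, Q.gpe_coe, deriv_eq_iff] at h1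
    have h2 := (hd τ x).hasDerivAt
    rw [h1] at h2
    exact h2
  have hv : LocBdd (𝓝 t) (fun t => (-(Complex.I / Q.hbar)) • Q.gpeOp t (u t) (u t)) := by
    simp only [gpeOp_apply]
    exact (LocBdd.sum_smul (Q.isBigO_gpeCoeff (hb t)) _ (hb t)).smul
      ⟨_, Eventually.of_forall fun _ => le_rfl⟩
  -- Bootstrap: boundedness of `u` bounds the right-hand side, which makes `u` continuous; then the
  -- coefficients and the right-hand side are continuous, as a derivative in the Schwartz space
  -- requires.
  have hc := hp.continuousAt hv
  refine hp.hasCurveDerivAt hv ?_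
  simp only [gpeOp_apply]
  have h1 := continuousAt_sum_smul (Q.continuousAt_gpeCoeff hc) (quadBasis Q.hbar) hc
  have h2 : ContinuousAt (fun _ : ℝ => -(Complex.I / Q.hbar)) t := continuousAt_const
  exact h2.smul h1

/-- Smooth curves generated by the operators of the nonlocal equation are solutions. -/
theorem isGPESolution_of_hasCurveDerivAt {u : ℝ → Sch n} (hs : IsSmoothCurve u)
    (hu : ∀ t, HasCurveDerivAt u ((-(Complex.I / Q.hbar)) • Q.gpeOp t (u t) (u t)) t) :
    Q.IsGPESolution u := by
  refine ⟨mem_Pt_of_isSmoothCurve Q.hbar_pos hs, fun t x => ?_⟩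
  rw [add_assoc, Q.gpe_coe, deriv_eq_iff]
  exact ((hu t).apply x).deriv

/-- The coefficients of the operator of the linear associated Schrödinger equation. -/
def laseCoeff (κt t : ℝ) (g : Moments n) : QIdx n → ℝ :=
  quadCoeff (Q.h0 κt t g - (Q.hz κt t g.1 - (Q.hzz κt t).mulVec g.1) ⬝ᵥ g.1 -
      1 / 2 * (g.1 ⬝ᵥ (Q.hzz κt t).mulVec g.1))
    (Q.hz κt t g.1 - (Q.hzz κt t).mulVec g.1) (Q.hzz κt t)

/-- The coefficients are those which `quadOp_recenter` carries back to `𝔥`, `𝔥_z` and `𝔥_zz` at the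
centre `z`. -/
theorem laseOp_apply (κt t : ℝ) (g : Moments n) (f : Sch n) :
    Q.laseOp κt t g f = ∑ i, (Q.laseCoeff κt t g i : ℂ) • quadBasis Q.hbar i f := by
  rw [laseCoeff, ← quadOp_zero_apply, quadOp_recenter _ g.1 _ _ (Q.hzz_isSymm κt t), laseOp]
  congr 2 <;> ring

theorem contDiff_hzz (κt : ℝ) (j k : PIdx n) : ContDiff ℝ ∞ fun t => Q.hzz κt t j k := by
  simp only [hzz, Matrix.add_apply, Matrix.smul_apply, smul_eq_mul]
  exact (Q.Hzz_smooth j k).add (contDiff_const.mul (Q.Wzz_smooth j k))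

variable {Q}

theorem contDiff_hz {m : WithTop ℕ∞} (hm : m ≤ ∞) {κt : ℝ} {z : ℝ → PIdx n → ℝ}
    (hz : ∀ j, ContDiff ℝ m fun t => z t j) (j : PIdx n) :
    ContDiff ℝ m fun t => Q.hz κt t (z t) j := by
  simp only [Data.hz, Pi.add_apply, Matrix.mulVec, dotProduct, Matrix.add_apply, Matrix.smul_apply,
    smul_eq_mul]
  exact ((Q.Hz_smooth j).of_le hm).add (ContDiff.sum fun k _ =>
    (((Q.Hzz_smooth j k).of_le hm).add (contDiff_const.mul (((Q.Wzz_smooth j k).of_le hm).add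
      ((Q.Wzw_smooth j k).of_le hm)))).mul (hz k))

/-- Solutions of the Hamilton--Ehrenfest system are smooth. -/
theorem IsHESSolution.contDiff {κt : ℝ} {g : ℝ → Moments n} (hg : Q.IsHESSolution κt g) :
    (∀ j, ContDiff ℝ ∞ fun t => (g t).1 j) ∧ ∀ j k, ContDiff ℝ ∞ fun t => (g t).2 j k := by
  have hnat : ∀ m : ℕ, (∀ j, ContDiff ℝ m fun t => (g t).1 j) ∧
      ∀ j k, ContDiff ℝ m fun t => (g t).2 j k := by
    intro m
    induction m with
    | zero =>
      exact ⟨fun j => contDiff_zero.2 (continuous_iff_continuousAt.2 fun t => (hg.1 t j).continuousAt),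
        fun j k => contDiff_zero.2
          (continuous_iff_continuousAt.2 fun t => (hg.2 t j k).continuousAt)⟩
    | succ m ih =>
      have hm : (m : WithTop ℕ∞) ≤ ∞ := by exact_mod_cast le_top
      have hstep : ∀ {f f' : ℝ → ℝ}, (∀ t, HasDerivAt f (f' t) t) → ContDiff ℝ m f' →
          ContDiff ℝ (m + 1 : ℕ) f := fun {f f'} h h' => by
        push_cast
        refine contDiff_succ_iff_deriv.2 ⟨fun t => (h t).differentiableAt, by simp, ?_⟩
        rwa [show deriv f = f' from funext fun t => (h t).deriv]
      refine ⟨fun j => hstep (fun t => hg.1 t j) ?_, fun j k => hstep (fun t => hg.2 t j k) ?_⟩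
      · simp only [Matrix.mulVec, dotProduct]
        exact ContDiff.sum fun k _ => contDiff_const.mul (contDiff_hz hm ih.1 k)
      · simp only [Matrix.sub_apply, Matrix.mul_apply]
        have hz := fun j k => (Q.contDiff_hzz κt j k).of_le hm
        exact (ContDiff.sum fun l _ => (ContDiff.sum fun i _ =>
          contDiff_const.mul (hz i l)).mul (ih.2 l k)).sub (ContDiff.sum fun l _ =>
            (ContDiff.sum fun i _ => (ih.2 j i).mul (hz i l)).mul contDiff_const)
  exact ⟨fun j => contDiff_infty.2 fun m => (hnat m).1 j,
    fun j k => contDiff_infty.2 fun m => (hnat m).2 j k⟩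

theorem IsHESSolution.contDiff_h0 {κt : ℝ} {g : ℝ → Moments n} (hg : Q.IsHESSolution κt g) :
    ContDiff ℝ ∞ fun t => Q.h0 κt t (g t) := by
  obtain ⟨h1, h2⟩ := hg.contDiff
  simp only [h0, Matrix.trace, Matrix.diag, Matrix.mul_apply, Matrix.mulVec, dotProduct,
    Matrix.add_apply, Matrix.smul_apply, smul_eq_mul]
  exact ((contDiff_const.mul (ContDiff.sum fun j _ => (h1 j).mul (ContDiff.sum fun k _ =>
    ((Q.Hzz_smooth j k).add (contDiff_const.mul (((Q.Wzz_smooth j k).add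
      (contDiff_const.mul (Q.Wzw_smooth j k))).add (Q.Www_smooth j k)))).mul (h1 k)))).add
    (ContDiff.sum fun j _ => (Q.Hz_smooth j).mul (h1 j))).add
    (contDiff_const.mul (ContDiff.sum fun j _ => ContDiff.sum fun k _ =>
      (Q.Www_smooth j k).mul (h2 k j)))

theorem IsHESSolution.contDiff_laseCoeff {κt : ℝ} {g : ℝ → Moments n} (hg : Q.IsHESSolution κt g)
    (i : QIdx n) : ContDiff ℝ ∞ fun t => Q.laseCoeff κt t (g t) i := by
  have h1 := hg.contDiff.1
  have h2 : ∀ j, ContDiff ℝ ∞ fun t => (Q.hzz κt t).mulVec (g t).1 j := fun j => by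
    simp only [Matrix.mulVec, dotProduct]
    exact ContDiff.sum fun k _ => (Q.contDiff_hzz κt j k).mul (h1 k)
  have h3 := fun j => contDiff_hz (Q := Q) (κt := κt) le_rfl h1 j
  rcases i with _ | j | ⟨j, k⟩
  · simp only [laseCoeff, quadCoeff, dotProduct, Pi.sub_apply]
    exact (hg.contDiff_h0.sub (ContDiff.sum fun j _ => ((h3 j).sub (h2 j)).mul (h1 j))).sub
      (contDiff_const.mul (ContDiff.sum fun j _ => (h1 j).mul (h2 j)))
  · exact (h3 j).sub (h2 j)
  · exact contDiff_const.mul (Q.contDiff_hzz κt j k)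

end Data

end NonlocalGPE
end

/-! ### Riccati equation, free evolution and the local propagator. -/

noncomputable section

namespace NonlocalGPE

open Filter

variable {n : ℕ}

/-! ### Derivatives of matrix-valued functions -/

/-- Entrywise differentiability of a matrix-valued function. -/
def MDeriv {l m : Type*} (Y : ℝ → Matrix l m ℝ) (Y' : Matrix l m ℝ) (t : ℝ) : Prop :=
  ∀ j k, HasDerivAt (fun τ => Y τ j k) (Y' j k) t

namespace MDeriv

variable {l m r : Type*} {t : ℝ}

theorem mul [Fintype m] {Y : ℝ → Matrix l m ℝ} {Z : ℝ → Matrix m r ℝ} {Y' Z'} (hY : MDeriv Y Y' t)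
    (hZ : MDeriv Z Z' t) : MDeriv (fun τ => Y τ * Z τ) (Y' * Z t + Y t * Z') t := fun j k => by
  simp only [Matrix.mul_apply, Matrix.add_apply, ← Finset.sum_add_distrib]
  exact HasDerivAt.fun_sum fun i _ => (hY j i).mul (hZ i k)

theorem sub {Y Z : ℝ → Matrix l m ℝ} {Y' Z'} (hY : MDeriv Y Y' t) (hZ : MDeriv Z Z' t) :
    MDeriv (fun τ => Y τ - Z τ) (Y' - Z') t := fun j k => (hY j k).sub (hZ j k)

theorem transpose {Y : ℝ → Matrix l m ℝ} {Y'} (hY : MDeriv Y Y' t) :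
    MDeriv (fun τ => (Y τ).transpose) Y'.transpose t := fun j k => hY k j

theorem continuousAt {Y : ℝ → Matrix l m ℝ} {Y'} (hY : MDeriv Y Y' t) : ContinuousAt Y t :=
  continuousAt_pi.2 fun j => continuousAt_pi.2 fun k => (hY j k).continuousAt

theorem continuousAt_inv [Fintype l] [DecidableEq l] {Y : ℝ → Matrix l l ℝ} (hY : ContinuousAt Y t)
    (h : (Y t).det ≠ 0) : ContinuousAt (fun τ => (Y τ)⁻¹) t := by
  simp only [Matrix.inv_def, Ring.inverse_eq_inv']
  have h1 : ContinuousAt (fun τ => (Y τ).det) t :=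
    (continuous_id.matrix_det (n := l) (R := ℝ)).continuousAt.comp hY
  exact (h1.inv₀ h).smul ((continuous_id.matrix_adjugate (n := l) (R := ℝ)).continuousAt.comp hY)

/-- Divide `Y(τ)⁻¹ - Y(t)⁻¹ = -Y(τ)⁻¹ (Y(τ) - Y(t)) Y(t)⁻¹` by `τ - t` and use continuity of the
inverse. -/
theorem inv [Fintype l] [DecidableEq l] {Y : ℝ → Matrix l l ℝ} {Y'} (hY : MDeriv Y Y' t)
    (h : (Y t).det ≠ 0) : MDeriv (fun τ => (Y τ)⁻¹) (-((Y t)⁻¹ * Y' * (Y t)⁻¹)) t := by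
  have hdet : ∀ᶠ τ in 𝓝 t, (Y τ).det ≠ 0 :=
    ((continuous_id.matrix_det (n := l) (R := ℝ)).continuousAt.comp hY.continuousAt).eventually_ne h
  have hs : Tendsto (fun τ => Matrix.of fun j k => slope (fun τ => Y τ j k) t τ) (𝓝[≠] t) (𝓝 Y') :=
    tendsto_pi_nhds.2 fun j => tendsto_pi_nhds.2 fun k => hasDerivAt_iff_tendsto_slope.1 (hY j k)
  have hi : Tendsto (fun τ => (Y τ)⁻¹) (𝓝[≠] t) (𝓝 (Y t)⁻¹) :=
    (continuousAt_inv hY.continuousAt h).tendsto.mono_left nhdsWithin_le_nhds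
  have hc : Continuous fun p : Matrix l l ℝ × Matrix l l ℝ => -(p.1 * p.2 * (Y t)⁻¹) :=
    ((continuous_fst.matrix_mul continuous_snd).matrix_mul continuous_const).neg
  have h1 := (hc.tendsto ((Y t)⁻¹, Y')).comp (hi.prodMk_nhds hs)
  intro j k
  rw [hasDerivAt_iff_tendsto_slope]
  refine ((tendsto_pi_nhds.1 (tendsto_pi_nhds.1 h1 j)) k).congr' ?_
  filter_upwards [nhdsWithin_le_nhds hdet] with τ hτ
  have e1 : (Matrix.of fun j k => slope (fun τ => Y τ j k) t τ) = (τ - t)⁻¹ • (Y τ - Y t) := by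
    ext a b
    simp [slope_def_module]
  have e2 : (Y τ)⁻¹ * (Y τ - Y t) * (Y t)⁻¹ = (Y t)⁻¹ - (Y τ)⁻¹ := by
    rw [Matrix.mul_sub, Matrix.sub_mul, Matrix.nonsing_inv_mul _ (isUnit_iff_ne_zero.2 hτ),
      Matrix.mul_assoc, Matrix.mul_nonsing_inv _ (isUnit_iff_ne_zero.2 h), one_mul, mul_one]
  simp only [Function.comp_apply, e1, Matrix.mul_smul, Matrix.smul_mul, e2]
  simp [slope_def_module]
  ring

end MDeriv

theorem exists_primitive {E : Type*} [NormedAddCommGroup E] [NormedSpace ℝ E] [CompleteSpace E]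
    {f : ℝ → E} {a b : ℝ} (hf : ContinuousOn f (Set.Ioo a b)) :
    ∃ F : ℝ → E, ∀ t ∈ Set.Ioo a b, HasDerivAt F (f t) t := by
  rcases le_or_gt b a with hab | hab
  · exact ⟨0, fun t ht => absurd (ht.1.trans ht.2) hab.not_gt⟩
  obtain ⟨c, hc⟩ := Set.nonempty_Ioo.2 hab
  refine ⟨fun t => ∫ s in c..t, f s, fun t ht => ?_⟩
  have hsub : Set.uIcc c t ⊆ Set.Ioo a b := Set.ordConnected_Ioo.uIcc_subset hc ht
  exact intervalIntegral.integral_hasDerivAt_right (hf.mono hsub).intervalIntegrable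
    (hf.stronglyMeasurableAtFilter isOpen_Ioo t ht) (hf.continuousAt (isOpen_Ioo.mem_nhds ht))

/-- Local solutions of the matrix Riccati equation and its companion equation. -/
theorem exists_riccati {S : ℝ → Matrix (PIdx n) (PIdx n) ℝ} (hS : ∀ t, (S t).IsSymm)
    (hc : ∀ j k, Continuous fun t => S t j k) (s : ℝ) :
    ∃ δ > 0, ∃ A B C : ℝ → Matrix (Fin n) (Fin n) ℝ, ∀ t ∈ Set.Ioo (s - δ) (s + δ),
      A t * B t = 1 ∧ (C t).IsSymm ∧
      MDeriv A (-(A t * ((S t).toBlocks₁₁ * C t + (S t).toBlocks₁₂))) t ∧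
      ContinuousAt B t ∧
      MDeriv C (-((S t).toBlocks₂₁ * C t + (S t).toBlocks₂₂ + C t * (S t).toBlocks₁₁ * C t +
        C t * (S t).toBlocks₁₂)) t := by
  have hJ : ∀ j k, Continuous fun t => (Matrix.J (Fin n) ℝ * S t) j k := fun j k => by
    simp only [Matrix.mul_apply]
    exact continuous_finsetSum _ fun l _ => continuous_const.mul (hc l k)
  -- The Riccati equation is linearized by the Hamiltonian flow `Ẏ = J S Y`, `Y(s) = 1`. With second
  -- block column `(p, q)`, take `C = p q⁻¹`, `A = q⁻¹`, `B = q`; as `q(s) = 1`, the inverse exists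
  -- near `s`.
  obtain ⟨Y, ⟨hY0, hY⟩, -⟩ := matrixODE_existsUnique hJ (B := fun _ => (0 : Matrix (PIdx n) (PIdx n) ℝ))
    (fun _ _ => continuous_const) s (1 : Matrix (PIdx n) (PIdx n) ℝ)
  set q : ℝ → Matrix (Fin n) (Fin n) ℝ := fun t => (Y t).toBlocks₂₂ with hq
  set p : ℝ → Matrix (Fin n) (Fin n) ℝ := fun t => (Y t).toBlocks₁₂ with hp
  have hblock : ∀ t, Matrix.J (Fin n) ℝ * S t * Y t + Y t * 0 = Matrix.fromBlocks
      (-((S t).toBlocks₂₁ * (Y t).toBlocks₁₁ + (S t).toBlocks₂₂ * (Y t).toBlocks₂₁))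
      (-((S t).toBlocks₂₁ * p t + (S t).toBlocks₂₂ * q t))
      ((S t).toBlocks₁₁ * (Y t).toBlocks₁₁ + (S t).toBlocks₁₂ * (Y t).toBlocks₂₁)
      ((S t).toBlocks₁₁ * p t + (S t).toBlocks₁₂ * q t) := fun t => by
    conv_lhs => rw [← Matrix.fromBlocks_toBlocks (S t), ← Matrix.fromBlocks_toBlocks (Y t)]
    simp [Matrix.J, Matrix.fromBlocks_multiply, hp, hq]
    constructor <;> abel
  have hp' : ∀ t, MDeriv p (-((S t).toBlocks₂₁ * p t + (S t).toBlocks₂₂ * q t)) t :=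
    fun t j k => by
      have := hY t (Sum.inl j) (Sum.inr k)
      rw [hblock] at this
      exact this
  have hq' : ∀ t, MDeriv q ((S t).toBlocks₁₁ * p t + (S t).toBlocks₁₂ * q t) t :=
    fun t j k => by
      have := hY t (Sum.inr j) (Sum.inr k)
      rw [hblock] at this
      exact this
  have hT11 : ∀ t, ((S t).toBlocks₁₁).transpose = (S t).toBlocks₁₁ := fun t => by
    ext j k; exact (hS t).apply _ _
  have hT12 : ∀ t, ((S t).toBlocks₁₂).transpose = (S t).toBlocks₂₁ := fun t => by
    ext j k; exact (hS t).apply _ _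
  have hT21 : ∀ t, ((S t).toBlocks₂₁).transpose = (S t).toBlocks₁₂ := fun t => by
    ext j k; exact (hS t).apply _ _
  have hT22 : ∀ t, ((S t).toBlocks₂₂).transpose = (S t).toBlocks₂₂ := fun t => by
    ext j k; exact (hS t).apply _ _
  -- The Lagrangian property: `pᵀq - qᵀp` is constant and vanishes at `s`, where `p = 0`. It yields
  -- the symmetry of `C`.
  have hiso : ∀ t, (p t).transpose * q t = (q t).transpose * p t := by
    have hd : ∀ t, MDeriv (fun t => (p t).transpose * q t - (q t).transpose * p t) 0 t := fun t => by
      have h1 := ((hp' t).transpose.mul (hq' t)).sub ((hq' t).transpose.mul (hp' t))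
      convert h1 using 1
      simp only [Matrix.transpose_neg, Matrix.transpose_add, Matrix.transpose_mul, hT11, hT12, hT21,
        hT22]
      noncomm_ring
    intro t
    ext j k
    have h1 := is_const_of_deriv_eq_zero (fun t => (hd t j k).differentiableAt)
      (fun t => (hd t j k).deriv) t s
    have h2 : p s = 0 := by simp [hp, hY0, ← Matrix.fromBlocks_one]
    simp only [h2] at h1
    simpa [sub_eq_zero] using h1
  have hdet : ∀ᶠ t in 𝓝 s, (q t).det ≠ 0 := by
    refine ((continuous_id.matrix_det (n := Fin n) (R := ℝ)).continuousAt.comp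
      (hq' s).continuousAt).eventually_ne ?_
    have h2 : q s = 1 := by simp [hq, hY0, ← Matrix.fromBlocks_one]
    simp [h2]
  obtain ⟨δ, hδ, hball⟩ := Metric.eventually_nhds_iff_ball.1 hdet
  refine ⟨δ, hδ, fun t => (q t)⁻¹, q, fun t => p t * (q t)⁻¹, fun t ht => ?_⟩
  have hdt : (q t).det ≠ 0 := hball t (by rwa [Real.ball_eq_Ioo])
  have hqq : q t * (q t)⁻¹ = 1 := Matrix.mul_nonsing_inv _ (isUnit_iff_ne_zero.2 hdt)
  have hqq' : (q t)⁻¹ * q t = 1 := Matrix.nonsing_inv_mul _ (isUnit_iff_ne_zero.2 hdt)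
  have hA : MDeriv (fun t => (q t)⁻¹)
      (-((q t)⁻¹ * ((S t).toBlocks₁₁ * (p t * (q t)⁻¹) + (S t).toBlocks₁₂))) t := by
    convert (hq' t).inv hdt using 1
    rw [Matrix.mul_assoc, Matrix.add_mul, Matrix.mul_assoc _ (q t), hqq, Matrix.mul_one,
      Matrix.mul_assoc]
  refine ⟨hqq', ?_, hA, (hq' t).continuousAt, ?_⟩
  · have hqT : ((q t)⁻¹).transpose * (q t).transpose = 1 := by
      rw [← Matrix.transpose_mul, hqq, Matrix.transpose_one]
    calc (p t * (q t)⁻¹).transpose = ((q t)⁻¹).transpose * ((p t).transpose * q t) * (q t)⁻¹ := by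
          rw [Matrix.transpose_mul, Matrix.mul_assoc, Matrix.mul_assoc, hqq, Matrix.mul_one]
      _ = p t * (q t)⁻¹ := by
          rw [hiso, ← Matrix.mul_assoc, hqT, Matrix.one_mul]
  · convert (hp' t).mul hA using 1
    rw [Matrix.neg_mul, Matrix.add_mul, Matrix.mul_assoc _ (q t), hqq, Matrix.mul_one]
    noncomm_ring

end NonlocalGPE
end

noncomputable section

namespace NonlocalGPE

open Filter FourierTransform

variable {n : ℕ}

/-! ### The free evolution -/

/-- The factor `2πħ` reflects the normalization `e^{2πi⟨x,ξ⟩}` of the Fourier transform. -/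
theorem Zop_inl_fourierInv (hbar : ℝ) (j : Fin n) (f : Sch n) :
    Zop hbar (Sum.inl j) (𝓕⁻ f) = ((2 * Real.pi * hbar : ℝ) : ℂ) • (𝓕⁻ (Xop j f) : Sch n) := by
  have h1 : Dop j (𝓕⁻ f) = (2 * Real.pi * Complex.I) • (𝓕⁻ (Xop j f) : Sch n) := by
    have h := SchwartzMap.lineDerivOp_fourierInv_eq f (EuclideanSpace.single j (1 : ℝ))
    have h2 : SchwartzMap.smulLeftCLM ℂ
        (fun x : Cfg n => inner ℝ x (EuclideanSpace.single j (1 : ℝ))) f = Xop j f := by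
      ext x
      rw [SchwartzMap.smulLeftCLM_apply_apply (by fun_prop), Xop_apply]
      simp [PiLp.inner_apply]
    have h3 : Dop j (𝓕⁻ f) = 𝓕⁻ ((2 * Real.pi * Complex.I) • Xop j f) := by
      rw [← h2]; exact h
    rw [h3, fourierInv_smul]
  simp only [Zop, smul_apply, h1, smul_smul]
  congr 1
  push_cast
  linear_combination (-2 * (hbar : ℂ) * Real.pi) * Complex.I_mul_I

/-- The evolution generated by a time-dependent quadratic form of the momenta. -/
theorem exists_free_evolution (hbar : ℝ) {b : ℝ → Matrix (Fin n) (Fin n) ℝ}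
    {t₀ t₁ : ℝ} (hb : ∀ j k, ContinuousOn (fun t => b t j k) (Set.Ioo t₀ t₁))
    (hsymm : ∀ t, (b t).IsSymm) :
    ∃ F : ℝ → Sch n →L[ℂ] Sch n, (∀ t, ∃ R : Sch n →L[ℂ] Sch n, ∀ f, F t (R f) = f) ∧
      ∀ t ∈ Set.Ioo t₀ t₁, ∀ f, HasCurveDerivAt (fun τ => F τ f) ((-(Complex.I / hbar) / 2) •
        ∑ j, ∑ k, (b t j k : ℂ) • Zop hbar (Sum.inl j) (Zop hbar (Sum.inl k) (F t f))) t := by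
  choose β hβ using fun j k => exists_primitive (hb j k)
  set c : ℝ := (2 * Real.pi * hbar) ^ 2 with hc
  -- On the Fourier side the evolution is multiplication by a Gaussian phase, itself a wave operator
  -- with `C = -(2πħ)² ∫ b`. The primitives are symmetrized because their constants are arbitrary;
  -- no normalization at any time is imposed.
  let γ : ℝ → Wave n := fun t =>
    { s := 0, P := 0, X := 0, A := 1, B := 1
      C := Matrix.of fun j k => -(c / 2) * (β j k t + β k j t)
      A_mul_B := one_mul 1
      C_symm := Matrix.IsSymm.ext fun j k => by simp [add_comm] }
  let Fo : Sch n →L[ℂ] Sch n := fourierCLM ℂ (Sch n)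
  let Fi : Sch n →L[ℂ] Sch n := fourierInvCLM ℂ (Sch n)
  refine ⟨fun t => Fi ∘L (γ t).op hbar ∘L Fo, fun t => ?_, fun t ht f => ?_⟩
  · obtain ⟨R, hR⟩ := (γ t).exists_op_comp_eq_one hbar
    refine ⟨Fi ∘L R ∘L Fo, fun f => ?_⟩
    simp [Fi, Fo, hR]
  · set φ : Sch n := Fo f
    set u : ℝ → Sch n := fun τ => (γ τ).op hbar φ with hu
    set v : ℝ → Sch n := fun τ => ∑ p : Fin n × Fin n,
      ((-(Complex.I / hbar) / 2 * c) * (b τ p.1 p.2 : ℂ)) • (Xop p.1 * Xop p.2) (u τ) with hv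
    have hCd : ∀ τ ∈ Set.Ioo t₀ t₁, ∀ j k, HasDerivAt (fun τ => (γ τ).C j k) ((-c • b τ) j k) τ := by
      intro τ hτ j k
      refine (((hβ j k τ hτ).add (hβ k j τ hτ)).const_mul (-(c / 2))).congr_deriv ?_
      have := (hsymm τ).apply j k
      rw [Matrix.smul_apply, smul_eq_mul]
      linear_combination (-(c / 2)) * this
    have hI : ∀ᶠ τ in 𝓝 t, τ ∈ Set.Ioo t₀ t₁ := isOpen_Ioo.mem_nhds ht
    have hp : PDeriv u v t := by
      refine hI.mono fun τ hτ x => ?_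
      have h1 := Wave.hasDerivAt_op hbar (γ := γ) (s' := 0) (P' := 0) (X' := 0) (A' := 0)
        (w := fun _ => φ) (w' := 0) (x := fun _ => x) (x' := 0)
        (hasDerivAt_const τ _) (fun j => hasDerivAt_const τ _) (fun j => hasDerivAt_const τ _)
        (fun j k => hasDerivAt_const τ _) (hCd τ hτ) (by simp [HasCurveDerivAt])
        (fun j => hasDerivAt_const τ _) rfl rfl
      refine h1.congr_deriv ?_
      simp only [hv, Fintype.sum_prod_type, _root_.sum_apply, smul_apply, mul_apply_eq_comp,
        Xop_apply, hu]
      set a := (γ τ).op hbar φ x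
      simp only [γ, map_zero, zero_apply, Pi.zero_apply, zero_mul, mul_zero, add_zero,
        Finset.sum_const_zero, zero_add, sub_zero, Matrix.zero_mulVec, Matrix.mulVec_zero,
        Complex.ofReal_zero, Complex.ofReal_mul, Complex.ofReal_sum, Finset.mul_sum, Finset.sum_mul,
        Matrix.smul_apply, smul_eq_mul, Complex.ofReal_neg]
      refine Finset.sum_congr rfl fun j _ => Finset.sum_congr rfl fun k _ => ?_
      push_cast
      ring
    have hul : LocBdd (𝓝 t) u := by
      have h0 : ∀ a : ℝ, ∃ K, ∀ᶠ _ : ℝ in 𝓝 t, ‖(a : ℂ)‖ ≤ K := fun a =>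
        ⟨_, Eventually.of_forall fun _ => le_rfl⟩
      exact Wave.locBdd_op (γ := γ) (f := fun _ => φ) hbar
        ⟨‖Complex.exp 0‖, Eventually.of_forall fun _ => le_refl _⟩
        (fun j => h0 0) (fun j => h0 0) (fun j k => h0 _) (fun j k => h0 _)
        (fun j k => exists_eventually_norm_ofReal_le (c := fun τ => (γ τ).C j k)
          (hCd t ht j k).continuousAt) (LocBdd.of_tendsto tendsto_const_nhds)
    have hbc : ∀ p : Fin n × Fin n, ContinuousAt
        (fun τ => (-(Complex.I / hbar) / 2 * c) * (b τ p.1 p.2 : ℂ)) t := fun p =>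
      continuousAt_const.mul (Complex.continuous_ofReal.continuousAt.comp
        ((hb p.1 p.2).continuousAt (isOpen_Ioo.mem_nhds ht)))
    have hvl : LocBdd (𝓝 t) v := LocBdd.sum_smul (fun p => (hbc p).tendsto.isBigO_one ℝ) _ hul
    have h2 : HasCurveDerivAt (fun τ => Fi (u τ)) (Fi (v t)) t :=
      ((hp.hasCurveDerivAt hvl (continuousAt_sum_smul hbc _ (hp.continuousAt hvl))).clm
        (Fi.restrictScalars ℝ))
    have h3 : ∀ g : Sch n, Fi g = 𝓕⁻ g := fun g => rfl
    have h4 : (-(Complex.I / hbar) / 2) • ∑ j, ∑ k, (b t j k : ℂ) •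
        Zop hbar (Sum.inl j) (Zop hbar (Sum.inl k) (Fi (u t))) = Fi (v t) := by
      simp only [hv, map_sum, map_smul, Fintype.sum_prod_type]
      simp only [Finset.smul_sum, smul_smul, mul_apply_eq_comp, h3, Zop_inl_fourierInv, map_smul]
      refine Finset.sum_congr rfl fun j _ => Finset.sum_congr rfl fun k _ => ?_
      congr 1
      rw [hc]
      push_cast
      ring
    rw [← h4] at h2
    exact h2

end NonlocalGPE
end

noncomputable section

namespace NonlocalGPE

open Filter

variable {n : ℕ}

/-! ### The local propagator of a quadratic operator -/

/-- Curves of wave operators whose parameters follow prescribed points of the phase space and the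
matrix Riccati equation. -/
theorem exists_wave {S : ℝ → Matrix (PIdx n) (PIdx n) ℝ} (hS : ∀ t, (S t).IsSymm)
    (hc : ∀ j k, Continuous fun t => S t j k) {σ : ℝ → ℂ} (hσ : Continuous σ)
    (p x : ℝ → Fin n → ℝ) (s : ℝ) :
    ∃ δ > 0, ∃ γ : ℝ → Wave n, ∀ t ∈ Set.Ioo (s - δ) (s + δ),
      (γ t).P = p t ∧ (γ t).X = x t ∧
      HasDerivAt (fun τ => (γ τ).s)
        (σ t - 1 / 2 * (((S t).toBlocks₁₁ * (γ t).C + (S t).toBlocks₁₂).trace : ℝ)) t ∧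
      MDeriv (fun τ => (γ τ).A)
        (-((γ t).A * ((S t).toBlocks₁₁ * (γ t).C + (S t).toBlocks₁₂))) t ∧
      ContinuousAt (fun τ => (γ τ).B) t ∧
      MDeriv (fun τ => (γ τ).C) (-((S t).toBlocks₂₁ * (γ t).C + (S t).toBlocks₂₂ +
        (γ t).C * (S t).toBlocks₁₁ * (γ t).C + (γ t).C * (S t).toBlocks₁₂)) t := by
  classical
  obtain ⟨δ, hδ, A, B, C, h⟩ := exists_riccati hS hc s
  have hcont : ContinuousOn (fun t => σ t - 1 / 2 *
      (((S t).toBlocks₁₁ * C t + (S t).toBlocks₁₂).trace : ℝ)) (Set.Ioo (s - δ) (s + δ)) := by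
    intro t ht
    refine ContinuousAt.continuousWithinAt (hσ.continuousAt.sub (continuousAt_const.mul
      (Complex.continuous_ofReal.continuousAt.comp ?_)))
    simp only [Matrix.trace, Matrix.diag, Matrix.add_apply, Matrix.mul_apply]
    exact tendsto_finsetSum _ fun j _ => (tendsto_finsetSum _ fun k _ =>
      (hc (Sum.inl j) (Sum.inl k)).continuousAt.mul ((h t ht).2.2.2.2 k j).continuousAt).add
        (hc (Sum.inl j) (Sum.inr j)).continuousAt
  obtain ⟨F, hF⟩ := exists_primitive hcont
  -- `Wave` carries proofs of `A B = 1` and of the symmetry of `C`, which hold only on the interval;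
  -- outside it trivial parameters are used.
  let γ : ℝ → Wave n := fun t => if ht : t ∈ Set.Ioo (s - δ) (s + δ) then
      { s := F t, P := p t, X := x t, A := A t, B := B t, C := C t
        A_mul_B := (h t ht).1, C_symm := (h t ht).2.1 }
    else { s := 0, P := 0, X := 0, A := 1, B := 1, C := 0
           A_mul_B := one_mul 1, C_symm := Matrix.isSymm_zero }
  have hγ : ∀ t ∈ Set.Ioo (s - δ) (s + δ), (γ t).s = F t ∧ (γ t).P = p t ∧ (γ t).X = x t ∧
      (γ t).A = A t ∧ (γ t).B = B t ∧ (γ t).C = C t := fun t ht => by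
    simp only [γ, dif_pos ht, and_self]
  refine ⟨δ, hδ, γ, fun t ht => ?_⟩
  have hI : ∀ᶠ τ in 𝓝 t, τ ∈ Set.Ioo (s - δ) (s + δ) := isOpen_Ioo.mem_nhds ht
  obtain ⟨-, -, h3, h4, h5⟩ := h t ht
  obtain ⟨e1, e2, e3, e4, e5, e6⟩ := hγ t ht
  rw [e4, e6]
  refine ⟨e2, e3, (hF t ht).congr_of_eventuallyEq (hI.mono fun τ hτ => (hγ τ hτ).1),
    fun j k => (h3 j k).congr_of_eventuallyEq (hI.mono fun τ hτ => ?_),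
    h4.congr (hI.mono fun τ hτ => (hγ τ hτ).2.2.2.2.1.symm),
    fun j k => (h5 j k).congr_of_eventuallyEq (hI.mono fun τ hτ => ?_)⟩
  · change (γ τ).A j k = _
    rw [(hγ τ hτ).2.2.2.1]
  · change (γ τ).C j k = _
    rw [(hγ τ hτ).2.2.2.2.2]

theorem sum_mul_bilin (M : Matrix (Fin n) (Fin n) ℝ) (u v : Fin n → ℝ) (a : ℂ) :
    ∑ j, ∑ k, (M j k : ℂ) * ((u j : ℂ) * v k * a) = ((u ⬝ᵥ M.mulVec v : ℝ) : ℂ) * a := by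
  simp only [dotProduct, Matrix.mulVec, Complex.ofReal_sum, Complex.ofReal_mul, Finset.mul_sum,
    Finset.sum_mul]
  exact Finset.sum_congr rfl fun j _ => Finset.sum_congr rfl fun k _ => by ring

theorem sum_mul_left (M : Matrix (Fin n) (Fin n) ℝ) (v : Fin n → ℝ) (b : Fin n → ℂ) :
    ∑ j, ∑ k, (M j k : ℂ) * ((v k : ℂ) * b j) = ∑ j, ((M.mulVec v j : ℝ) : ℂ) * b j := by
  simp only [dotProduct, Matrix.mulVec, Complex.ofReal_sum, Complex.ofReal_mul, Finset.sum_mul,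
    mul_assoc]

theorem sum_mul_right (M : Matrix (Fin n) (Fin n) ℝ) (v : Fin n → ℝ) (b : Fin n → ℂ) :
    ∑ j, ∑ k, (M j k : ℂ) * ((v j : ℂ) * b k) =
      ∑ j, ((M.transpose.mulVec v j : ℝ) : ℂ) * b j := by
  rw [Finset.sum_comm, ← sum_mul_left]
  rfl

theorem sum_sum_comm {ι M : Type*} [Fintype ι] [AddCommMonoid M] (F : ι → ι → ι → ι → M) :
    ∑ l, ∑ m, ∑ j, ∑ k, F l m j k = ∑ j, ∑ k, ∑ l, ∑ m, F l m j k := by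
  calc _ = ∑ l, ∑ j, ∑ m, ∑ k, F l m j k := Finset.sum_congr rfl fun l _ => Finset.sum_comm
    _ = ∑ j, ∑ l, ∑ m, ∑ k, F l m j k := Finset.sum_comm
    _ = ∑ j, ∑ l, ∑ k, ∑ m, F l m j k := Finset.sum_congr rfl fun j _ =>
      Finset.sum_congr rfl fun l _ => Finset.sum_comm
    _ = _ := Finset.sum_congr rfl fun j _ => Finset.sum_comm

/-- The action of a quadratic operator on the image of a wave operator. -/
theorem quadOp_op_apply {hbar : ℝ} (hbar0 : hbar ≠ 0) (γ : Wave n) (c : ℝ) (v : PIdx n → ℝ)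
    {S : Matrix (PIdx n) (PIdx n) ℝ} (hS : S.IsSymm) (f : Sch n) (x : Cfg n) {y u : Fin n → ℝ}
    (hy : y = x.ofLp - γ.X) (hu : u = γ.C.mulVec y) :
    quadOp hbar (Sum.elim γ.P γ.X) c v S (γ.op hbar f) x =
      ((c + ((v ∘ Sum.inl) ⬝ᵥ u + (v ∘ Sum.inr) ⬝ᵥ y) + 1 / 2 * (u ⬝ᵥ S.toBlocks₁₁.mulVec u) +
        u ⬝ᵥ S.toBlocks₁₂.mulVec y + 1 / 2 * (y ⬝ᵥ S.toBlocks₂₂.mulVec y) : ℝ) : ℂ) *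
          γ.op hbar f x -
      Complex.I * hbar / 2 * ((S.toBlocks₁₁ * γ.C + S.toBlocks₁₂).trace : ℝ) * γ.op hbar f x +
      ∑ j, (((v ∘ Sum.inl + S.toBlocks₁₁.mulVec u + S.toBlocks₁₂.mulVec y) j : ℝ) : ℂ) *
        γ.op hbar (γ.mom hbar j f) x +
      1 / 2 * ∑ j, ∑ k, (S.toBlocks₁₁ j k : ℂ) * γ.op hbar (γ.mom hbar j (γ.mom hbar k f)) x := by
  set z : PIdx n → ℝ := Sum.elim γ.P γ.X with hz
  set a := γ.op hbar f x with ha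
  set b : Fin n → ℂ := fun j => γ.op hbar (γ.mom hbar j f) x with hb
  set d : Fin n → Fin n → ℂ := fun j k => γ.op hbar (γ.mom hbar j (γ.mom hbar k f)) x with hd
  have hx : ∀ l (h : Sch n), dZop hbar z (Sum.inr l) h x = y l * h x := fun l h => by
    simp [dZop_apply, Zop, hz, hy, sub_mul]
  have hop : ∀ j (h : Sch n), dZop hbar z (Sum.inl j) (γ.op hbar h) =
      ∑ l, (γ.C j l : ℂ) • dZop hbar z (Sum.inr l) (γ.op hbar h) + γ.op hbar (γ.mom hbar j h) :=
    fun j h => Wave.dZop_inl_op hbar0 γ j h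
  have hul : ∀ j, (u j : ℂ) = ∑ l, (γ.C j l : ℂ) * y l := fun j => by
    rw [hu]; simp [Matrix.mulVec, dotProduct]
  have hp : ∀ j, dZop hbar z (Sum.inl j) (γ.op hbar f) x = u j * a + b j := fun j => by
    rw [hop, add_apply, _root_.sum_apply]
    simp only [smul_apply, smul_eq_mul, hx]
    rw [hul, Finset.sum_mul]
    simp only [mul_assoc, ha, hb]
  -- Moving the position to the left of the momentum costs `-iħ δ_jk`; these corrections are the
  -- source of the trace term.
  have hpx : ∀ j k, dZop hbar z (Sum.inl j) (dZop hbar z (Sum.inr k) (γ.op hbar f)) x =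
      y k * (u j * a + b j) - (if j = k then Complex.I * hbar * a else 0) := fun j k => by
    have h1 := congrArg (fun A : Sch n →L[ℂ] Sch n => A (γ.op hbar f) x)
      (dZop_comm hbar z (Sum.inl j) (Sum.inr k))
    simp only [mul_apply_eq_comp, add_apply, smul_apply, one_apply_eq_self, hx, hp,
      smul_eq_mul] at h1
    rw [h1]
    by_cases hjk : j = k
    · subst hjk
      simp [Matrix.J, ha]
      ring
    · simp [Matrix.J, hjk]
  have hpp : ∀ j k, dZop hbar z (Sum.inl j) (dZop hbar z (Sum.inl k) (γ.op hbar f)) x =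
      (u j * u k * a + u k * b j + u j * b k + d j k) - Complex.I * hbar * (γ.C k j * a) :=
    fun j k => by
      have h0 : dZop hbar z (Sum.inl j) (γ.op hbar (γ.mom hbar k f)) x = u j * b k + d j k := by
        rw [hop, add_apply, _root_.sum_apply]
        simp only [smul_apply, smul_eq_mul, hx]
        rw [hul, Finset.sum_mul]
        simp only [mul_assoc, hb, hd]
      rw [hop k f, map_add, map_sum, add_apply, _root_.sum_apply, h0]
      simp only [map_smul, smul_apply, smul_eq_mul, hpx, mul_sub, mul_ite, mul_zero,
        Finset.sum_sub_distrib, Finset.sum_ite_eq, Finset.mem_univ, if_true]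
      have h2 : ∑ l, (γ.C k l : ℂ) * (y l * (u j * a + b j)) = u k * (u j * a + b j) := by
        rw [hul k, Finset.sum_mul]
        simp only [mul_assoc]
      rw [h2]
      ring
  have hxp : S.toBlocks₂₁ = S.toBlocks₁₂.transpose := by
    ext j k; exact (hS.apply _ _)
  have hpT : S.toBlocks₁₁.transpose = S.toBlocks₁₁ := by
    ext j k; exact hS.apply _ _
  have e11 : ∑ j, ∑ k, (S (Sum.inl j) (Sum.inl k) : ℂ) *
      dZop hbar z (Sum.inl j) (dZop hbar z (Sum.inl k) (γ.op hbar f)) x =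
      ((u ⬝ᵥ S.toBlocks₁₁.mulVec u : ℝ) : ℂ) * a +
        2 * ∑ j, ((S.toBlocks₁₁.mulVec u j : ℝ) : ℂ) * b j +
        ∑ j, ∑ k, (S.toBlocks₁₁ j k : ℂ) * d j k -
        Complex.I * hbar * ((S.toBlocks₁₁ * γ.C).trace : ℝ) * a := by
    have h1 := sum_mul_bilin S.toBlocks₁₁ u u a
    have h2 := sum_mul_left S.toBlocks₁₁ u b
    have h3 := sum_mul_right S.toBlocks₁₁ u b
    rw [hpT] at h3
    have h4 : ∑ j, ∑ k, (S.toBlocks₁₁ j k : ℂ) * (Complex.I * hbar * (γ.C k j * a)) =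
        Complex.I * hbar * ((S.toBlocks₁₁ * γ.C).trace : ℝ) * a := by
      simp only [Matrix.trace, Matrix.diag, Matrix.mul_apply, Complex.ofReal_sum,
        Complex.ofReal_mul, Finset.mul_sum, Finset.sum_mul]
      exact Finset.sum_congr rfl fun j _ => Finset.sum_congr rfl fun k _ => by ring
    have h5 : ∀ j k, S (Sum.inl j) (Sum.inl k) = S.toBlocks₁₁ j k := fun _ _ => rfl
    simp only [hpp, h5, mul_sub, mul_add _ (_ + _), mul_add _ (_ * _), Finset.sum_sub_distrib, Finset.sum_add_distrib]
    rw [h1, h2, h3, h4]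
    ring
  have e12 : ∑ j, ∑ k, (S (Sum.inl j) (Sum.inr k) : ℂ) *
      dZop hbar z (Sum.inl j) (dZop hbar z (Sum.inr k) (γ.op hbar f)) x =
      ((u ⬝ᵥ S.toBlocks₁₂.mulVec y : ℝ) : ℂ) * a +
        ∑ j, ((S.toBlocks₁₂.mulVec y j : ℝ) : ℂ) * b j -
        Complex.I * hbar * (S.toBlocks₁₂.trace : ℝ) * a := by
    have h1 := sum_mul_bilin S.toBlocks₁₂ u y a
    have h2 := sum_mul_left S.toBlocks₁₂ y b
    have h5 : ∀ j k, S (Sum.inl j) (Sum.inr k) = S.toBlocks₁₂ j k := fun _ _ => rfl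
    have h6 : ∀ j k, (y k : ℂ) * (u j * a + b j) = u j * y k * a + y k * b j := fun j k => by ring
    simp only [hpx, h5, h6, mul_sub, mul_add _ (_ * _), Finset.sum_sub_distrib, mul_ite, mul_zero,
      Finset.sum_add_distrib, Finset.sum_ite_eq, Finset.mem_univ, if_true]
    rw [h1, h2]
    simp only [Matrix.trace, Matrix.diag, Complex.ofReal_sum, Finset.mul_sum, Finset.sum_mul]
    congr 1
    exact Finset.sum_congr rfl fun j _ => by ring
  have e21 : ∑ j, ∑ k, (S (Sum.inr j) (Sum.inl k) : ℂ) *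
      dZop hbar z (Sum.inr j) (dZop hbar z (Sum.inl k) (γ.op hbar f)) x =
      ((u ⬝ᵥ S.toBlocks₁₂.mulVec y : ℝ) : ℂ) * a +
        ∑ j, ((S.toBlocks₁₂.mulVec y j : ℝ) : ℂ) * b j := by
    have h1 := sum_mul_bilin S.toBlocks₂₁ y u a
    have h2 := sum_mul_right S.toBlocks₂₁ y b
    have h3 : y ⬝ᵥ S.toBlocks₂₁.mulVec u = u ⬝ᵥ S.toBlocks₁₂.mulVec y := by
      rw [hxp, Matrix.dotProduct_mulVec, Matrix.vecMul_transpose, dotProduct_comm]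
    rw [h3] at h1
    rw [hxp, Matrix.transpose_transpose] at h2
    have h5 : ∀ j k, S (Sum.inr j) (Sum.inl k) = S.toBlocks₂₁ j k := fun _ _ => rfl
    have h6 : ∀ j k, (y j : ℂ) * (u k * a + b k) = y j * u k * a + y j * b k := fun j k => by ring
    rw [← hxp] at h2
    simp only [hx, hp, h5, h6, mul_add _ (_ * _), Finset.sum_add_distrib]
    rw [h1, h2]
  have e22 : ∑ j, ∑ k, (S (Sum.inr j) (Sum.inr k) : ℂ) *
      dZop hbar z (Sum.inr j) (dZop hbar z (Sum.inr k) (γ.op hbar f)) x =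
      ((y ⬝ᵥ S.toBlocks₂₂.mulVec y : ℝ) : ℂ) * a := by
    rw [← sum_mul_bilin S.toBlocks₂₂ y y a]
    simp only [hx, ← mul_assoc]
    rfl
  have e1 : ∑ j, (v (Sum.inl j) : ℂ) * dZop hbar z (Sum.inl j) (γ.op hbar f) x =
      (((v ∘ Sum.inl) ⬝ᵥ u : ℝ) : ℂ) * a + ∑ j, (v (Sum.inl j) : ℂ) * b j := by
    simp only [hp, mul_add, Finset.sum_add_distrib, dotProduct, Complex.ofReal_sum,
      Complex.ofReal_mul, Finset.sum_mul, mul_assoc, Function.comp_apply]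
  have e2 : ∑ j, (v (Sum.inr j) : ℂ) * dZop hbar z (Sum.inr j) (γ.op hbar f) x =
      (((v ∘ Sum.inr) ⬝ᵥ y : ℝ) : ℂ) * a := by
    simp only [hx, dotProduct, Complex.ofReal_sum,
      Complex.ofReal_mul, Finset.sum_mul, mul_assoc, Function.comp_apply, ha]
  simp only [quadOp, add_apply, smul_apply, _root_.sum_apply, one_apply_eq_self, mul_apply_eq_comp,
    smul_eq_mul, Fintype.sum_sum_type, Finset.sum_add_distrib]
  rw [e1, e2, e11, e12, e21, e22, Matrix.trace_add]
  simp only [Pi.add_apply, Function.comp_apply, Complex.ofReal_add, add_mul, Finset.sum_add_distrib,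
    Complex.ofReal_mul]
  push_cast
  ring

/-- If the parameters of a curve of wave operators follow the classical flow of a quadratic operator
and the Riccati equation, the wave operators intertwine the evolution generated by the transformed
kinetic energy with the evolution generated by the quadratic operator. -/
theorem hasDerivAt_wave {hbar : ℝ} (hbar0 : hbar ≠ 0) {γ : ℝ → Wave n} {t : ℝ} {c : ℝ}
    {v : PIdx n → ℝ} {S : Matrix (PIdx n) (PIdx n) ℝ} (hS : S.IsSymm)
    (hs : HasDerivAt (fun τ => (γ τ).s) (-(Complex.I / hbar) *
      ((c - (γ t).P ⬝ᵥ (v ∘ Sum.inl) : ℝ) : ℂ) -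
        1 / 2 * ((S.toBlocks₁₁ * (γ t).C + S.toBlocks₁₂).trace : ℝ)) t)
    (hP : ∀ j, HasDerivAt (fun τ => (γ τ).P j) (-v (Sum.inr j)) t)
    (hX : ∀ j, HasDerivAt (fun τ => (γ τ).X j) (v (Sum.inl j)) t)
    (hA : MDeriv (fun τ => (γ τ).A) (-((γ t).A * (S.toBlocks₁₁ * (γ t).C + S.toBlocks₁₂))) t)
    (hC : MDeriv (fun τ => (γ τ).C) (-(S.toBlocks₂₁ * (γ t).C + S.toBlocks₂₂ +
        (γ t).C * S.toBlocks₁₁ * (γ t).C + (γ t).C * S.toBlocks₁₂)) t)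
    {w : ℝ → Sch n} (hw : HasCurveDerivAt w ((-(Complex.I / hbar) / 2) • ∑ j, ∑ k,
      (((γ t).A * S.toBlocks₁₁ * (γ t).A.transpose) j k : ℂ) •
        Zop hbar (Sum.inl j) (Zop hbar (Sum.inl k) (w t))) t) (x : Cfg n) :
    HasDerivAt (fun τ => (γ τ).op hbar (w τ) x) (((-(Complex.I / hbar)) •
      quadOp hbar (Sum.elim (γ t).P (γ t).X) c v S ((γ t).op hbar (w t))) x) t := by
  set y : Fin n → ℝ := x.ofLp - (γ t).X with hy
  set u : Fin n → ℝ := (γ t).C.mulVec y with hu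
  have h0 : (hbar : ℂ) ≠ 0 := by exact_mod_cast hbar0
  have h1 := Wave.hasDerivAt_op hbar hs hP hX hA hC hw (x := fun _ => x) (x' := 0)
    (fun j => hasDerivAt_const t _) hy (y' := -(v ∘ Sum.inl)) (by ext j; simp)
  refine h1.congr_deriv ?_
  rw [smul_apply, smul_eq_mul, quadOp_op_apply hbar0 (γ t) c v hS (w t) x hy hu]
  set a := (γ t).op hbar (w t) x
  -- the terms of second order in the momenta
  have e1 : (γ t).op hbar ((-(Complex.I / hbar) / 2) • ∑ j, ∑ k,
      (((γ t).A * S.toBlocks₁₁ * (γ t).A.transpose) j k : ℂ) •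
        Zop hbar (Sum.inl j) (Zop hbar (Sum.inl k) (w t))) x = -(Complex.I / hbar) * (1 / 2 *
      ∑ j, ∑ k, (S.toBlocks₁₁ j k : ℂ) *
        (γ t).op hbar ((γ t).mom hbar j ((γ t).mom hbar k (w t))) x) := by
    have hm : ∀ j k, (γ t).op hbar ((γ t).mom hbar j ((γ t).mom hbar k (w t))) x =
        ∑ l, ∑ m, ((γ t).A l j : ℂ) * ((γ t).A m k *
          (γ t).op hbar (Zop hbar (Sum.inl l) (Zop hbar (Sum.inl m) (w t))) x) := fun j k => by
      simp only [Wave.mom_apply, map_sum, map_smul, Finset.smul_sum, _root_.sum_apply, smul_apply,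
        smul_eq_mul]
      rw [Finset.sum_comm]
      exact Finset.sum_congr rfl fun l _ => Finset.sum_congr rfl fun m _ => by ring
    have hM : ∀ l m, ((γ t).A * S.toBlocks₁₁ * (γ t).A.transpose) l m =
        ∑ j, ∑ k, (γ t).A l j * S.toBlocks₁₁ j k * (γ t).A m k := fun l m => by
      simp only [Matrix.mul_apply, Matrix.transpose_apply, Finset.sum_mul]
      exact Finset.sum_comm
    simp only [map_sum, map_smul, _root_.sum_apply, smul_apply, smul_eq_mul, hm, hM,
      Complex.ofReal_sum, Complex.ofReal_mul, Finset.sum_mul]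
    rw [sum_sum_comm, neg_div, ← mul_assoc]
    congr 1
    · ring
    · simp only [Finset.mul_sum]
      refine Finset.sum_congr rfl fun j _ => Finset.sum_congr rfl fun k _ =>
        Finset.sum_congr rfl fun l _ => Finset.sum_congr rfl fun m _ => ?_
      ring
  -- the terms of first order in the momenta
  have e2 : ∑ m, ((((-((γ t).A * (S.toBlocks₁₁ * (γ t).C + S.toBlocks₁₂))).mulVec y +
      (γ t).A.mulVec (-(v ∘ Sum.inl))) m : ℝ) : ℂ) * (γ t).op hbar (Dop m (w t)) x =
      -(Complex.I / hbar) * ∑ j, (((v ∘ Sum.inl + S.toBlocks₁₁.mulVec u +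
        S.toBlocks₁₂.mulVec y) j : ℝ) : ℂ) * (γ t).op hbar ((γ t).mom hbar j (w t)) x := by
    set r := v ∘ Sum.inl + S.toBlocks₁₁.mulVec u + S.toBlocks₁₂.mulVec y with hr
    have hv : (-((γ t).A * (S.toBlocks₁₁ * (γ t).C + S.toBlocks₁₂))).mulVec y +
        (γ t).A.mulVec (-(v ∘ Sum.inl)) = -(γ t).A.mulVec r := by
      rw [hr, hu, Matrix.neg_mulVec, ← Matrix.mulVec_mulVec, Matrix.add_mulVec,
        ← Matrix.mulVec_mulVec, Matrix.mulVec_neg, Matrix.mulVec_add, Matrix.mulVec_add,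
        Matrix.mulVec_add]
      abel
    have hm : ∀ j, (γ t).op hbar ((γ t).mom hbar j (w t)) x =
        ∑ m, ((γ t).A m j : ℂ) * (-Complex.I * hbar * (γ t).op hbar (Dop m (w t)) x) := fun j => by
      simp only [Wave.mom_apply, Zop, map_sum, map_smul, _root_.sum_apply, smul_apply, smul_eq_mul]
    have h2 : ∀ d : ℂ, Complex.I / hbar * (-Complex.I * hbar * d) = d := fun d => by
      field_simp
      simp
    rw [hv]
    simp only [hm, Finset.mul_sum, Pi.neg_apply, Matrix.mulVec, dotProduct, Complex.ofReal_neg,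
      Complex.ofReal_sum, Complex.ofReal_mul, neg_mul, Finset.sum_mul]
    simp only [← Finset.sum_neg_distrib]
    rw [Finset.sum_comm]
    refine Finset.sum_congr rfl fun j _ => Finset.sum_congr rfl fun m _ => ?_
    linear_combination (-((γ t).A m j : ℂ) * r j) * (h2 ((γ t).op hbar (Dop m (w t)) x)).symm
  -- the quadratic form of the phase
  have e3 : (∑ j, (-v (Sum.inr j) * y j + (γ t).P j * (-(v ∘ Sum.inl)) j) +
      (1 / 2 * ∑ j, ∑ k, (-(S.toBlocks₂₁ * (γ t).C + S.toBlocks₂₂ +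
        (γ t).C * S.toBlocks₁₁ * (γ t).C + (γ t).C * S.toBlocks₁₂)) j k * (y j * y k) +
        ∑ j, ∑ k, (γ t).C j k * (y k * (-(v ∘ Sum.inl)) j)) : ℝ) =
      -((v ∘ Sum.inr) ⬝ᵥ y) - (γ t).P ⬝ᵥ (v ∘ Sum.inl) - (v ∘ Sum.inl) ⬝ᵥ u -
        1 / 2 * (u ⬝ᵥ S.toBlocks₁₁.mulVec u) - u ⬝ᵥ S.toBlocks₁₂.mulVec y -
          1 / 2 * (y ⬝ᵥ S.toBlocks₂₂.mulVec y) := by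
    have hq : ∀ (M : Matrix (Fin n) (Fin n) ℝ), ∑ j, ∑ k, M j k * (y j * y k) = y ⬝ᵥ M.mulVec y :=
      fun M => by
        simp only [dotProduct, Matrix.mulVec, Finset.mul_sum]
        exact Finset.sum_congr rfl fun j _ => Finset.sum_congr rfl fun k _ => by ring
    have hl : ∑ j, ∑ k, (γ t).C j k * (y k * (-(v ∘ Sum.inl)) j) = -((v ∘ Sum.inl) ⬝ᵥ u) := by
      rw [← neg_dotProduct]
      simp only [hu, dotProduct, Matrix.mulVec, Finset.mul_sum]
      exact Finset.sum_congr rfl fun j _ => Finset.sum_congr rfl fun k _ => by ring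
    have hCy : ∀ b : Fin n → ℝ, y ⬝ᵥ (γ t).C.mulVec b = u ⬝ᵥ b := fun b => by
      rw [Matrix.dotProduct_mulVec, ← Matrix.mulVec_transpose, (γ t).C_symm.eq]
    have h21 : y ⬝ᵥ S.toBlocks₂₁.mulVec u = u ⬝ᵥ S.toBlocks₁₂.mulVec y := by
      have : S.toBlocks₂₁ = S.toBlocks₁₂.transpose := by
        ext j k; exact hS.apply _ _
      rw [this, Matrix.dotProduct_mulVec, Matrix.vecMul_transpose, dotProduct_comm]
    have hd : ∑ j, (-v (Sum.inr j) * y j + (γ t).P j * (-(v ∘ Sum.inl)) j) =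
        -((v ∘ Sum.inr) ⬝ᵥ y) - (γ t).P ⬝ᵥ (v ∘ Sum.inl) := by
      simp [dotProduct, Finset.sum_add_distrib, sub_eq_add_neg]
    rw [hq, hl, hd]
    simp only [Matrix.neg_mulVec, Matrix.add_mulVec, ← Matrix.mulVec_mulVec, dotProduct_neg,
      dotProduct_add, hCy, ← hu, h21]
    ring
  -- Scalar terms remain. The trace correction `-iħ/2 · tr`, multiplied by `-i/ħ`, is the `-½ tr` in
  -- the equation for `s`; the quadratic parts match by the Riccati equation.
  rw [e1, e2, e3]
  push_cast
  field_simp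
  ring_nf
  simp only [Complex.I_sq]
  ring

end NonlocalGPE
end

/-! ### Existence and uniqueness of the Green operator. -/

noncomputable section

namespace NonlocalGPE

open Filter

variable {n : ℕ}

namespace Data

variable {Q : Data n}

/-! ### The Green operator -/

/-- `u` is locally bounded at `t` and solves the linear associated Schrödinger equation pointwise
at the time `t`. -/
def IsPointwiseLaseAt (Q : Data n) (κt : ℝ) (g : ℝ → Moments n) (u : ℝ → Sch n) (t : ℝ) : Prop :=
  LocBdd (𝓝 t) u ∧ ∀ x, HasDerivAt (fun τ => u τ x)
    (((-(Complex.I / Q.hbar)) • Q.laseOp κt t (g t) (u t)) x) t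

/-- The same bootstrap as for the nonlocal equation, here with coefficients already known to be
continuous. -/
theorem IsPointwiseLaseAt.isLaseAt {κt : ℝ} {g : ℝ → Moments n} (hg : Q.IsHESSolution κt g)
    {u : ℝ → Sch n} {a b : ℝ} (hu : ∀ t ∈ Set.Ioo a b, Q.IsPointwiseLaseAt κt g u t) {t : ℝ}
    (ht : t ∈ Set.Ioo a b) : Q.IsLaseAt κt g u t := by
  have hcoeff : ∀ i, ContinuousAt (fun τ => (Q.laseCoeff κt τ (g τ) i : ℂ)) t := fun i =>
    Complex.continuous_ofReal.continuousAt.comp (hg.contDiff_laseCoeff i).continuous.continuousAt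
  have hp : PDeriv u (fun t => (-(Complex.I / Q.hbar)) • Q.laseOp κt t (g t) (u t)) t :=
    Eventually.mono (isOpen_Ioo.mem_nhds ht) fun τ hτ x => (hu τ hτ).2 x
  have hv : LocBdd (𝓝 t) (fun t => (-(Complex.I / Q.hbar)) • Q.laseOp κt t (g t) (u t)) := by
    simp only [laseOp_apply]
    exact (LocBdd.sum_smul (fun i => (hcoeff i).tendsto.isBigO_one ℝ) _ (hu t ht).1).smul
      ⟨_, Eventually.of_forall fun _ => le_rfl⟩
  have hc := hp.continuousAt hv
  refine hp.hasCurveDerivAt hv ?_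
  simp only [laseOp_apply]
  have h1 := continuousAt_sum_smul hcoeff (quadBasis Q.hbar) hc
  have h2 : ContinuousAt (fun _ : ℝ => -(Complex.I / Q.hbar)) t := continuousAt_const
  exact h2.smul h1

/-- A wave operator centred at the classical trajectory is composed with the free evolution for `A
𝔥_pp Aᵀ`, where `𝔥_pp` is the momentum block of `𝔥_zz`. The result is not normalized at `s`; its
right inverses allow any value to be prescribed later. -/
theorem exists_local_propagator {κt : ℝ} {g : ℝ → Moments n} (hg : Q.IsHESSolution κt g) (s : ℝ) :
    ∃ δ > 0, ∃ V : ℝ → Sch n →L[ℂ] Sch n,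
      (∀ t, ∃ R : Sch n →L[ℂ] Sch n, ∀ f, V t (R f) = f) ∧
      ∀ t ∈ Set.Ioo (s - δ) (s + δ), ∀ f, Q.IsPointwiseLaseAt κt g (fun τ => V τ f) t := by
  have hz := hg.contDiff.1
  have hhz := fun j => contDiff_hz (Q := Q) (κt := κt) le_rfl hz j
  have hσ : Continuous fun t => -(Complex.I / Q.hbar) *
      ((Q.h0 κt t (g t) - ((g t).1 ∘ Sum.inl) ⬝ᵥ (Q.hz κt t (g t).1 ∘ Sum.inl) : ℝ) : ℂ) := by
    refine continuous_const.mul (Complex.continuous_ofReal.comp (hg.contDiff_h0.continuous.sub ?_))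
    simp only [dotProduct, Function.comp_apply]
    exact continuous_finsetSum _ fun j _ => (hz _).continuous.mul (hhz _).continuous
  obtain ⟨δ, hδ, γ, hγ⟩ := exists_wave (Q.hzz_isSymm κt) (Q.continuous_hzz κt) hσ
    (fun t => (g t).1 ∘ Sum.inl) (fun t => (g t).1 ∘ Sum.inr) s
  have hb : ∀ j k, ContinuousOn (fun t => ((γ t).A * (Q.hzz κt t).toBlocks₁₁ *
      (γ t).A.transpose) j k) (Set.Ioo (s - δ) (s + δ)) := fun j k t ht => by
    refine ContinuousAt.continuousWithinAt ?_
    have hA := (hγ t ht).2.2.2.1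
    simp only [Matrix.mul_apply, Matrix.transpose_apply]
    exact tendsto_finsetSum _ fun l _ => (tendsto_finsetSum _ fun m _ =>
      (hA j m).continuousAt.mul (Q.continuous_hzz κt _ _).continuousAt).mul (hA k l).continuousAt
  have hsymm : ∀ t, ((γ t).A * (Q.hzz κt t).toBlocks₁₁ * (γ t).A.transpose).IsSymm := fun t => by
    have : (Q.hzz κt t).toBlocks₁₁.transpose = (Q.hzz κt t).toBlocks₁₁ := by
      ext j k; exact (Q.hzz_isSymm κt t).apply _ _
    rw [Matrix.IsSymm, Matrix.transpose_mul, Matrix.transpose_mul, Matrix.transpose_transpose, this,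
      Matrix.mul_assoc]
  obtain ⟨F, hFR, hF⟩ := exists_free_evolution Q.hbar hb hsymm
  refine ⟨δ, hδ, fun t => (γ t).op Q.hbar ∘L F t, fun t => ?_, fun t ht f => ⟨?_, fun x => ?_⟩⟩
  · obtain ⟨R, hR⟩ := (γ t).exists_op_comp_eq_one Q.hbar
    obtain ⟨R', hR'⟩ := hFR t
    exact ⟨R' ∘L R, fun f => by simp [hR, hR']⟩
  all_goals
    have hI : ∀ᶠ τ in 𝓝 t, τ ∈ Set.Ioo (s - δ) (s + δ) := isOpen_Ioo.mem_nhds ht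
    obtain ⟨e1, e2, h3, h4, h5, h6⟩ := hγ t ht
    have hP : ∀ j, HasDerivAt (fun τ => (γ τ).P j) (-(Q.hz κt t (g t).1) (Sum.inr j)) t :=
      fun j => by
        have h := (hg.1 t (Sum.inl j)).congr_of_eventuallyEq
          (hI.mono fun τ hτ => congrFun (hγ τ hτ).1 j)
        refine h.congr_deriv ?_
        simp [Matrix.J, Matrix.mulVec, dotProduct, Matrix.one_apply]
    have hX : ∀ j, HasDerivAt (fun τ => (γ τ).X j) (Q.hz κt t (g t).1 (Sum.inl j)) t :=
      fun j => by
        have h := (hg.1 t (Sum.inr j)).congr_of_eventuallyEq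
          (hI.mono fun τ hτ => congrFun (hγ τ hτ).2.1 j)
        refine h.congr_deriv ?_
        simp [Matrix.J, Matrix.mulVec, dotProduct, Matrix.one_apply]
  · have hB : ∀ j k, ContinuousAt (fun τ => (γ τ).B j k) t := fun j k =>
      continuousAt_pi.1 (continuousAt_pi.1 h5 j) k
    exact Wave.locBdd_op (γ := γ) (f := fun τ => F τ f) Q.hbar
      (exists_eventually_norm_le (c := fun τ => Complex.exp (γ τ).s) h3.continuousAt.cexp)
      (fun j => exists_eventually_norm_ofReal_le (c := fun τ => (γ τ).P j) (hP j).continuousAt)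
      (fun j => exists_eventually_norm_ofReal_le (c := fun τ => (γ τ).X j) (hX j).continuousAt)
      (fun j k => exists_eventually_norm_ofReal_le (c := fun τ => (γ τ).A j k)
        (h4 j k).continuousAt)
      (fun j k => exists_eventually_norm_ofReal_le (c := fun τ => (γ τ).B j k) (hB j k))
      (fun j k => exists_eventually_norm_ofReal_le (c := fun τ => (γ τ).C j k)
        (h6 j k).continuousAt) (LocBdd.of_tendsto (hF t ht f).continuousAt)
  · have h := hasDerivAt_wave Q.hbar_pos.ne' (γ := γ) (c := Q.h0 κt t (g t))
      (v := Q.hz κt t (g t).1) (Q.hzz_isSymm κt t) (by rw [e1]; exact h3) hP hX h4 h6 (hF t ht f) x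
    rw [e1, e2, Sum.elim_comp_inl_inr] at h
    exact h

/-- The gluing theorem is applied with operators as the state space and value `1` at time `s`,
uniqueness coming from conservation of the norm. Smoothness follows since the coefficients along an
HES solution are smooth. -/
theorem exists_isGreen {κt : ℝ} {g : ℝ → Moments n} (hg : Q.IsHESSolution κt g) (s : ℝ) :
    ∃ G, Q.IsGreen κt s g G := by
  obtain ⟨G, hGs, hG⟩ := exists_global
    (P := fun (G : ℝ → Sch n →L[ℂ] Sch n) t => ∀ f, Q.IsPointwiseLaseAt κt g (fun τ => G τ f) t)
    (fun G G' t he h f => by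
      have he' : (fun τ => G' τ f) =ᶠ[𝓝 t] fun τ => G τ f := he.mono fun τ hτ => by
        simp only [hτ]
      refine ⟨fun k m => ?_, fun x => ?_⟩
      · obtain ⟨C, hC⟩ := (h f).1 k m
        exact ⟨C, hC.mp (he'.mono fun τ h1 h2 => by simpa only [h1] using h2)⟩
      · have h1 := ((h f).2 x).congr_of_eventuallyEq
          (f₁ := fun τ => G' τ f x) (he'.mono fun τ hτ => congrArg (fun φ : Sch n => φ x) hτ)
        have h2 : G' t f = G t f := he'.self_of_nhds
        dsimp only at h1 ⊢
        rwa [h2])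
    (fun G G' a b c hc h h' he t ht => ContinuousLinearMap.ext fun f =>
      IsLaseAt.unique (fun t ht => IsPointwiseLaseAt.isLaseAt hg (fun t ht => h t ht f) ht)
        (fun t ht => IsPointwiseLaseAt.isLaseAt hg (fun t ht => h' t ht f) ht) hc
        (by rw [he]) ht)
    (fun s => by
      obtain ⟨δ, hδ, V, hR, hV⟩ := exists_local_propagator hg s
      refine ⟨δ, hδ, fun c hc A => ?_⟩
      obtain ⟨R, hR⟩ := hR c
      -- As `V c ∘ R = 1`, this local solution takes the prescribed operator value `A` at time `c`.
      exact ⟨fun t => V t ∘L R ∘L A, ContinuousLinearMap.ext fun f => by simp [hR],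
        fun t ht f => hV t ht (R (A f))⟩)
    s (1 : Sch n →L[ℂ] Sch n)
  have hsm : ∀ f, IsSmoothCurve fun t => G t f := fun f =>
    isSmoothCurve_of_pointwise_equation
      (c := fun i t => -(Complex.I / Q.hbar) * (Q.laseCoeff κt t (g t) i : ℂ))
      (fun i => contDiff_const.mul (Complex.ofRealCLM.contDiff.comp (hg.contDiff_laseCoeff i)))
      (quadBasis Q.hbar) (fun t => (hG t f).1) (fun t x => by
        have h := (hG t f).2 x
        rw [laseOp_apply, Finset.smul_sum] at h
        simpa only [smul_smul] using h)
  refine ⟨G, fun f => ⟨hsm f, fun t x => ?_, ?_⟩⟩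
  · rw [lase_coe, deriv_eq_iff]
    exact ((hG t f).2 x).deriv
  · have h := (hsm f).continuous.tendsto s
    simp only [hGs, one_apply_eq_self] at h
    exact h

theorem IsGreen.isLaseAt {κt s : ℝ} {g : ℝ → Moments n} {G : ℝ → Sch n →L[ℂ] Sch n}
    (hG : Q.IsGreen κt s g G) (f : Sch n) (t : ℝ) : Q.IsLaseAt κt g (fun t => G t f) t := by
  obtain ⟨hs, he, -⟩ := hG f
  obtain ⟨v, -, hv⟩ := hs.exists_deriv
  have h1 : v t = (-(Complex.I / Q.hbar)) • Q.laseOp κt t (g t) (G t f) := by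
    ext x
    have h2 := he t x
    rw [lase_coe, deriv_eq_iff, ((hv t).apply x).deriv] at h2
    exact h2
  have := hv t
  rw [h1] at this
  exact this

theorem IsGreen.apply_self {κt s : ℝ} {g : ℝ → Moments n} {G : ℝ → Sch n →L[ℂ] Sch n}
    (hG : Q.IsGreen κt s g G) (f : Sch n) : G s f = f :=
  tendsto_nhds_unique ((hG f).1.continuous.tendsto s) (hG f).2.2

/-- The Green operator of the linear associated Schrödinger equation exists and is unique. -/
theorem existsUnique_isGreen {κt : ℝ} {g : ℝ → Moments n} (hg : Q.IsHESSolution κt g) (s : ℝ) :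
    ∃! G, Q.IsGreen κt s g G := by
  obtain ⟨G, hG⟩ := exists_isGreen hg s
  refine ⟨G, hG, fun G' hG' => ?_⟩
  funext t
  refine ContinuousLinearMap.ext fun f => ?_
  have h := IsLaseAt.eq_of_eq (hG'.isLaseAt f) (hG.isLaseAt f) (s := s)
    (by simp only [hG'.apply_self, hG.apply_self])
  exact congrFun h t

theorem isGreen_green {κt : ℝ} {g : ℝ → Moments n} (hg : Q.IsHESSolution κt g) (s : ℝ) :
    Q.IsGreen κt s g (Q.green κt s g) :=
  Classical.epsilon_spec (exists_isGreen hg s)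

/-- Every solution of the linear associated Schrödinger equation is given by the Green operator. -/
theorem green_apply_eq {κt : ℝ} {g : ℝ → Moments n} (hg : Q.IsHESSolution κt g) {u : ℝ → Sch n}
    (hu : ∀ t, Q.IsLaseAt κt g u t) (s t : ℝ) : Q.green κt s g t (u s) = u t :=
  congrFun (IsLaseAt.eq_of_eq (fun t => (isGreen_green hg s).isLaseAt (u s) t) hu (s := s)
    ((isGreen_green hg s).apply_self (u s))) t

end Data

end NonlocalGPE
end

/-! ### The nonlinear evolution operator, its inverse, and the symmetry operators. -/

noncomputable section

namespace NonlocalGPE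

open Filter

variable {n : ℕ}

namespace Data

variable (Q : Data n)

/-! ### The nonlinear evolution operator and the symmetry operators -/

theorem evol_self (s : ℝ) (χ : Sch n) : Q.evol s s χ = χ :=
  (isGreen_green (Q.hes_spec _ s _).1 s).apply_self χ

/-- The nonlinear evolution operator produces solutions of the nonlocal equation. -/
theorem evol_spec (s : ℝ) (χ : Sch n) : IsSmoothCurve (fun t => Q.evol t s χ) ∧
    ∀ t, HasCurveDerivAt (fun t => Q.evol t s χ)
      ((-(Complex.I / Q.hbar)) • Q.gpeOp t (Q.evol t s χ) (Q.evol t s χ)) t := by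
  set κt := Q.kappa * normSq χ with hκ
  obtain ⟨hg, hgs⟩ := Q.hes_spec κt s (moments Q.hbar χ)
  set g := Q.hes κt s (moments Q.hbar χ) with hgdef
  have hG := isGreen_green hg s
  have hu : ∀ t, Q.IsLaseAt κt g (fun t => Q.evol t s χ) t := hG.isLaseAt χ
  refine ⟨(hG χ).1, fun t => ?_⟩
  suffices h : Q.gpeOp t (Q.evol t s χ) (Q.evol t s χ) = Q.laseOp κt t (g t) (Q.evol t s χ) by
    rw [h]; exact hu t
  have hN : normSq (Q.evol t s χ) = normSq χ := by
    have := IsLaseAt.normSq_eq (fun t _ => hu t) (mem_Ioo_cover t s).1 (mem_Ioo_cover t s).2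
    rwa [Q.evol_self] at this
  -- For the zero state the HES trajectory starting from zero moments need not stay at the
  -- conventional moments of zero, but both operators then act on zero.
  by_cases hχ : χ = 0
  · have : Q.evol t s χ = 0 := eq_zero_of_normSq_eq_zero (by rw [hN, hχ]; exact normSq_zero)
    rw [this, map_zero, map_zero]
  · have hm : moments Q.hbar (Q.evol t s χ) = g t :=
      IsLaseAt.moments_eq hg hu (s := s) (by rwa [Q.evol_self]) (by rw [Q.evol_self, hgs]) t
    rw [gpeOp_eq_laseOp, hN, hm]

theorem isGPESolution_evol (χ : Sch n) : Q.IsGPESolution fun t => Q.evol t 0 χ :=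
  Q.isGPESolution_of_hasCurveDerivAt (Q.evol_spec 0 χ).1 (Q.evol_spec 0 χ).2

variable {Q}

/-- The inverse evolution operator recovers the earlier values of a curve generated by the nonlocal
equation. -/
theorem evolInv_eq {u : ℝ → Sch n}
    (hu : ∀ t, HasCurveDerivAt u ((-(Complex.I / Q.hbar)) • Q.gpeOp t (u t) (u t)) t) (t s : ℝ) :
    Q.evolInv t s (u t) = u s := by
  have hN := normSq_eq_of_gpe hu
  by_cases h0 : u t = 0
  · have hs : u s = 0 := eq_zero_of_normSq_eq_zero (by rw [hN s t, h0]; exact normSq_zero)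
    rw [h0, hs, evolInv, map_zero]
  · have h00 : u 0 ≠ 0 := fun h => h0 (eq_zero_of_normSq_eq_zero (by
      rw [hN t 0, h]; exact normSq_zero))
    obtain ⟨h1, h2⟩ := lase_of_gpe hu (κt := Q.kappa * normSq (u t)) fun r => by rw [hN t r]
    -- By uniqueness for the HES, the trajectory prescribed at time `t` is the moment curve of `u`
    -- itself, so the Green operator propagates `u` back to time `s`.
    have hg := Q.hes_eq (h2 h00) (s := t) rfl
    rw [evolInv, hg]
    exact green_apply_eq (h2 h00) h1 t s

theorem evolInv_evol (t s : ℝ) (χ : Sch n) : Q.evolInv t s (Q.evol t s χ) = χ := by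
  have := evolInv_eq (Q.evol_spec s χ).2 t s
  rwa [Q.evol_self] at this

/-- Pulling a solution back to time zero gives its initial value whatever `t` is, so the transformed
curve is a single evolution orbit. -/
theorem symOp_eq {u : ℝ → Sch n} (hu : Q.IsGPESolution u) (a : Sch n → Sch n) (t : ℝ) :
    Q.symOp a t (u t) = Q.evol t 0 (a (u 0)) := by
  rw [symOp, evolInv_eq hu.hasCurveDerivAt]

theorem isGPESolution_symOp {u : ℝ → Sch n} (hu : Q.IsGPESolution u) (a : Sch n → Sch n) :
    Q.IsGPESolution fun t => Q.symOp a t (u t) := by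
  simp only [symOp_eq hu]
  exact Q.isGPESolution_evol _

end Data

/-- An operator exponential is a one-parameter group. -/
theorem IsOperatorExp.add_apply {hbar : ℝ} (h : 0 < hbar) {b : Sch n → Sch n}
    {E : ℝ → Sch n → Sch n} (hE : IsOperatorExp hbar b E) (α β : ℝ) (χ : Sch n) :
    E (α + β) χ = E α (E β χ) := by
  have hmem : ∀ ψ : Sch n, ψ ∈ P0 hbar := fun ψ => by rw [P0_eq_univ h]; trivial
  -- The shifted curve solves the same autonomous equation with initial value `E β χ`; uniqueness
  -- identifies it with the exponential.
  have h1 := hE.2.2 (fun α => E (α + β) χ) (fun α => ⟨hmem _, by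
    have h2 := (hE.2.1 χ (hmem χ)).2 (α + β)
    unfold HasCurveDerivAt at h2 ⊢
    simpa only [add_right_comm α _ β] using h2⟩) α
  simpa using h1

end NonlocalGPE
end

theorem mainTheorem7 (n : ℕ) (Q : NonlocalGPE.Data n) :
    -- the evolution operator is well defined
    (∀ (κt s : ℝ) (g₀ : NonlocalGPE.Moments n),
      ∃! g : ℝ → NonlocalGPE.Moments n, Q.IsHESSolution κt g ∧ g s = g₀) ∧
    (∀ (κt s : ℝ) (g : ℝ → NonlocalGPE.Moments n), Q.IsHESSolution κt g →
      ∃! G : ℝ → NonlocalGPE.Sch n →L[ℂ] NonlocalGPE.Sch n, Q.IsGreen κt s g G) ∧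
    -- symmetry operators
    (∀ a : NonlocalGPE.Sch n → NonlocalGPE.Sch n,
      Set.MapsTo a (NonlocalGPE.P0 Q.hbar) (NonlocalGPE.P0 Q.hbar) →
      ∀ Ψ : ℝ → NonlocalGPE.Sch n, Q.IsGPESolution Ψ →
        Q.IsGPESolution (fun t => Q.symOp a t (Ψ t))) ∧
    -- one-parameter families of symmetry operators
    (∀ (b : NonlocalGPE.Sch n → NonlocalGPE.Sch n)
      (E : ℝ → NonlocalGPE.Sch n → NonlocalGPE.Sch n),
      Set.MapsTo b (NonlocalGPE.P0 Q.hbar) (NonlocalGPE.P0 Q.hbar) →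
      NonlocalGPE.IsOperatorExp Q.hbar b E →
      (∀ (α : ℝ) (Ψ : ℝ → NonlocalGPE.Sch n), Q.IsGPESolution Ψ →
        Q.IsGPESolution (fun t => Q.symOp (E α) t (Ψ t))) ∧
      (∀ Ψ ∈ NonlocalGPE.Pt Q.hbar, ∀ α β t : ℝ,
        Q.symOp (E (α + β)) t (Ψ t) = Q.symOp (E α) t (Q.symOp (E β) t (Ψ t)))) := by
  refine ⟨fun κt s g₀ => Q.existsUnique_isHESSolution κt s g₀,
    fun κt s g hg => NonlocalGPE.Data.existsUnique_isGreen hg s,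
    fun a _ Ψ hΨ => NonlocalGPE.Data.isGPESolution_symOp hΨ a,
    fun b E _ hE => ⟨fun α Ψ hΨ => NonlocalGPE.Data.isGPESolution_symOp hΨ (E α),
      fun Ψ _ α β t => ?_⟩⟩
  -- In the composition the inner `evolInv` cancels the preceding `evol`, leaving `E α (E β ·)`
  -- between the outer evolutions.
  simp only [NonlocalGPE.Data.symOp, NonlocalGPE.Data.evolInv_evol, hE.add_apply Q.hbar_pos]
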